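/- Let $k$ be an algebraically closed field of characteristic $0$, let $s\ge 0$ and let $V=V(\mathfrak a_s)$ be the exterior algebra over $k$ on $x_1,\dots,x_s$, with its $\mathbb Z/2$-grading. All $V$-modules are finite-dimensional supermodules; a homogeneous map $f:M\to N$ of parity $|f|$ is a $k$-linear map with $f(M_q)\subseteq N_{q+|f|}$ and $f(am)=(-1)^{|f||a|}a f(m)$. For a field extension $K/k$ and $0\ne\alpha=(\lambda_1,\dots,\lambda_s)\in K^s$ let $\bar\alpha\in\mathbb P^{s-1}=\operatorname{Proj}k[Y_1,\dots,Y_s]$ be the point with homogeneous coordinates $\alpha$, let $x_\alpha=\sum_i\lambda_i x_i$ act on $K\otimes_k M$, and put $$\mathcal F_{1,\alpha}(M)=\operatorname{Ker}x_\alpha/\operatorname{Im}x_\alpha,\qquad \mathcal F_{2,\alpha}(M)=\operatorname{Im}x_\alpha ,$$ which are super vector spaces over $K$. For $\alpha\in k^s\setminus\{0\}$ write $M_{x_\alpha}=\operatorname{Ker}x_\alpha/\operatorname{Im}x_\alpha$, a subquotient of $M$. The module $M$ is of constant Jordan type $(a_{ev}|a_{od})[1]+a_2[2]$ if for every $\alpha\in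 k^s\setminus\{0\}$ the restriction of $M$ to $\langle x_\alpha\rangle$ is isomorphic to $k_{ev}^{\oplus a_{ev}}\oplus k_{od}^{\oplus a_{od}}\oplus P^{\oplus a_2}$, where $k_{ev},k_{od}$ are the trivial modules in even and odd degree, and each copy of $P$ is, up to parity change, the free module $\langle p,x_\alpha p\rangle$ of rank one. Let $\tilde M(j)=M\otimes\mathcal O(j)$ on $\mathbb P^{s-1}$ and $\theta_M:\tilde M(j)\to\tilde M(j+1)$, $\theta_M(m\otimes f)=\sum_i x_i m\otimes Y_i f$, so that $\theta_M^2=0$. Define the sheaves of supermodules $\mathcal F_1(M)=\operatorname{Ker}\theta_M/\operatorname{Im}\theta_M$ and $\mathcal F_2(M)=\operatorname{Im}\theta_M$, as subquotients of $\tilde M=\tilde M(0)$; for a homogeneous map $f$ let $\mathcal F_i(f)$ be the map induced by $f\otimes\operatorname{id}:\tilde M\to\tilde N$ (with $(-1)^{|f|}f\otimes\operatorname{id}$ on $\tilde M(\pm1)$). **Theorem.** Let $M$ be a $V$-module of constant Jordan type $(a_{ev}|a_{od})[1]+a_2[2]$. 1. $\mathcal F_1(M)$ is a super vector bundle of rank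 $(a_{ev}|a_{od})$ on $\mathbb P^{s-1}$ (that is, locally free, with even part of rank $a_{ev}$ and odd part of rank $a_{od}$), and for every $\alpha\in k^s\setminus\{0\}$ its fibre over $\bar\alpha$ is isomorphic, as a super vector space, to $M_{x_\alpha}$. 2. $\mathcal F_2(M)$ is a vector bundle of rank $a_2$ on $\mathbb P^{s-1}$, and for every $\alpha\in k^s\setminus\{0\}$ and every decomposition $M|_{\langle x_\alpha\rangle}\cong k_{ev}^{\oplus a_{ev}}\oplus k_{od}^{\oplus a_{od}}\oplus P^{\oplus a_2}$ its fibre over $\bar\alpha$ is isomorphic to the socle of the $\langle x_\alpha\rangle$-module $P^{\oplus a_2}$. 3. For $i=1,2$ the construction $\mathcal F_i$ is functorial: $\mathcal F_i(\operatorname{id})=\operatorname{id}$ and $\mathcal F_i(g\circ f)=\mathcal F_i(g)\circ\mathcal F_i(f)$ for all homogeneous maps of finite-dimensional supermodules. If moreover $f:M\to N$ is a homogeneous map between modules of constant Jordan type (of possibly different types), then for every field extension $K/k$ and every $\alpha\in K^s\setminus\{0\}$ evaluation at $\alpha$ induces isomorphisms $\mathcal F_i(M)\otimes_{\mathcal O}K\cong\mathcal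 F_{i,\alpha}(M)$ and $\mathcal F_i(N)\otimes_{\mathcal O}K\cong\mathcal F_{i,\alpha}(N)$, where $\mathcal O_{\bar\alpha}\to K$ is evaluation at $\alpha$, and the square $$\begin{array}{ccc}\mathcal F_i(M)\otimes_{\mathcal O}K&\longrightarrow&\mathcal F_i(N)\otimes_{\mathcal O}K\\ \downarrow\cong&&\downarrow\cong\\ \mathcal F_{i,\alpha}(M)&\longrightarrow&\mathcal F_{i,\alpha}(N)\end{array}$$ with horizontal maps induced by $f$ commutes. (Every point $\bar\alpha$ of $\mathbb P^{s-1}$ arises in this way with $K$ its residue field.) -/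

import Mathlib

open CategoryTheory AlgebraicGeometry TopologicalSpace Opposite TensorProduct
universe u

noncomputable section
namespace SuperBundle

section ProjTilde

variable {k A N : Type u} [Field k] [CommRing A] [Algebra k A]
  (𝒜 : ℕ → Submodule k A) [GradedAlgebra 𝒜] [AddCommGroup N] [Module A N]
  (𝒩 : ℕ → AddSubgroup N)

/-- The localization `N_x` of an `A`-module `N` at a point `x` of `Proj A`. -/
abbrev LocalizedAt (N : Type u) [AddCommGroup N] [Module A N]
    (x : ProjectiveSpectrum 𝒜) : Type u :=
  LocalizedModule x.asHomogeneousIdeal.toIdeal.primeCompl N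

/-- `v = n / b` in `N_x`, with `b` not in the homogeneous prime `x`. -/
def IsFractionAt (x : ProjectiveSpectrum 𝒜) (n : N) (b : A) (v : LocalizedAt 𝒜 N x) : Prop :=
  ∃ hb : b ∈ x.asHomogeneousIdeal.toIdeal.primeCompl, v = LocalizedModule.mk n ⟨b, hb⟩

variable {𝒜} in
/-- `f = n / b` on `U`, with `n` and `b` homogeneous of the same degree. -/
def IsGradedFraction {U : Opens (ProjectiveSpectrum.top 𝒜)}
    (f : ∀ x : U, LocalizedAt 𝒜 N x.1) : Prop :=
  ∃ (d : ℕ) (n : N) (b : A), n ∈ 𝒩 d ∧ b ∈ 𝒜 d ∧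
    ∀ x : U, IsFractionAt 𝒜 x.1 n b (f x)

/-- Being a homogeneous fraction of degree zero, as a prelocal predicate. -/
def gradedFractionPrelocal :
    TopCat.PrelocalPredicate (X := ProjectiveSpectrum.top 𝒜)
      (fun x => LocalizedAt 𝒜 N x) where
  pred f := IsGradedFraction 𝒩 f
  res := by
    rintro V U i f ⟨d, n, b, hn, hb, w⟩
    exact ⟨d, n, b, hn, hb, fun x => w (i x)⟩

/-- Being locally a homogeneous fraction of degree zero. -/
def gradedLocallyFraction :
    TopCat.LocalPredicate (X := ProjectiveSpectrum.top 𝒜) (fun x => LocalizedAt 𝒜 N x) :=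
  (gradedFractionPrelocal 𝒜 𝒩).sheafify

variable [SetLike.GradedSMul 𝒜 𝒩]

/-- The sections of `Ñ` over `U`: the functions `x ↦ f x ∈ N_x` which are locally of the form
`n / b` with `n ∈ 𝒩 d` and `b ∈ 𝒜 d`. -/
def projSections (U : Opens (ProjectiveSpectrum.top 𝒜)) :
    AddSubgroup (∀ x : U, LocalizedAt 𝒜 N x.1) where
  carrier := {f | (gradedLocallyFraction 𝒜 𝒩).pred f}
  add_mem' {f g} hf hg x := by
    obtain ⟨V, mV, iV, d, n, b, hn, hb, w⟩ := hf x
    obtain ⟨V', mV', iV', d', n', b', hn', hb', w'⟩ := hg x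
    refine ⟨V ⊓ V', ⟨mV, mV'⟩, Opens.infLELeft _ _ ≫ iV, d + d', b' • n + b • n', b * b',
      ?_, SetLike.mul_mem_graded hb hb', fun y => ?_⟩
    · refine add_mem ?_ ?_
      · rw [add_comm]; exact SetLike.GradedSMul.smul_mem hb' hn
      · exact SetLike.GradedSMul.smul_mem hb hn'
    · obtain ⟨h, e⟩ := w ⟨y.1, y.2.1⟩
      obtain ⟨h', e'⟩ := w' ⟨y.1, y.2.2⟩
      exact ⟨Submonoid.mul_mem _ h h', (congrArg₂ (· + ·) e e').trans
        (LocalizedModule.mk_add_mk ..)⟩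
  zero_mem' x := ⟨U, x.2, 𝟙 _, 0, 0, 1, zero_mem _, SetLike.GradedOne.one_mem, fun y =>
    ⟨Submonoid.one_mem _, (LocalizedModule.zero_mk _).symm⟩⟩
  neg_mem' {f} hf x := by
    obtain ⟨V, mV, iV, d, n, b, hn, hb, w⟩ := hf x
    refine ⟨V, mV, iV, d, -n, b, neg_mem hn, hb, fun y => ?_⟩
    obtain ⟨h, e⟩ := w y
    exact ⟨h, (congrArg (- ·) e).trans (LocalizedModule.mk_neg (M := N)).symm⟩

theorem smul_mem_projSections (U : Opens (ProjectiveSpectrum.top 𝒜))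
    (r : (ProjectiveSpectrum.Proj.structureSheaf 𝒜).1.obj (op U))
    (f : ∀ x : U, LocalizedAt 𝒜 N x.1) (hf : f ∈ projSections 𝒜 𝒩 U) :
    (fun x => HomogeneousLocalization.val (r.1 x) • f x) ∈ projSections 𝒜 𝒩 U := by
  intro x
  obtain ⟨V, mV, iV, d, n, b, hn, hb, w⟩ := hf x
  obtain ⟨V', mV', iV', d', a, c, hc, w'⟩ := r.2 x
  refine ⟨V ⊓ V', ⟨mV, mV'⟩, Opens.infLELeft _ _ ≫ iV, d' + d, a.1 • n, c.1 * b,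
      SetLike.GradedSMul.smul_mem a.2 hn, SetLike.mul_mem_graded c.2 hb, fun y => ?_⟩
  obtain ⟨h, e⟩ := w ⟨y.1, y.2.1⟩
  have e' := w' ⟨y.1, y.2.2⟩
  refine ⟨Submonoid.mul_mem _ (hc ⟨y.1, y.2.2⟩) h, ?_⟩
  have e'' := congrArg HomogeneousLocalization.val e'
  rw [HomogeneousLocalization.val_mk] at e''
  exact (congrArg₂ (fun (p : Localization _) (q : LocalizedAt 𝒜 N _) => p • q) e'' e).trans
    (LocalizedModule.mk_smul_mk ..)

/-- `Ñ` as a sheaf of types. -/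
def projTildeInType : TopCat.Sheaf (Type u) (ProjectiveSpectrum.top 𝒜) :=
  TopCat.subsheafToTypes (gradedLocallyFraction 𝒜 𝒩)

instance (U : (Opens (ProjectiveSpectrum.top 𝒜))ᵒᵖ) :
    AddCommGroup ((projTildeInType 𝒜 𝒩).1.obj U) :=
  (projSections 𝒜 𝒩 U.unop).toAddCommGroup

instance projSectionsModule (U : (Opens (ProjectiveSpectrum.top 𝒜))ᵒᵖ) :
    Module ((ProjectiveSpectrum.Proj.structureSheaf 𝒜).1.obj U)
      ((projTildeInType 𝒜 𝒩).1.obj U) where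
  smul r f := ⟨fun x => HomogeneousLocalization.val (r.1 x) • f.1 x,
    smul_mem_projSections 𝒜 𝒩 U.unop r f.1 f.2⟩
  one_smul f := Subtype.ext <| funext fun x => by
    change HomogeneousLocalization.val (1 : HomogeneousLocalization _ _) • f.1 x = _
    rw [HomogeneousLocalization.val_one, one_smul]
  mul_smul r r' f := Subtype.ext <| funext fun x => by
    change HomogeneousLocalization.val (r.1 x * r'.1 x) • f.1 x = _ • _ • _
    rw [HomogeneousLocalization.val_mul, mul_smul]
  smul_zero r := Subtype.ext <| funext fun x => smul_zero _
  smul_add r f g := Subtype.ext <| funext fun x => smul_add _ _ _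
  add_smul r r' f := Subtype.ext <| funext fun x => by
    change HomogeneousLocalization.val (r.1 x + r'.1 x) • f.1 x = _ • _ + _ • _
    rw [HomogeneousLocalization.val_add, add_smul]
  zero_smul f := Subtype.ext <| funext fun x => by
    change HomogeneousLocalization.val (0 : HomogeneousLocalization _ _) • f.1 x = _
    rw [HomogeneousLocalization.val_zero, zero_smul]; rfl

/-- `Ñ` as a presheaf of abelian groups. -/
def projTildeAb : TopCat.Presheaf Ab.{u} (ProjectiveSpectrum.top 𝒜) where
  obj U := AddCommGrpCat.of ((projTildeInType 𝒜 𝒩).1.obj U)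
  map i := AddCommGrpCat.ofHom
    { toFun := (projTildeInType 𝒜 𝒩).1.map i
      map_zero' := rfl
      map_add' := fun _ _ => rfl }

/-- The sheaf `Ñ` on `Proj A` associated with a graded `A`-module `N = ⊕ 𝒩 d`. -/
def projTilde : (Proj 𝒜).Modules where
  val :=
    letI (U : (Proj 𝒜).Opensᵒᵖ) :
        Module ((Proj 𝒜).ringCatSheaf.obj.obj U) ((projTildeAb 𝒜 𝒩).obj U) :=
      projSectionsModule 𝒜 𝒩 U
    PresheafOfModules.ofPresheaf (R := (Proj 𝒜).ringCatSheaf.obj) (projTildeAb 𝒜 𝒩)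
      (fun _ _ _ _ _ => rfl)
  isSheaf := (TopCat.Presheaf.isSheaf_iff_isSheaf_comp (forget AddCommGrpCat) _).2
    (projTildeInType 𝒜 𝒩).2

variable {N' : Type u} [AddCommGroup N'] [Module A N'] {𝒩' : ℕ → AddSubgroup N'}
  [SetLike.GradedSMul 𝒜 𝒩']

/-- The localization at `x` of an `A`-linear map. -/
def localizedMap (x : ProjectiveSpectrum 𝒜) (f : N →ₗ[A] N') :
    LocalizedAt 𝒜 N x →ₗ[Localization x.asHomogeneousIdeal.toIdeal.primeCompl]
      LocalizedAt 𝒜 N' x :=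
  LocalizedModule.map x.asHomogeneousIdeal.toIdeal.primeCompl f

variable {𝒩} in
/-- The map of presheaves underlying `projTildeMap`. -/
def projTildeMapAb (f : N →ₗ[A] N') (hf : ∀ d, ∀ n ∈ 𝒩 d, f n ∈ 𝒩' d) :
    projTildeAb 𝒜 𝒩 ⟶ projTildeAb 𝒜 𝒩' where
  app U := AddCommGrpCat.ofHom
    { toFun := fun t =>
        ⟨fun x => localizedMap 𝒜 x.1 f (t.1 x), by
          intro x
          obtain ⟨V, mV, iV, d, n, b, hn, hb, w⟩ := t.2 x
          refine ⟨V, mV, iV, d, f n, b, hf d n hn, hb, fun y => ?_⟩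
          obtain ⟨h, e⟩ := w y
          exact ⟨h, (congrArg (localizedMap 𝒜 _ f) e).trans
            (LocalizedModule.map_mk ..)⟩⟩
      map_zero' := Subtype.ext <| funext fun _ => map_zero _
      map_add' := fun _ _ => Subtype.ext <| funext fun _ => map_add _ _ _ }
  naturality _ _ _ := rfl

variable {𝒩} in
/-- The morphism `Ñ ⟶ Ñ'` induced by a degree-preserving `A`-linear map `N → N'`. -/
def projTildeMap (f : N →ₗ[A] N') (hf : ∀ d, ∀ n ∈ 𝒩 d, f n ∈ 𝒩' d) :
    projTilde 𝒜 𝒩 ⟶ projTilde 𝒜 𝒩' :=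
  SheafOfModules.Hom.mk (PresheafOfModules.homMk (M₁ := (projTilde 𝒜 𝒩).val)
    (M₂ := (projTilde 𝒜 𝒩').val) (projTildeMapAb 𝒜 f hf)
    (fun _ r m => Subtype.ext <| funext fun x =>
      (localizedMap 𝒜 x.1 f).map_smul
        (HomogeneousLocalization.val (r.1 x)) (m.1 x)))

theorem localizedMap_mk (x : ProjectiveSpectrum 𝒜) (f : N →ₗ[A] N') (n : N)
    (b : x.asHomogeneousIdeal.toIdeal.primeCompl) :
    localizedMap 𝒜 x f (LocalizedModule.mk n b) = LocalizedModule.mk (f n) b :=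
  LocalizedModule.map_mk ..

theorem projTildeMap_hom_ext {f g : projTilde 𝒜 𝒩 ⟶ projTilde 𝒜 𝒩'}
    (h : ∀ (U : Opens (ProjectiveSpectrum.top 𝒜)) (t : (projTildeInType 𝒜 𝒩).1.obj (op U))
      (x : U), ((f.app U t : (projTildeInType 𝒜 𝒩').1.obj (op U)).1 x) =
        ((g.app U t : (projTildeInType 𝒜 𝒩').1.obj (op U)).1 x)) : f = g := by
  refine Scheme.Modules.hom_ext _ _ fun U => ?_
  ext t
  exact Subtype.ext (funext fun x => h U t x)

variable {N'' : Type u} [AddCommGroup N''] [Module A N''] {𝒩'' : ℕ → AddSubgroup N''}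
  [SetLike.GradedSMul 𝒜 𝒩'']

theorem localizedMap_comp (x : ProjectiveSpectrum 𝒜) (f : N →ₗ[A] N') (g : N' →ₗ[A] N'')
    (v : LocalizedAt 𝒜 N x) :
    localizedMap 𝒜 x g (localizedMap 𝒜 x f v) = localizedMap 𝒜 x (g ∘ₗ f) v := by
  induction v using LocalizedModule.induction_on with
  | h n b => simp only [localizedMap_mk, LinearMap.comp_apply]

theorem localizedMap_zero (x : ProjectiveSpectrum 𝒜) (v : LocalizedAt 𝒜 N x) :
    localizedMap 𝒜 x (0 : N →ₗ[A] N') v = 0 := by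
  induction v using LocalizedModule.induction_on with
  | h n b => rw [localizedMap_mk, LinearMap.zero_apply, LocalizedModule.zero_mk]

theorem projTildeMap_comp (f : N →ₗ[A] N') (hf : ∀ d, ∀ n ∈ 𝒩 d, f n ∈ 𝒩' d)
    (g : N' →ₗ[A] N'') (hg : ∀ d, ∀ n ∈ 𝒩' d, g n ∈ 𝒩'' d) :
    projTildeMap 𝒜 f hf ≫ projTildeMap 𝒜 g hg =
      projTildeMap 𝒜 (g ∘ₗ f) fun d n hn => hg d _ (hf d n hn) := by
  exact projTildeMap_hom_ext 𝒜 𝒩 fun U t x => localizedMap_comp 𝒜 x.1 f g (t.1 x)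

theorem projTildeMap_eq_zero (f : N →ₗ[A] N') (hf : ∀ d, ∀ n ∈ 𝒩 d, f n ∈ 𝒩' d) (h : f = 0) :
    projTildeMap 𝒜 f hf = 0 := by
  subst h
  exact projTildeMap_hom_ext 𝒜 𝒩 fun U t x => localizedMap_zero 𝒜 x.1 (t.1 x)

theorem projTildeMap_congr {f g : N →ₗ[A] N'} (h : f = g)
    (hf : ∀ d, ∀ n ∈ 𝒩 d, f n ∈ 𝒩' d) (hg : ∀ d, ∀ n ∈ 𝒩 d, g n ∈ 𝒩' d) :
    projTildeMap 𝒜 f hf = projTildeMap 𝒜 g hg := by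
  subst h; rfl

/-- The global section of `Ñ` given by an element of `N` of degree zero. -/
def projGlobalSection (n : N) (hn : n ∈ 𝒩 0) :
    (projTilde 𝒜 𝒩).presheaf.obj (op ⊤) :=
  (⟨fun _ => LocalizedModule.mk n 1, fun x => ⟨⊤, x.2, 𝟙 _, 0, n, 1, hn,
    SetLike.GradedOne.one_mem, fun _ => ⟨Submonoid.one_mem _, rfl⟩⟩⟩ :
      (projTildeInType 𝒜 𝒩).1.obj (op ⊤))

/-- The global section of the structure sheaf of `Proj A` given by an element of degree zero. -/
def projConst (a : A) (ha : a ∈ 𝒜 0) : (Proj 𝒜).presheaf.obj (op ⊤) :=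
  (⟨fun x => HomogeneousLocalization.mk ⟨0, ⟨a, ha⟩, ⟨1, SetLike.GradedOne.one_mem⟩,
      Submonoid.one_mem _⟩, fun y => ⟨⊤, y.2, 𝟙 _, 0, ⟨a, ha⟩, ⟨1, SetLike.GradedOne.one_mem⟩,
      fun y => (Ideal.ne_top_iff_one _).mp y.1.isPrime.ne_top, fun _ => rfl⟩⟩ :
    (ProjectiveSpectrum.Proj.structureSheaf 𝒜).1.obj (op ⊤))

theorem projGlobalSection_add (n n' : N) (hn : n ∈ 𝒩 0) (hn' : n' ∈ 𝒩 0) :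
    projGlobalSection 𝒜 𝒩 (n + n') (add_mem hn hn') =
      projGlobalSection 𝒜 𝒩 n hn + projGlobalSection 𝒜 𝒩 n' hn' := by
  have h (x : ProjectiveSpectrum 𝒜) : (LocalizedModule.mk (n + n') 1 : LocalizedAt 𝒜 N x) =
      LocalizedModule.mk n 1 + LocalizedModule.mk n' 1 := by
    rw [LocalizedModule.mk_add_mk, one_smul, one_smul, one_mul]
  exact Subtype.ext (funext fun x => h x.1)

theorem projGlobalSection_smul (a : A) (ha : a ∈ 𝒜 0) (n : N) (hn : n ∈ 𝒩 0)
    (han : a • n ∈ 𝒩 0) :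
    projGlobalSection 𝒜 𝒩 (a • n) han = projConst 𝒜 a ha • projGlobalSection 𝒜 𝒩 n hn := by
  have h (x : ProjectiveSpectrum 𝒜) : (LocalizedModule.mk (a • n) 1 : LocalizedAt 𝒜 N x) =
      HomogeneousLocalization.val (HomogeneousLocalization.mk ⟨0, ⟨a, ha⟩,
        ⟨1, SetLike.GradedOne.one_mem⟩, Submonoid.one_mem _⟩ : HomogeneousLocalization 𝒜
          x.asHomogeneousIdeal.toIdeal.primeCompl) •
        (LocalizedModule.mk n 1 : LocalizedAt 𝒜 N x) := by
    rw [HomogeneousLocalization.val_mk]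
    refine Eq.trans ?_ (LocalizedModule.mk_smul_mk ..).symm
    exact congrArg (LocalizedModule.mk (a • n)) (one_mul _).symm
  exact Subtype.ext (funext fun x => h x.1)

end ProjTilde

/-! ### Supermodules over the exterior algebra -/

section Super

variable (k : Type u) [Field k] (s : ℕ)

/-- `V(𝔞_s)`, the exterior algebra on `s` generators. -/
abbrev V : Type u := ExteriorAlgebra k (Fin s → k)

variable {k s} in
/-- For `α = (λ₁, …, λ_s)`, the element `x_α = λ₁ x₁ + ⋯ + λ_s x_s` of `V(𝔞_s)`. -/
def xElt (α : Fin s → k) : V k s := ExteriorAlgebra.ι k α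

/-- The homogeneous part of parity `p` of `V(𝔞_s)`. -/
abbrev Vpart (p : ZMod 2) : Submodule k (V k s) :=
  CliffordAlgebra.evenOdd (0 : QuadraticForm k (Fin s → k)) p

/-- A finite-dimensional `V(𝔞_s)`-supermodule. -/
structure SuperMod where
  /-- The underlying module. -/
  carrier : Type u
  [addCommGroup : AddCommGroup carrier]
  [moduleBase : Module k carrier]
  [module : Module (V k s) carrier]
  [isScalarTower : IsScalarTower k (V k s) carrier]
  [finiteDimensional : FiniteDimensional k carrier]
  /-- The even part (`0`) and the odd part (`1`). -/
  part : ZMod 2 → Submodule k carrier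
  isInternal : DirectSum.IsInternal part
  smul_mem : ∀ {p q : ZMod 2} {a : V k s} {m : carrier},
    a ∈ Vpart k s p → m ∈ part q → a • m ∈ part (p + q)

attribute [instance] SuperMod.addCommGroup SuperMod.moduleBase SuperMod.module
  SuperMod.isScalarTower SuperMod.finiteDimensional

variable {k s}

theorem xElt_mem (α : Fin s → k) : xElt α ∈ Vpart k s 1 :=
  CliffordAlgebra.ι_mem_evenOdd_one _ _

theorem xElt_mul_self (α : Fin s → k) : xElt α * xElt α = 0 := ExteriorAlgebra.ι_sq_zero _

theorem xElt_mul_add (α β : Fin s → k) : xElt α * xElt β + xElt β * xElt α = 0 :=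
  ExteriorAlgebra.ι_add_mul_swap _ _

namespace SuperMod

variable (M N L : SuperMod k s)

/-- The action of `x_α` as a `k`-linear endomorphism of `M`. -/
def xEnd (α : Fin s → k) : M.carrier →ₗ[k] M.carrier := Algebra.lsmul k k M.carrier (xElt α)

/-- The action of the generator `x_i`, as a map from one homogeneous part of `M` to the other. -/
def xPart (i : Fin s) {p r : ZMod 2} (h : p + 1 = r) : M.part p →ₗ[k] M.part r :=
  (M.xEnd (Pi.single i 1)).restrict fun _ hm => by
    rw [← h, add_comm]
    exact M.smul_mem (xElt_mem _) hm

theorem xPart_self (i : Fin s) {p q r : ZMod 2} (h : p + 1 = q) (h' : q + 1 = r)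
    (m : M.part p) : M.xPart i h' (M.xPart i h m) = 0 := by
  apply Subtype.ext
  change xElt (k := k) (s := s) _ • xElt (k := k) (s := s) _ • m.1 = 0
  rw [smul_smul, xElt_mul_self, zero_smul]

theorem xPart_add (i j : Fin s) {p q r : ZMod 2} (h : p + 1 = q) (h' : q + 1 = r)
    (m : M.part p) : M.xPart i h' (M.xPart j h m) + M.xPart j h' (M.xPart i h m) = 0 := by
  apply Subtype.ext
  change xElt (k := k) (s := s) _ • xElt (k := k) (s := s) _ • m.1 + xElt (k := k) (s := s) _ • xElt (k := k) (s := s) _ • m.1 = 0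
  rw [smul_smul, smul_smul, ← add_smul, xElt_mul_add, zero_smul]

end SuperMod

/-- A homogeneous map `M → N` of parity `p` of supermodules: a `k`-linear map which shifts the
parity by `p` and satisfies `f (a m) = (-1)^(|f||a|) a (f m)`. -/
structure HomogMap (p : ZMod 2) (M N : SuperMod k s) where
  /-- The underlying linear map. -/
  toLin : M.carrier →ₗ[k] N.carrier
  map_mem : ∀ {q : ZMod 2} {m : M.carrier}, m ∈ M.part q → toLin m ∈ N.part (q + p)
  map_smul : ∀ {r : ZMod 2} {a : V k s} (m : M.carrier), a ∈ Vpart k s r →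
    toLin (a • m) = (-1 : k) ^ (p.val * r.val) • a • toLin m

namespace HomogMap

variable {M N L : SuperMod k s} {p p' : ZMod 2}

/-- The identity map. -/
def id (M : SuperMod k s) : HomogMap 0 M M where
  toLin := LinearMap.id
  map_mem h := by simpa using h
  map_smul m _ := by simp

/-- Composition of homogeneous maps; parities add up. -/
def comp (g : HomogMap p' N L) (f : HomogMap p M N) : HomogMap (p + p') M L where
  toLin := g.toLin ∘ₗ f.toLin
  map_mem h := by
    rw [← add_assoc]
    exact g.map_mem (f.map_mem h)
  map_smul {r a} m ha := by
    rw [LinearMap.comp_apply, f.map_smul m ha, _root_.map_smul, g.map_smul _ ha, smul_smul,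
      LinearMap.comp_apply, ← pow_add]
    congr 1
    have key : ∀ p p' r : ZMod 2,
        (p.val * r.val + p'.val * r.val) % 2 = ((p + p').val * r.val) % 2 := by decide
    rw [neg_one_pow_eq_pow_mod_two, key, ← neg_one_pow_eq_pow_mod_two]

/-- The component `M_q → N_r` of a homogeneous map of parity `p = r - q`. -/
def part (f : HomogMap p M N) {q r : ZMod 2} (h : q + p = r) : M.part q →ₗ[k] N.part r :=
  f.toLin.restrict fun _ hm => h ▸ f.map_mem hm

theorem part_xPart (f : HomogMap p M N) (i : Fin s) {q r q' r' : ZMod 2} (h : q + p = r)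
    (h' : q' + p = r') (hq : q + 1 = q') (hr : r + 1 = r') (m : M.part q) :
    f.part h' (M.xPart i hq m) = (-1 : k) ^ p.val • N.xPart i hr (f.part h m) := by
  apply Subtype.ext
  have := f.map_smul m.1 (xElt_mem (Pi.single i 1))
  rw [ZMod.val_one, mul_one] at this
  exact this

end HomogMap

end Super

/-! ### The sheaves `M ⊗ 𝒪(j)` on projective space and the map `θ` -/

section Sheaves

variable (k : Type u) [Field k] (s : ℕ)

/-- The homogeneous coordinate ring `k[Y₁, …, Y_s]`. -/
abbrev S : Type u := MvPolynomial (Fin s) k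

/-- The grading of `k[Y₁, …, Y_s]` by the degree. -/
abbrev grading : ℕ → Submodule k (S k s) := MvPolynomial.homogeneousSubmodule (Fin s) k

instance : GradedAlgebra (grading k s) := MvPolynomial.gradedAlgebra

/-- The projective space `ℙ^(s-1)` over `k`. -/
abbrev ProjSpace : Scheme.{u} := Proj (grading k s)

variable (W W' W'' : Type u) [AddCommGroup W] [Module k W] [AddCommGroup W'] [Module k W']
  [AddCommGroup W''] [Module k W'']

/-- The component of degree `d` of the graded module `k[Y₁, …, Y_s](j) ⊗ W`: it is spanned by the
`f ⊗ w` with `f` homogeneous of degree `d + j`. -/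
def twistDeg (j : ℤ) (d : ℕ) : AddSubgroup (S k s ⊗[k] W) :=
  (Submodule.span k {t | ∃ (e : ℕ) (f : S k s) (w : W),
    (e : ℤ) = d + j ∧ f ∈ grading k s e ∧ t = f ⊗ₜ[k] w}).toAddSubgroup

variable {k s} {W W' W''}

theorem tmul_mem_twistDeg {j : ℤ} {d e : ℕ} {f : S k s} (he : (e : ℤ) = d + j)
    (hf : f ∈ grading k s e) (w : W) : f ⊗ₜ[k] w ∈ twistDeg k s W j d :=
  Submodule.subset_span ⟨e, f, w, he, hf, rfl⟩

theorem map_mem_twistDeg {j j' : ℤ} {d d' : ℕ} (g : S k s ⊗[k] W →ₗ[k] S k s ⊗[k] W')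
    (hg : ∀ (e : ℕ) (f : S k s) (w : W), (e : ℤ) = d + j → f ∈ grading k s e →
      g (f ⊗ₜ[k] w) ∈ twistDeg k s W' j' d') :
    ∀ n ∈ twistDeg k s W j d, g n ∈ twistDeg k s W' j' d' := by
  intro n hn
  have : Submodule.span k {t | ∃ (e : ℕ) (f : S k s) (w : W),
      (e : ℤ) = d + j ∧ f ∈ grading k s e ∧ t = f ⊗ₜ[k] w} ≤
      (Submodule.span k {t | ∃ (e : ℕ) (f : S k s) (w : W'),
      (e : ℤ) = d' + j' ∧ f ∈ grading k s e ∧ t = f ⊗ₜ[k] w}).comap g := by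
    rw [Submodule.span_le]
    rintro _ ⟨e, f, w, he, hf, rfl⟩
    exact hg e f w he hf
  exact this hn

instance (j : ℤ) : SetLike.GradedSMul (grading k s) (twistDeg k s W j) where
  smul_mem {i d a n} ha hn := by
    refine map_mem_twistDeg (Algebra.lsmul k k (S k s ⊗[k] W) a) ?_ n hn
    intro e f w he hf
    change (a • f) ⊗ₜ[k] w ∈ _
    refine tmul_mem_twistDeg (e := i + e) ?_ (SetLike.mul_mem_graded ha hf) w
    rw [vadd_eq_add]; push_cast; omega

variable (k s W) in
/-- The sheaf `W ⊗ 𝒪(j)` on `ℙ^(s-1)`, for a vector space `W`: the sheaf associated with the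
graded module `W ⊗ k[Y₁, …, Y_s](j)`. -/
def twist (j : ℤ) : (ProjSpace k s).Modules := projTilde (grading k s) (twistDeg k s W j)

/-- The map `g ⊗ id : W ⊗ 𝒪(j) ⟶ W' ⊗ 𝒪(j)`. -/
def twistMap (g : W →ₗ[k] W') (j : ℤ) : twist k s W j ⟶ twist k s W' j :=
  projTildeMap (grading k s) (g.baseChange (S k s)) fun _ =>
    map_mem_twistDeg ((g.baseChange (S k s)).restrictScalars k) fun _ _ w he hf =>
      tmul_mem_twistDeg he hf (g w)

/-- For linear maps `x_i : W → W'`, the map `w ⊗ f ↦ ∑ x_i w ⊗ Y_i f`. -/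
def koszulLin (x : Fin s → (W →ₗ[k] W')) : S k s ⊗[k] W →ₗ[S k s] S k s ⊗[k] W' :=
  ∑ i, (MvPolynomial.X i : S k s) • (x i).baseChange (S k s)

theorem koszulLin_ext {g g' : S k s ⊗[k] W →ₗ[S k s] S k s ⊗[k] W'}
    (h : ∀ f w, g (f ⊗ₜ[k] w) = g' (f ⊗ₜ[k] w)) : g = g' :=
  LinearMap.ext fun n => by
    induction n using TensorProduct.induction_on with
    | zero => rw [map_zero, map_zero]
    | tmul f w => exact h f w
    | add a b ha hb => rw [map_add, map_add, ha, hb]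

theorem koszulLin_tmul (x : Fin s → (W →ₗ[k] W')) (f : S k s) (w : W) :
    koszulLin x (f ⊗ₜ[k] w) = ∑ i, (MvPolynomial.X i * f) ⊗ₜ[k] x i w := by
  simp [koszulLin, TensorProduct.smul_tmul']

theorem koszulLin_mem (x : Fin s → (W →ₗ[k] W')) {j j' : ℤ} (hj : j + 1 = j') (d : ℕ) :
    ∀ n ∈ twistDeg k s W j d, koszulLin x n ∈ twistDeg k s W' j' d :=
  map_mem_twistDeg ((koszulLin x).restrictScalars k) fun e f w he hf => by
    rw [LinearMap.restrictScalars_apply, koszulLin_tmul]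
    refine sum_mem fun i _ => tmul_mem_twistDeg (e := 1 + e) (by push_cast; omega) ?_ _
    exact SetLike.mul_mem_graded (MvPolynomial.isHomogeneous_X k i) hf

/-- The morphism `W ⊗ 𝒪(j) ⟶ W' ⊗ 𝒪(j + 1)`, `w ⊗ f ↦ ∑ x_i w ⊗ Y_i f`. -/
def koszulMap (x : Fin s → (W →ₗ[k] W')) {j j' : ℤ} (hj : j + 1 = j') :
    twist k s W j ⟶ twist k s W' j' :=
  projTildeMap (grading k s) (koszulLin x) (koszulLin_mem x hj)

/-- The morphism `θ_M : M̃(j) ⟶ M̃(j + 1)`, `m ⊗ f ↦ ∑ x_i m ⊗ Y_i f`, from the part of parity `p`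
to the part of parity `r = p + 1`. -/
def theta (M : SuperMod k s) {p r : ZMod 2} (h : p + 1 = r) {j j' : ℤ} (hj : j + 1 = j') :
    twist k s (M.part p) j ⟶ twist k s (M.part r) j' :=
  koszulMap (fun i => M.xPart i h) hj

theorem theta_comp_theta (M : SuperMod k s) {p q r : ZMod 2} (h : p + 1 = q) (h' : q + 1 = r)
    {j j' j'' : ℤ} (hj : j + 1 = j') (hj' : j' + 1 = j'') :
    theta M h hj ≫ theta M h' hj' = 0 := by
  refine (projTildeMap_comp ..).trans (projTildeMap_eq_zero _ _ _ _ ?_)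
  refine koszulLin_ext fun f w => ?_
  simp only [LinearMap.coe_comp, Function.comp_apply, LinearMap.zero_apply, koszulLin_tmul,
    map_sum]
  rw [← Finset.sum_product']
  refine Finset.sum_involution (fun a _ => a.swap) (fun a _ => ?_) (fun a _ h0 h1 => h0 ?_)
    (fun a _ => by simp) (fun a _ => by simp)
  · rw [mul_left_comm, Prod.fst_swap, Prod.snd_swap, ← tmul_add, M.xPart_add, tmul_zero]
  · have h2 : a.1 = a.2 := congrArg Prod.snd h1
    rw [h2, M.xPart_self, tmul_zero]

theorem theta_comp_twistMap {M N : SuperMod k s} {p : ZMod 2} (f : HomogMap p M N)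
    {q r q' r' : ZMod 2} (h : q + p = r) (h' : q' + p = r') (hq : q + 1 = q') (hr : r + 1 = r')
    {j j' : ℤ} (hj : j + 1 = j') :
    theta M hq hj ≫ twistMap (f.part h') j' =
      twistMap ((-1 : k) ^ p.val • f.part h) j ≫ theta N hr hj := by
  refine (projTildeMap_comp ..).trans ((projTildeMap_congr _ _ ?_ _ _).trans
    (projTildeMap_comp ..).symm)
  refine koszulLin_ext fun a m => ?_
  simp only [LinearMap.coe_comp, Function.comp_apply, koszulLin_tmul, map_sum,
    LinearMap.baseChange_tmul, LinearMap.smul_apply, _root_.map_smul]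
  exact Finset.sum_congr rfl fun i _ => congrArg _ (by
    rw [f.part_xPart i h h' hq hr])

theorem theta_comp_twistMap' {M N : SuperMod k s} {p : ZMod 2} (f : HomogMap p M N)
    {q r q' r' : ZMod 2} (h : q + p = r) (h' : q' + p = r') (hq : q + 1 = q') (hr : r + 1 = r')
    {j j' : ℤ} (hj : j + 1 = j') :
    theta M hq hj ≫ twistMap ((-1 : k) ^ p.val • f.part h') j' =
      twistMap (f.part h) j ≫ theta N hr hj := by
  refine (projTildeMap_comp ..).trans ((projTildeMap_congr _ _ ?_ _ _).trans
    (projTildeMap_comp ..).symm)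
  refine koszulLin_ext fun a m => ?_
  simp only [LinearMap.coe_comp, Function.comp_apply, koszulLin_tmul, map_sum,
    LinearMap.baseChange_tmul, LinearMap.smul_apply]
  exact Finset.sum_congr rfl fun i _ => congrArg _ (by
    rw [f.part_xPart i h h' hq hr, smul_smul, ← mul_pow, neg_mul_neg, mul_one,
      one_pow, one_smul])

/-! ### The functors `ℱ₁` and `ℱ₂` -/

/-- The complex `M̃(-1) ⟶ M̃ ⟶ M̃(1)` given by `θ_M`, in parity `q` in the middle. -/
def thetaComplex (M : SuperMod k s) (q : ZMod 2) : ShortComplex (ProjSpace k s).Modules :=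
  ShortComplex.mk _ _ (theta_comp_theta M (p := q + 1) (q := q) (r := q + 1)
    (by rw [add_assoc, CharTwo.add_self_eq_zero, add_zero]) rfl
    (j := -1) (j' := 0) (j'' := 1) rfl rfl)

/-- The part of parity `q` of `ℱ₁(M) = Ker θ_M / Im θ_M`, a subquotient of `M̃ = M ⊗ 𝒪`. -/
def F₁ (M : SuperMod k s) (q : ZMod 2) : (ProjSpace k s).Modules := (thetaComplex M q).homology

/-- The part of parity `q` of `ℱ₂(M) = Im θ_M`, a subsheaf of `M̃ = M ⊗ 𝒪`. -/
def F₂ (M : SuperMod k s) (q : ZMod 2) : (ProjSpace k s).Modules :=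
  Limits.image (thetaComplex M q).f

/-- The part of parity `q` of the kernel of `θ_M : M̃ ⟶ M̃(1)`. -/
def kerTheta (M : SuperMod k s) (q : ZMod 2) : (ProjSpace k s).Modules := (thetaComplex M q).cycles

/-- The inclusion of the kernel of `θ_M` into `M̃`. -/
def kerThetaι (M : SuperMod k s) (q : ZMod 2) : kerTheta M q ⟶ twist k s (M.part q) 0 :=
  (thetaComplex M q).iCycles

/-- The projection of the kernel of `θ_M` onto `ℱ₁(M)`. -/
def F₁π (M : SuperMod k s) (q : ZMod 2) : kerTheta M q ⟶ F₁ M q := (thetaComplex M q).homologyπ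

/-- The inclusion of `ℱ₂(M)` into `M̃`. -/
def F₂ι (M : SuperMod k s) (q : ZMod 2) : F₂ M q ⟶ twist k s (M.part q) 0 :=
  Limits.image.ι (thetaComplex M q).f

variable {M N : SuperMod k s} {p : ZMod 2}

/-- The morphism of complexes induced by a homogeneous map `f`: it is `f ⊗ id` in the middle and
`(-1)^|f| (f ⊗ id)` at the ends. -/
def thetaComplexMap (f : HomogMap p M N) {q r : ZMod 2} (h : q + p = r) :
    thetaComplex M q ⟶ thetaComplex N r where
  τ₁ := twistMap ((-1 : k) ^ p.val • f.part (by rw [← h]; ring)) (-1)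
  τ₂ := twistMap (f.part h) 0
  τ₃ := twistMap ((-1 : k) ^ p.val • f.part (by rw [← h]; ring)) 1
  comm₁₂ := (theta_comp_twistMap f _ h _ _ rfl).symm
  comm₂₃ := (theta_comp_twistMap' f h _ rfl rfl rfl).symm

/-- The map `ℱ₁(f)` induced by `f ⊗ id`, from parity `q` to parity `r = q + |f|`. -/
def F₁map (f : HomogMap p M N) {q r : ZMod 2} (h : q + p = r) : F₁ M q ⟶ F₁ N r :=
  ShortComplex.homologyMap (thetaComplexMap f h)

/-- The map `ℱ₂(f)` induced by `f ⊗ id`, from parity `q` to parity `r = q + |f|`. -/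
def F₂map (f : HomogMap p M N) {q r : ZMod 2} (h : q + p = r) : F₂ M q ⟶ F₂ N r :=
  Limits.image.map (Arrow.homMk (thetaComplexMap f h).τ₁ (thetaComplexMap f h).τ₂
    (thetaComplexMap f h).comm₁₂ : Arrow.mk (thetaComplex M q).f ⟶ Arrow.mk (thetaComplex N r).f)

end Sheaves

/-! ### Stalks and fibres of sheaves of modules -/

section Fibres

/-- The stalk of a sheaf of modules on a scheme. -/
abbrev stalkMod {X : Scheme.{u}} (F : X.Modules) (x : X) : Type u := F.presheaf.stalk x

instance {X : Scheme.{u}} (F : X.Modules) (x : X) :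
    Module (X.presheaf.stalk x) (stalkMod F x) :=
  PresheafOfModules.instModuleCarrierStalkCommRingCatCarrierAbPresheafOpensCarrier
    (R := X.presheaf) F.val x

theorem germ_smul {X : Scheme.{u}} (F : X.Modules) (x : X) (U : X.Opens) (hx : x ∈ U)
    (r : X.presheaf.obj (op U)) (m : F.presheaf.obj (op U)) :
    (F.presheaf.germ U x hx (r • m) : stalkMod F x) =
      X.presheaf.germ U x hx r • (F.presheaf.germ U x hx m : stalkMod F x) :=
  PresheafOfModules.germ_smul (R := X.presheaf) F.val x U hx r m

/-- The map on stalks induced by a morphism of sheaves of modules. -/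
def stalkModMap {X : Scheme.{u}} {F G : X.Modules} (φ : F ⟶ G) (x : X) :
    stalkMod F x →ₗ[X.presheaf.stalk x] stalkMod G x where
  toFun := (TopCat.Presheaf.stalkFunctor Ab x).map ((Scheme.Modules.toPresheaf X).map φ)
  map_add' := map_add _
  map_smul' r m := by
    obtain ⟨U, hU, r, rfl⟩ := X.presheaf.exists_germ_eq r
    obtain ⟨V, hV, m, rfl⟩ := F.presheaf.exists_germ_eq m
    have hUV : x ∈ U ⊓ V := ⟨hU, hV⟩
    have hr := X.presheaf.germ_res_apply (homOfLE inf_le_left : U ⊓ V ⟶ U) x hUV r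
    have hm := F.presheaf.germ_res_apply (homOfLE inf_le_right : U ⊓ V ⟶ V) x hUV m
    rw [← hr, ← hm]
    generalize X.presheaf.map (homOfLE inf_le_left : U ⊓ V ⟶ U).op r = r'
    generalize F.presheaf.map (homOfLE inf_le_right : U ⊓ V ⟶ V).op m = m'
    refine (congrArg _ (germ_smul F x (U ⊓ V) hUV r' m').symm).trans ?_
    refine (TopCat.Presheaf.stalkFunctor_map_germ_apply (C := Ab) (U ⊓ V) x hUV
      ((Scheme.Modules.toPresheaf X).map φ) _).trans ?_
    refine (congrArg (G.presheaf.germ (U ⊓ V) x hUV) (φ.app_smul r' m')).trans ?_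
    refine (germ_smul G x (U ⊓ V) hUV r' _).trans (congrArg _ ?_)
    exact (TopCat.Presheaf.stalkFunctor_map_germ_apply (C := Ab) (U ⊓ V) x hUV
      ((Scheme.Modules.toPresheaf X).map φ) _).symm

variable {X : Scheme.{u}} {x : X} {K : Type u} [Field K] (ev : X.presheaf.stalk x →+* K)
  {F G : X.Modules}

variable (F) in
/-- The fibre `K ⊗ F_x` of a sheaf of modules `F` at a point `x`, for a ring homomorphism
`ev : 𝒪_x → K`. -/
def Fibre : Type u :=
  letI := ev.toAlgebra
  K ⊗[X.presheaf.stalk x] stalkMod F x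

instance : AddCommGroup (Fibre ev F) :=
  letI := ev.toAlgebra
  (inferInstance : AddCommGroup (K ⊗[X.presheaf.stalk x] stalkMod F x))

instance : Module K (Fibre ev F) :=
  letI := ev.toAlgebra
  (inferInstance : Module K (K ⊗[X.presheaf.stalk x] stalkMod F x))

/-- The `K`-linear map on fibres induced by a morphism of sheaves of modules. -/
def fibreMap (φ : F ⟶ G) : Fibre ev F →ₗ[K] Fibre ev G :=
  letI := ev.toAlgebra
  (stalkModMap φ x).baseChange K

variable (F) in
/-- The value `1 ⊗ t_x` in the fibre at `x` of a global section `t`. -/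
def globalValue (t : F.presheaf.obj (op ⊤)) : Fibre ev F :=
  letI := ev.toAlgebra
  (1 : K) ⊗ₜ[X.presheaf.stalk x] (F.presheaf.germ ⊤ x trivial t : stalkMod F x)

theorem globalValue_add (t t' : F.presheaf.obj (op ⊤)) :
    globalValue ev F (t + t') = globalValue ev F t + globalValue ev F t' := by
  let := ev.toAlgebra
  exact (congrArg (fun v : stalkMod F x => (1 : K) ⊗ₜ[X.presheaf.stalk x] v)
    (map_add (F.presheaf.germ ⊤ x trivial).hom t t')).trans (TensorProduct.tmul_add ..)

theorem globalValue_smul (r : X.presheaf.obj (op ⊤)) (t : F.presheaf.obj (op ⊤)) :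
    globalValue ev F (r • t) =
      ev (X.presheaf.germ ⊤ x trivial r) • globalValue ev F t := by
  let := ev.toAlgebra
  refine (congrArg (fun v : stalkMod F x => (1 : K) ⊗ₜ[X.presheaf.stalk x] v)
    (germ_smul F x ⊤ trivial r t)).trans ?_
  refine (TensorProduct.tmul_smul _ _ _).trans ((TensorProduct.smul_tmul' _ _ _).trans ?_)
  refine Eq.trans ?_ (TensorProduct.smul_tmul' _ _ _).symm
  rw [smul_eq_mul, Algebra.smul_def]
  rfl

end Fibres

/-! ### Points of projective space and fibres -/

section Points

variable {k : Type u} [Field k] {s : ℕ} {K : Type u} [Field K] [Algebra k K]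

variable (k) in
/-- Substituting `Y_i = λ_i T`. -/
def lineEval (α : Fin s → K) : S k s →ₐ[k] Polynomial K :=
  MvPolynomial.aeval fun i => Polynomial.C (α i) * Polynomial.X

theorem lineEval_of_mem (α : Fin s → K) {d : ℕ} {f : S k s} (hf : f ∈ grading k s d) :
    lineEval k α f = Polynomial.C (MvPolynomial.aeval α f) * Polynomial.X ^ d := by
  rw [lineEval, MvPolynomial.aeval_def, MvPolynomial.aeval_def, MvPolynomial.eval₂_eq',
    MvPolynomial.eval₂_eq', map_sum, Finset.sum_mul]
  refine Finset.sum_congr rfl fun m hm => ?_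
  have hd : ∑ i, m i = d := by
    rw [← (MvPolynomial.mem_homogeneousSubmodule d f).mp hf (MvPolynomial.mem_support_iff.mp hm),
      Finsupp.weight_apply, Finsupp.sum_fintype _ _ (by simp)]
    simp
  simp only [mul_pow, Finset.prod_mul_distrib, Finset.prod_pow_eq_pow_sum, hd, map_mul, map_prod,
    map_pow, mul_assoc, IsScalarTower.algebraMap_apply k K (Polynomial K),
    Polynomial.algebraMap_eq]

theorem coeff_lineEval (α : Fin s → K) (d : ℕ) (f : S k s) :
    (lineEval k α f).coeff d = MvPolynomial.aeval α (MvPolynomial.homogeneousComponent d f) := by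
  conv_lhs => rw [← MvPolynomial.sum_homogeneousComponent f]
  rw [map_sum, Polynomial.finsetSum_coeff]
  simp only [lineEval_of_mem α (MvPolynomial.homogeneousComponent_mem _ f),
    Polynomial.coeff_C_mul_X_pow]
  rw [Finset.sum_ite_eq]
  split_ifs with h
  · rfl
  · rw [MvPolynomial.homogeneousComponent_eq_zero _ _ (by simpa using h), map_zero]

variable (k) in
/-- The homogeneous prime ideal of the point `ᾱ` of `ℙ^(s-1)` with homogeneous coordinates
`α = (λ₁, …, λ_s) ∈ K^s ∖ {0}`, for a field extension `K` of `k`: a polynomial belongs to this prime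
ideal if and only if all its homogeneous components vanish at `α`. -/
def pointPrime (α : Fin s → K) (hα : α ≠ 0) : ProjectiveSpectrum (grading k s) where
  asHomogeneousIdeal :=
    { toSubmodule := RingHom.ker (lineEval k α)
      is_homogeneous' := by
        intro d f hf
        change lineEval k α _ = 0
        rw [lineEval_of_mem α (SetLike.coe_mem _)]
        have h : MvPolynomial.aeval α (MvPolynomial.homogeneousComponent d f) = 0 := by
          rw [← coeff_lineEval, (show lineEval k α f = 0 from hf), Polynomial.coeff_zero]
        have h' : ((DirectSum.decompose (grading k s) f d : grading k s d) : S k s) =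
            MvPolynomial.homogeneousComponent d f :=
          MvPolynomial.decomposition.decompose'_apply f d
        rw [h', h, map_zero, zero_mul] }
  isPrime := RingHom.ker_isPrime (lineEval k α)
  not_irrelevant_le := by
    intro h
    refine hα (funext fun i => ?_)
    have hi : (MvPolynomial.X i : S k s) ∈ HomogeneousIdeal.irrelevant (grading k s) :=
      HomogeneousIdeal.mem_irrelevant_of_mem (grading k s) one_pos
        (MvPolynomial.isHomogeneous_X k i)
    have h0 : lineEval k α (MvPolynomial.X i) = 0 := h hi
    rw [lineEval_of_mem α (MvPolynomial.isHomogeneous_X k i), MvPolynomial.aeval_X] at h0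
    simpa using h0

theorem mem_point_iff (α : Fin s → K) (hα : α ≠ 0) {d : ℕ} {f : S k s}
    (hf : f ∈ grading k s d) :
    f ∈ (pointPrime k α hα).asHomogeneousIdeal.toIdeal ↔ MvPolynomial.aeval α f = 0 := by
  change lineEval k α f = 0 ↔ _
  rw [lineEval_of_mem α hf, mul_eq_zero, Polynomial.C_eq_zero]
  exact or_iff_left (pow_ne_zero _ Polynomial.X_ne_zero)

theorem aeval_den_ne_zero (α : Fin s → K) (hα : α ≠ 0)
    (c : HomogeneousLocalization.NumDenSameDeg (grading k s)
      (pointPrime k α hα).asHomogeneousIdeal.toIdeal.primeCompl) :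
    MvPolynomial.aeval α (c.den : S k s) ≠ 0 :=
  fun h => c.den_mem ((mem_point_iff α hα c.den.2).mpr h)

/-- Evaluation at `α` of the homogeneous fractions of degree zero which are defined at `ᾱ`:
`a / b ↦ a(α) / b(α)`. -/
def evalAt (α : Fin s → K) (hα : α ≠ 0) :
    HomogeneousLocalization.AtPrime (grading k s) (pointPrime k α hα).asHomogeneousIdeal.toIdeal →+*
      K where
  toFun := Quotient.lift (fun c => MvPolynomial.aeval α (c.num : S k s) /
      MvPolynomial.aeval α (c.den : S k s)) <| by
    intro a b hab
    have e : a.embedding = b.embedding := hab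
    simp only [HomogeneousLocalization.NumDenSameDeg.embedding, Localization.mk_eq_mk_iff,
      Localization.r_iff_exists] at e
    obtain ⟨c, hc⟩ := e
    have hc0 : (c : S k s) ≠ 0 := fun h => c.2 (by rw [h]; exact zero_mem _)
    have := congrArg (MvPolynomial.aeval α) (mul_left_cancel₀ hc0 hc)
    rw [map_mul, map_mul] at this
    rw [div_eq_div_iff (aeval_den_ne_zero α hα a) (aeval_den_ne_zero α hα b)]
    linear_combination this
  map_one' := by
    change MvPolynomial.aeval α (1 : S k s) / MvPolynomial.aeval α (1 : S k s) = 1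
    rw [map_one, div_one]
  map_zero' := by
    change MvPolynomial.aeval α (0 : S k s) / MvPolynomial.aeval α (1 : S k s) = 0
    rw [map_zero, zero_div]
  map_mul' a b := by
    induction a using Quotient.inductionOn' with | h a => ?_
    induction b using Quotient.inductionOn' with | h b => ?_
    change MvPolynomial.aeval α ((a.num : S k s) * (b.num : S k s)) /
      MvPolynomial.aeval α ((a.den : S k s) * (b.den : S k s)) = _ / _ * (_ / _)
    rw [map_mul, map_mul, mul_div_mul_comm]
  map_add' a b := by
    induction a using Quotient.inductionOn' with | h a => ?_
    induction b using Quotient.inductionOn' with | h b => ?_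
    change MvPolynomial.aeval α ((a.den : S k s) * (b.num : S k s) + (b.den : S k s) * (a.num : S k s)) /
      MvPolynomial.aeval α ((a.den : S k s) * (b.den : S k s)) = _ / _ + _ / _
    have ha := aeval_den_ne_zero α hα a
    have hb := aeval_den_ne_zero α hα b
    rw [map_mul, map_add, map_mul, map_mul, div_add_div _ _ ha hb]
    congr 1
    ring

variable (k) in
/-- The point `ᾱ` of `ℙ^(s-1)` with homogeneous coordinates `α ∈ K^s ∖ {0}`. -/
def point (α : Fin s → K) (hα : α ≠ 0) : ProjSpace k s := pointPrime k α hα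

variable (k) in
/-- The evaluation `𝒪_ᾱ → K` at `α` on the local ring of `ℙ^(s-1)` at `ᾱ`. -/
def evalStalk (α : Fin s → K) (hα : α ≠ 0) :
    (ProjSpace k s).presheaf.stalk (point k α hα) →+* K :=
  (evalAt α hα).comp (Proj.stalkIso (grading k s) (point k α hα)).hom.hom


theorem evalStalk_projConst (α : Fin s → K) (hα : α ≠ 0) (a : S k s) (ha : a ∈ grading k s 0) :
    evalStalk k α hα ((ProjSpace k s).presheaf.germ ⊤ (point k α hα) trivial
      (projConst (grading k s) a ha)) = MvPolynomial.aeval α a := by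
  refine (congrArg (evalAt α hα) (Proj.stalkIso'_germ (grading k s) ⊤ (point k α hα) trivial
    (projConst (grading k s) a ha))).trans ?_
  have h : MvPolynomial.aeval α a / MvPolynomial.aeval α (1 : S k s) =
      MvPolynomial.aeval α a := by rw [map_one, div_one]
  exact h

variable {W : Type u} [AddCommGroup W] [Module k W]

theorem one_tmul_mem (w : W) : (1 : S k s) ⊗ₜ[k] w ∈ twistDeg k s W 0 0 :=
  tmul_mem_twistDeg (e := 0) (by simp) (SetLike.GradedOne.one_mem) w

/-- The value at `ᾱ` of the constant section `w` of `W ⊗ 𝒪`. -/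
def constValue (α : Fin s → K) (hα : α ≠ 0) (w : W) :
    Fibre (evalStalk k α hα) (twist k s W 0) :=
  globalValue (evalStalk k α hα) (twist k s W 0)
    (projGlobalSection (grading k s) (twistDeg k s W 0) ((1 : S k s) ⊗ₜ[k] w) (one_tmul_mem w))

theorem constValue_add (α : Fin s → K) (hα : α ≠ 0) (w w' : W) :
    constValue (k := k) α hα (w + w') = constValue α hα w + constValue α hα w' := by
  refine Eq.trans ?_ (globalValue_add _ _ _)
  unfold constValue
  congr 1
  refine Eq.trans ?_ (projGlobalSection_add _ _ _ _ _ _)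
  congr 1
  exact tmul_add _ _ _

theorem constValue_smul (α : Fin s → K) (hα : α ≠ 0) (c : k) (w : W) :
    constValue (k := k) α hα (c • w) = algebraMap k K c • constValue (k := k) α hα w := by
  have hc : MvPolynomial.C c ∈ grading k s 0 := MvPolynomial.isHomogeneous_C _ c
  have h : algebraMap k K c = MvPolynomial.aeval α (MvPolynomial.C c : S k s) := by simp
  rw [h, ← evalStalk_projConst α hα _ hc]
  refine Eq.trans ?_ (globalValue_smul _ _ _)
  unfold constValue
  congr 1
  have h' : (1 : S k s) ⊗ₜ[k] (c • w) = (MvPolynomial.C c : S k s) • ((1 : S k s) ⊗ₜ[k] w) := by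
    rw [smul_tmul', smul_eq_mul, mul_one, tmul_smul, smul_tmul', MvPolynomial.smul_eq_C_mul,
      mul_one]
  refine Eq.trans ?_ (projGlobalSection_smul _ _ _ hc _ _ (h' ▸ one_tmul_mem (c • w)))
  congr 1

variable (k W) in
/-- The map `c ⊗ w ↦ c w` from `K ⊗ W` to the fibre of `W ⊗ 𝒪` at `ᾱ`. -/
def constMap (α : Fin s → K) (hα : α ≠ 0) :
    K ⊗[k] W →ₗ[K] Fibre (evalStalk k α hα) (twist k s W 0) :=
  letI : Module k (Fibre (evalStalk k α hα) (twist k s W 0)) :=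
    Module.compHom _ (algebraMap k K)
  haveI : IsScalarTower k K (Fibre (evalStalk k α hα) (twist k s W 0)) :=
    ⟨fun a b c => by
      rw [Algebra.smul_def, mul_smul]; rfl⟩
  LinearMap.liftBaseChange K
    { toFun := constValue α hα
      map_add' := constValue_add α hα
      map_smul' := constValue_smul α hα }

theorem constMap_tmul (α : Fin s → K) (hα : α ≠ 0) (c : K) (w : W) :
    constMap k W α hα (c ⊗ₜ[k] w) = c • constValue α hα w := rfl

end Points

/-! ### Subquotients -/

section Subquotient

variable {R M M' : Type u} [Ring R] [AddCommGroup M] [Module R M] [AddCommGroup M'] [Module R M']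

/-- The subquotient `A / (A ∩ B)` of a module. -/
def Subquotient (A B : Submodule R M) : Type u := A ⧸ B.submoduleOf A

instance (A B : Submodule R M) : AddCommGroup (Subquotient A B) :=
  inferInstanceAs (AddCommGroup (A ⧸ B.submoduleOf A))

instance (A B : Submodule R M) : Module R (Subquotient A B) :=
  inferInstanceAs (Module R (A ⧸ B.submoduleOf A))

/-- The class of an element of `A` in `A / (A ∩ B)`. -/
def Subquotient.mk (A B : Submodule R M) : A →ₗ[R] Subquotient A B :=
  (B.submoduleOf A).mkQ

/-- The map of subquotients induced by a linear map. -/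
def Subquotient.map {A B : Submodule R M} {A' B' : Submodule R M'} (g : M →ₗ[R] M')
    (hA : ∀ v ∈ A, g v ∈ A') (hB : ∀ v ∈ B, g v ∈ B') : Subquotient A B →ₗ[R] Subquotient A' B' :=
  (B.submoduleOf A).mapQ (B'.submoduleOf A') (g.restrict hA) fun x hx => hB x.1 hx

end Subquotient

/-! ### The fibres `ℱ_{i,α}` and the Jordan type -/

section JordanType

variable {k : Type u} [Field k] {s : ℕ} {K : Type u} [Field K] [Algebra k K]

theorem add_one_add_one (q : ZMod 2) : q + 1 + 1 = q := by
  rw [add_assoc, CharTwo.add_self_eq_zero, add_zero]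

namespace SuperMod

variable (M N : SuperMod k s)

/-- For `α = (λ₁, …, λ_s) ∈ K^s`, the action of `x_α = ∑ λ_i x_i` on `K ⊗ M`, from the part of
parity `p` to the part of parity `r = p + 1`. -/
def xAt (α : Fin s → K) {p r : ZMod 2} (h : p + 1 = r) :
    K ⊗[k] M.part p →ₗ[K] K ⊗[k] M.part r :=
  ∑ i, α i • (M.xPart i h).baseChange K

/-- The part of parity `q` of `Ker x_α ⊆ K ⊗ M`. -/
def kerAt (α : Fin s → K) (q : ZMod 2) : Submodule K (K ⊗[k] M.part q) :=
  LinearMap.ker (M.xAt α (p := q) rfl)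

/-- The part of parity `q` of `ℱ_{2,α}(M) = Im x_α ⊆ K ⊗ M`. -/
def imAt (α : Fin s → K) (q : ZMod 2) : Submodule K (K ⊗[k] M.part q) :=
  LinearMap.range (M.xAt α (add_one_add_one q))

/-- The part of parity `q` of `ℱ_{1,α}(M) = Ker x_α / Im x_α`. -/
abbrev F₁At (α : Fin s → K) (q : ZMod 2) : Type u := Subquotient (M.kerAt α q) (M.imAt α q)

/-- The action of `x_α` on `M`, from the part of parity `p` to the part of parity `r = p + 1`. -/
def xElem (α : Fin s → k) {p r : ZMod 2} (h : p + 1 = r) : M.part p →ₗ[k] M.part r :=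
  (M.xEnd α).restrict fun _ hm => by
    rw [← h, add_comm]
    exact M.smul_mem (xElt_mem α) hm

/-- The part of parity `q` of `M_{x_α} = Ker x_α / Im x_α`, for `α ∈ k^s`. -/
abbrev MxPart (α : Fin s → k) (q : ZMod 2) : Type u :=
  Subquotient (LinearMap.ker (M.xElem α (p := q) rfl))
    (LinearMap.range (M.xElem α (add_one_add_one q)))

/-- An isomorphism of `M`, restricted to `⟨x_α⟩`, with a direct sum of `a_ev` copies of the trivial
module `k_ev`, of `a_od` copies of `k_od` and of `a₂` two-dimensional projective modules
`P` with bases `p, x_α p`, where `p` is homogeneous of some parity. -/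
structure JordanDecomposition (α : Fin s → k) (a_ev a_od a₂ : ℕ) where
  /-- The basis of `M` given by the decomposition. -/
  basis : Module.Basis ((Fin a_ev ⊕ Fin a_od) ⊕ (Fin a₂ ⊕ Fin a₂)) k M.carrier
  even_mem : ∀ i, basis (.inl (.inl i)) ∈ M.part 0
  odd_mem : ∀ i, basis (.inl (.inr i)) ∈ M.part 1
  trivial_smul : ∀ i, xElt α • basis (.inl i) = 0
  /-- The parities of the generators of the projective summands. -/
  parity : Fin a₂ → ZMod 2
  gen_mem : ∀ i, basis (.inr (.inl i)) ∈ M.part (parity i)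
  gen_smul : ∀ i, xElt α • basis (.inr (.inl i)) = basis (.inr (.inr i))

/-- The projective part `P^{a₂}` of a decomposition `M = k_ev^{a_ev} ⊕ k_od^{a_od} ⊕ P^{a₂}`. -/
def JordanDecomposition.projectivePart {M : SuperMod k s} {α : Fin s → k} {a_ev a_od a₂ : ℕ}
    (D : M.JordanDecomposition α a_ev a_od a₂) : Submodule k M.carrier :=
  Submodule.span k (Set.range fun i => D.basis (.inr i))

/-- `W` is a simple `⟨x_α⟩`-submodule of `M`. -/
def IsSimpleSub (α : Fin s → k) (W : Submodule k M.carrier) : Prop :=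
  W ≠ ⊥ ∧ W ∈ Module.End.invtSubmodule (M.xEnd α) ∧
    ∀ W' ∈ Module.End.invtSubmodule (M.xEnd α), W' ≤ W → W' = ⊥ ∨ W' = W

/-- The socle of an `⟨x_α⟩`-submodule `P` of `M`: the sum of its simple submodules. -/
def socle (α : Fin s → k) (P : Submodule k M.carrier) : Submodule k M.carrier :=
  sSup {W | W ≤ P ∧ M.IsSimpleSub α W}

/-- `M` is of constant Jordan type `(a_ev|a_od)[1] + a₂[2]`. -/
def HasConstantJordanType (a_ev a_od a₂ : ℕ) : Prop :=
  ∀ α : Fin s → k, α ≠ 0 → Nonempty (M.JordanDecomposition α a_ev a_od a₂)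

end SuperMod

namespace HomogMap

variable {M N : SuperMod k s} {p : ZMod 2}

theorem partAt_xAt (f : HomogMap p M N) (α : Fin s → K) {q r q' r' : ZMod 2} (h : q + p = r)
    (h' : q' + p = r') (hq : q + 1 = q') (hr : r + 1 = r') (v : K ⊗[k] M.part q) :
    (f.part h').baseChange K (M.xAt α hq v) =
      (-1 : k) ^ p.val • N.xAt α hr ((f.part h).baseChange K v) := by
  induction v using TensorProduct.induction_on with
  | zero => simp
  | add a b ha hb => simp only [map_add, ha, hb, smul_add]
  | tmul c m =>
    simp only [SuperMod.xAt, LinearMap.sum_apply, LinearMap.smul_apply, map_sum,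
      LinearMap.baseChange_tmul, _root_.map_smul, Finset.smul_sum]
    refine Finset.sum_congr rfl fun i _ => ?_
    rw [f.part_xPart i h h' hq hr, tmul_smul, smul_comm]

theorem part_mem_kerAt (f : HomogMap p M N) (α : Fin s → K) {q r : ZMod 2} (h : q + p = r)
    (v : K ⊗[k] M.part q) (hv : v ∈ M.kerAt α q) : (f.part h).baseChange K v ∈ N.kerAt α r := by
  have h' : q + 1 + p = r + 1 := by rw [← h]; ring
  have e := f.partAt_xAt α h h' rfl rfl v
  rw [(show M.xAt α rfl v = 0 from hv), map_zero] at e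
  have e' := congrArg (fun w => (-1 : k) ^ p.val • w) e
  simp only [smul_zero, smul_smul, ← mul_pow, neg_mul_neg, mul_one, one_pow, one_smul] at e'
  exact e'.symm

theorem part_mem_imAt (f : HomogMap p M N) (α : Fin s → K) {q r : ZMod 2} (h : q + p = r)
    (v : K ⊗[k] M.part q) (hv : v ∈ M.imAt α q) : (f.part h).baseChange K v ∈ N.imAt α r := by
  obtain ⟨w, rfl⟩ := hv
  have h' : q + 1 + p = r + 1 := by rw [← h]; ring
  rw [f.partAt_xAt α h' h _ (add_one_add_one r) w]
  exact (N.imAt α r).smul_of_tower_mem _ ⟨_, rfl⟩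

/-- The map `ℱ_{1,α}(M) → ℱ_{1,α}(N)` induced by `f`, from parity `q` to parity `r = q + |f|`. -/
def F₁At (f : HomogMap p M N) (α : Fin s → K) {q r : ZMod 2} (h : q + p = r) :
    M.F₁At α q →ₗ[K] N.F₁At α r :=
  Subquotient.map ((f.part h).baseChange K) (f.part_mem_kerAt α h) (f.part_mem_imAt α h)

/-- The map `ℱ_{2,α}(M) → ℱ_{2,α}(N)` induced by `f`, from parity `q` to parity `r = q + |f|`. -/
def imAt (f : HomogMap p M N) (α : Fin s → K) {q r : ZMod 2} (h : q + p = r) :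
    M.imAt α q →ₗ[K] N.imAt α r :=
  ((f.part h).baseChange K).restrict (f.part_mem_imAt α h)

end HomogMap

/-- The isomorphism `φ` from the fibre of `ℱ₁(M)` at `ᾱ` to `ℱ_{1,α}(M)` is the one given by
evaluation at `α`: if a value `z` in the fibre at `ᾱ` of `Ker θ_M` is mapped to `v ∈ K ⊗ M` in the fibre
of `M ⊗ 𝒪`, then `v ∈ Ker x_α` and the class of `z` corresponds to the class of `v`. -/
def IsSpecialization₁ (M : SuperMod k s) (α : Fin s → K) (hα : α ≠ 0) (q : ZMod 2)
    (φ : Fibre (evalStalk k α hα) (F₁ M q) ≃ₗ[K] M.F₁At α q) : Prop :=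
  ∀ (z : Fibre (evalStalk k α hα) (kerTheta M q)) (v : K ⊗[k] M.part q),
    fibreMap (evalStalk k α hα) (kerThetaι M q) z = constMap k (M.part q) α hα v →
      ∃ hv : v ∈ M.kerAt α q, φ (fibreMap (evalStalk k α hα) (F₁π M q) z) =
        Subquotient.mk (M.kerAt α q) (M.imAt α q) ⟨v, hv⟩

/-- The isomorphism `φ` from the fibre of `ℱ₂(M)` at `ᾱ` to `ℱ_{2,α}(M)` is the one given by
evaluation at `α`: if `z` is mapped to `v ∈ K ⊗ M` in the fibre of `M ⊗ 𝒪`, then `φ z = v`. -/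
def IsSpecialization₂ (M : SuperMod k s) (α : Fin s → K) (hα : α ≠ 0) (q : ZMod 2)
    (φ : Fibre (evalStalk k α hα) (F₂ M q) ≃ₗ[K] M.imAt α q) : Prop :=
  ∀ (z : Fibre (evalStalk k α hα) (F₂ M q)) (v : K ⊗[k] M.part q),
    fibreMap (evalStalk k α hα) (F₂ι M q) z = constMap k (M.part q) α hα v → (φ z).1 = v

end JordanType

/-! ### Vector bundles -/

section Bundles

/-- A vector bundle of rank `r`: a locally free sheaf of rank `r`. -/
def IsVectorBundle {X : Scheme.{u}} (F : X.Modules) (r : ℕ) : Prop :=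
  ∀ x : X, ∃ U : X.Opens, x ∈ U ∧
    Nonempty (F.restrict U.ι ≅ SheafOfModules.free (R := U.toScheme.ringCatSheaf) (ULift.{u} (Fin r)))

/-- A super vector bundle of rank `(r_ev|r_od)`: a `ℤ/2`-graded sheaf of modules which locally has a
basis of `r_ev` even and `r_od` odd sections. -/
def IsSuperVectorBundle {X : Scheme.{u}} (F : ZMod 2 → X.Modules) (r_ev r_od : ℕ) : Prop :=
  ∀ x : X, ∃ U : X.Opens, x ∈ U ∧
    Nonempty ((F 0).restrict U.ι ≅
      SheafOfModules.free (R := U.toScheme.ringCatSheaf) (ULift.{u} (Fin r_ev))) ∧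
    Nonempty ((F 1).restrict U.ι ≅
      SheafOfModules.free (R := U.toScheme.ringCatSheaf) (ULift.{u} (Fin r_od)))

end Bundles

end SuperBundle
end

open SuperBundle

/-!
The restriction of `M` to `⟨x_α⟩` has type `(a_ev|a_od)[1] + a₂[2]` for all `α ∈ k^s ∖ {0}`, so
the rank of `x_α` on `M` is `a₂`. This rank is the sum of the ranks of the even and of the odd
part of `x_α`, which are lower semicontinuous in `α`; since the sum is constant, each of them is
constant and equal to the rank over the function field (`rank_eval_eq_genericRank`). By the
Nullstellensatz the matrix of linear forms which describes `θ_M` then has the same rank over every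
field in which not all coordinates vanish, and in particular at the non-closed points of `ℙ^{s-1}`
(`rank_map_eq_genericRank`).

A matrix over a domain with a non-vanishing minor of the size of its rank has a generalized
inverse whose only denominator is that minor. Applied to the two differentials of the complex
`M̃(-1) ⟶ M̃ ⟶ M̃(1)`, whose homology is `ℱ₁(M)`, this gives near every point a contraction of the
complex onto a free module: homotopies on both sides and a factorization of the remaining
projector through `𝒪^a`. All of this is done with matrices of homogeneous polynomials
(`exists_imageSplitting`, `exists_complexSplitting`) and transported to sheaves by letting
matrices with a denominator `h` act on `W ⊗ 𝒪(j)` over `D₊(h)` (`coordFrac`). The rank `a` is the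
number of Jordan blocks of size one in the given degree, by a dimension count at one closed point.
Hence `ℱ₁(M)` and, in the same way, `ℱ₂(M)` are vector bundles
(`HasConstantJordanType.isSuperVectorBundle_F₁`, `HasConstantJordanType.isVectorBundle_F₂`).

A contraction is preserved by every additive functor, so that near `ᾱ` the passage to the fibre
commutes with the kernel, the image and the homology of the complex (`fibreMap_iCycles_injective`,
`range_fibreMap_iCycles`, `fibreMap_homologyπ_eq_zero_iff`, `range_fibreMap_imageι`). Evaluation
at `α` identifies the fibre of `W ⊗ 𝒪(j)` with `K ⊗ W` (`fibreEval_bijective`) and `θ_M` with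
`x_α` (`fibreEval_theta`). Together these identify the fibres of `ℱ₁(M)` and `ℱ₂(M)` with `Ker x_α
/ Im x_α` and `Im x_α` (`exists_isSpecialization₁`, `exists_isSpecialization₂`). The isomorphisms
are characterized by values of sections of `M̃`, on which a homogeneous map acts by `f ⊗ id`,
whence the commutative squares. For `K = k` one obtains the fibres at closed points; the image of
`x_α` has dimension `a₂`, which is also the dimension of the socle of `P^{⊕ a₂}`. Functoriality is
that of homology and of images.
-/

noncomputable section

namespace SuperBundle

/-! ### Fractions of morphisms between sheaves `Ñ` -/

section FracMap

variable {k A N : Type u} [Field k] [CommRing A] [Algebra k A]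
  {𝒜 : ℕ → Submodule k A} [GradedAlgebra 𝒜] [AddCommGroup N] [Module A N]
  {𝒩 : ℕ → AddSubgroup N} [SetLike.GradedSMul 𝒜 𝒩]
  {N' : Type u} [AddCommGroup N'] [Module A N'] {𝒩' : ℕ → AddSubgroup N'}
  [SetLike.GradedSMul 𝒜 𝒩']
  {N'' : Type u} [AddCommGroup N''] [Module A N''] {𝒩'' : ℕ → AddSubgroup N''}
  [SetLike.GradedSMul 𝒜 𝒩'']

/-- The map `v ↦ φ(v) / b` from `N_x` to `N'_x`, for a denominator `b` outside the prime `x`. -/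
def localizedDiv (x : ProjectiveSpectrum 𝒜) (φ : N →ₗ[A] N') (b : A)
    (hb : b ∈ x.asHomogeneousIdeal.toIdeal.primeCompl) :
    LocalizedAt 𝒜 N x →ₗ[Localization x.asHomogeneousIdeal.toIdeal.primeCompl]
      LocalizedAt 𝒜 N' x :=
  (Localization.mk 1 ⟨b, hb⟩ : Localization x.asHomogeneousIdeal.toIdeal.primeCompl) •
    localizedMap 𝒜 x φ

theorem localizedDiv_mk (x : ProjectiveSpectrum 𝒜) (φ : N →ₗ[A] N') (b : A)
    (hb : b ∈ x.asHomogeneousIdeal.toIdeal.primeCompl) (n : N)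
    (c : x.asHomogeneousIdeal.toIdeal.primeCompl) :
    localizedDiv x φ b hb (LocalizedModule.mk n c) = LocalizedModule.mk (φ n) (⟨b, hb⟩ * c) := by
  refine (LinearMap.smul_apply _ _ _).trans ?_
  rw [localizedMap_mk, LocalizedModule.mk_smul_mk, one_smul]

/-- The denominator `b` vanishes at no point of the open set `U`. -/
def NonvanishingOn (U : (Proj 𝒜).Opens) (b : A) : Prop :=
  ∀ x : ProjectiveSpectrum 𝒜, (show (Proj 𝒜) from x) ∈ U →
    b ∈ x.asHomogeneousIdeal.toIdeal.primeCompl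

theorem mem_of_mem_image (U : (Proj 𝒜).Opens) (V : U.toScheme.Opens) {x : Proj 𝒜}
    (hx : x ∈ U.ι ''ᵁ V) : x ∈ U := by
  obtain ⟨y, _, rfl⟩ := hx
  exact y.2

/-- The map of presheaves underlying `fracMap`. -/
def fracMapAb (U : (Proj 𝒜).Opens) (b : A) (hU : NonvanishingOn U b) (e : ℕ) (hb : b ∈ 𝒜 e)
    (φ : N →ₗ[A] N') (hφ : ∀ d, ∀ n ∈ 𝒩 d, φ n ∈ 𝒩' (d + e)) :
    ((projTilde 𝒜 𝒩).restrict U.ι).presheaf ⟶ ((projTilde 𝒜 𝒩').restrict U.ι).presheaf where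
  app V := AddCommGrpCat.ofHom
    { toFun := fun t : (projTildeInType 𝒜 𝒩).1.obj (op (U.ι ''ᵁ V.unop)) =>
        (⟨fun x => localizedDiv x.1 φ b (hU x.1 (mem_of_mem_image U V.unop x.2)) (t.1 x), by
          intro x
          obtain ⟨W, mW, iW, d, n, c, hn, hc, w⟩ := t.2 x
          refine ⟨W, mW, iW, d + e, φ n, b * c, hφ d n hn, ?_, fun y => ?_⟩
          · rw [add_comm]; exact SetLike.mul_mem_graded hb hc
          obtain ⟨h, w⟩ := w y
          have hby := hU y.1 (mem_of_mem_image U V.unop (iW y).2)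
          exact ⟨Submonoid.mul_mem _ hby h, (congrArg (localizedDiv y.1 φ b hby) w).trans
            (localizedDiv_mk ..)⟩⟩ : (projTildeInType 𝒜 𝒩').1.obj (op (U.ι ''ᵁ V.unop)))
      map_zero' := Subtype.ext <| funext fun _ => map_zero _
      map_add' := fun _ _ => Subtype.ext <| funext fun _ => map_add _ _ _ }
  naturality _ _ _ := rfl

/-- The morphism `φ / b : Ñ|_U ⟶ Ñ'|_U`. -/
def fracMap (U : (Proj 𝒜).Opens) (b : A) (hU : NonvanishingOn U b) (e : ℕ) (hb : b ∈ 𝒜 e)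
    (φ : N →ₗ[A] N') (hφ : ∀ d, ∀ n ∈ 𝒩 d, φ n ∈ 𝒩' (d + e)) :
    (projTilde 𝒜 𝒩).restrict U.ι ⟶ (projTilde 𝒜 𝒩').restrict U.ι :=
  SheafOfModules.Hom.mk (PresheafOfModules.homMk
    (M₁ := ((projTilde 𝒜 𝒩).restrict U.ι).val)
    (M₂ := ((projTilde 𝒜 𝒩').restrict U.ι).val) (fracMapAb U b hU e hb φ hφ)
    (fun V r m => Subtype.ext <| funext fun x =>
      (localizedDiv x.1 φ b (hU x.1 (mem_of_mem_image U V.unop x.2))).map_smul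
        (HomogeneousLocalization.val
          (((U.ι.appIso V.unop).inv r :
            (ProjectiveSpectrum.Proj.structureSheaf 𝒜).1.obj (op (U.ι ''ᵁ V.unop))).1 x))
        ((m : (projTildeInType 𝒜 𝒩).1.obj (op (U.ι ''ᵁ V.unop))).1 x)))

theorem restrict_projTilde_hom_ext {U : (Proj 𝒜).Opens}
    {f g : (projTilde 𝒜 𝒩).restrict U.ι ⟶ (projTilde 𝒜 𝒩').restrict U.ι}
    (h : ∀ (V : U.toScheme.Opens) (t : (projTildeInType 𝒜 𝒩).1.obj (op (U.ι ''ᵁ V)))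
      (x : ↥(U.ι ''ᵁ V)),
      ((f.app V t : (projTildeInType 𝒜 𝒩').1.obj (op (U.ι ''ᵁ V))).1 x) =
        ((g.app V t : (projTildeInType 𝒜 𝒩').1.obj (op (U.ι ''ᵁ V))).1 x)) : f = g := by
  refine Scheme.Modules.hom_ext _ _ fun V => ?_
  ext t
  exact Subtype.ext (funext fun x => h V t x)

/-- Two fractions of maps agree if they agree after clearing denominators. -/
theorem localizedDiv_congr (x : ProjectiveSpectrum 𝒜) {φ φ' : N →ₗ[A] N'} {b b' : A}
    (hb : b ∈ x.asHomogeneousIdeal.toIdeal.primeCompl)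
    (hb' : b' ∈ x.asHomogeneousIdeal.toIdeal.primeCompl) (h : b' • φ = b • φ')
    (v : LocalizedAt 𝒜 N x) : localizedDiv x φ b hb v = localizedDiv x φ' b' hb' v := by
  induction v using LocalizedModule.induction_on with
  | h n c =>
    rw [localizedDiv_mk, localizedDiv_mk, LocalizedModule.mk_eq]
    refine ⟨1, ?_⟩
    have := LinearMap.congr_fun h n
    simp only [LinearMap.smul_apply] at this
    simp only [one_smul, Submonoid.smul_def, mul_smul]
    rw [smul_comm b', this, smul_comm]

theorem fracMap_congr {U : (Proj 𝒜).Opens} {b b' : A} {hU : NonvanishingOn U b}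
    {hU' : NonvanishingOn U b'} {e e' : ℕ} {hb : b ∈ 𝒜 e} {hb' : b' ∈ 𝒜 e'}
    {φ φ' : N →ₗ[A] N'} {hφ : ∀ d, ∀ n ∈ 𝒩 d, φ n ∈ 𝒩' (d + e)}
    {hφ' : ∀ d, ∀ n ∈ 𝒩 d, φ' n ∈ 𝒩' (d + e')} (h : b' • φ = b • φ') :
    fracMap U b hU e hb φ hφ = fracMap U b' hU' e' hb' φ' hφ' :=
  restrict_projTilde_hom_ext fun _ t x => localizedDiv_congr x.1 _ _ h (t.1 x)

theorem localizedDiv_comp (x : ProjectiveSpectrum 𝒜) (φ : N →ₗ[A] N') (ψ : N' →ₗ[A] N'') (b b' : A)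
    (hb : b ∈ x.asHomogeneousIdeal.toIdeal.primeCompl)
    (hb' : b' ∈ x.asHomogeneousIdeal.toIdeal.primeCompl) (v : LocalizedAt 𝒜 N x) :
    localizedDiv x ψ b' hb' (localizedDiv x φ b hb v) =
      localizedDiv x (ψ ∘ₗ φ) (b' * b) (Submonoid.mul_mem _ hb' hb) v := by
  induction v using LocalizedModule.induction_on with
  | h n c =>
    rw [localizedDiv_mk, localizedDiv_mk, localizedDiv_mk, ← mul_assoc]
    rfl

theorem NonvanishingOn.mul {U : (Proj 𝒜).Opens} {b b' : A} (hU : NonvanishingOn U b)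
    (hU' : NonvanishingOn U b') : NonvanishingOn U (b * b') :=
  fun x hx => Submonoid.mul_mem _ (hU x hx) (hU' x hx)

theorem NonvanishingOn.one (U : (Proj 𝒜).Opens) : NonvanishingOn U (1 : A) :=
  fun _ _ => Submonoid.one_mem _

theorem fracMap_comp (U : (Proj 𝒜).Opens) {b b' : A} (hU : NonvanishingOn U b)
    (hU' : NonvanishingOn U b') {e e' : ℕ} (hb : b ∈ 𝒜 e) (hb' : b' ∈ 𝒜 e')
    (φ : N →ₗ[A] N') (hφ : ∀ d, ∀ n ∈ 𝒩 d, φ n ∈ 𝒩' (d + e))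
    (ψ : N' →ₗ[A] N'') (hψ : ∀ d, ∀ n ∈ 𝒩' d, ψ n ∈ 𝒩'' (d + e')) :
    fracMap U b hU e hb φ hφ ≫ fracMap U b' hU' e' hb' ψ hψ =
      fracMap U (b' * b) (hU'.mul hU) (e' + e) (SetLike.mul_mem_graded hb' hb) (ψ ∘ₗ φ)
        (fun d n hn => by
          rw [add_comm e', ← add_assoc]
          exact hψ _ _ (hφ d n hn)) :=
  restrict_projTilde_hom_ext fun _ t x => localizedDiv_comp x.1 φ ψ b b' _ _ (t.1 x)

theorem fracMap_add (U : (Proj 𝒜).Opens) {b : A} (hU : NonvanishingOn U b) {e : ℕ} (hb : b ∈ 𝒜 e)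
    (φ : N →ₗ[A] N') (hφ : ∀ d, ∀ n ∈ 𝒩 d, φ n ∈ 𝒩' (d + e))
    (ψ : N →ₗ[A] N') (hψ : ∀ d, ∀ n ∈ 𝒩 d, ψ n ∈ 𝒩' (d + e)) :
    fracMap U b hU e hb φ hφ + fracMap U b hU e hb ψ hψ =
      fracMap U b hU e hb (φ + ψ) (fun d n hn => add_mem (hφ d n hn) (hψ d n hn)) := by
  refine restrict_projTilde_hom_ext fun V t x => ?_
  have key : ∀ (x : ProjectiveSpectrum 𝒜) (hb : b ∈ x.asHomogeneousIdeal.toIdeal.primeCompl)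
      (v : LocalizedAt 𝒜 N x), localizedDiv x φ b hb v + localizedDiv x ψ b hb v =
        localizedDiv x (φ + ψ) b hb v := by
    intro x hb v
    induction v using LocalizedModule.induction_on with
    | h n c =>
      rw [localizedDiv_mk, localizedDiv_mk, localizedDiv_mk, LocalizedModule.mk_add_mk,
        ← smul_add]
      exact LocalizedModule.mk_cancel_common_left _ _ _
  exact key x.1 _ (t.1 x)

/-- The fraction `b / b` of maps is the identity. -/
theorem fracMap_smul_id (U : (Proj 𝒜).Opens) {b : A} (hU : NonvanishingOn U b) {e : ℕ}
    (hb : b ∈ 𝒜 e) (φ : N →ₗ[A] N) (hφ : ∀ d, ∀ n ∈ 𝒩 d, φ n ∈ 𝒩 (d + e))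
    (h : φ = b • LinearMap.id) : fracMap U b hU e hb φ hφ = 𝟙 _ := by
  subst h
  refine restrict_projTilde_hom_ext fun V t x => ?_
  have key : ∀ (x : ProjectiveSpectrum 𝒜) (hb : b ∈ x.asHomogeneousIdeal.toIdeal.primeCompl)
      (v : LocalizedAt 𝒜 N x), localizedDiv x (b • LinearMap.id) b hb v = v := by
    intro x hb v
    induction v using LocalizedModule.induction_on with
    | h n c =>
      rw [localizedDiv_mk]
      exact LocalizedModule.mk_cancel_common_left ⟨b, hb⟩ c n
  exact key x.1 _ (t.1 x)

theorem fracMap_eq_zero (U : (Proj 𝒜).Opens) {b : A} (hU : NonvanishingOn U b) {e : ℕ}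
    (hb : b ∈ 𝒜 e) (φ : N →ₗ[A] N') (hφ : ∀ d, ∀ n ∈ 𝒩 d, φ n ∈ 𝒩' (d + e)) (h : φ = 0) :
    fracMap U b hU e hb φ hφ = 0 := by
  subst h
  refine restrict_projTilde_hom_ext fun V t x => ?_
  have key : ∀ (x : ProjectiveSpectrum 𝒜) (hb : b ∈ x.asHomogeneousIdeal.toIdeal.primeCompl)
      (v : LocalizedAt 𝒜 N x), localizedDiv x (0 : N →ₗ[A] N') b hb v = 0 := by
    intro x hb v
    induction v using LocalizedModule.induction_on with
    | h n c => rw [localizedDiv_mk, LinearMap.zero_apply, LocalizedModule.zero_mk]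
  exact key x.1 _ (t.1 x)

/-- The restriction of a morphism of degree zero, as a fraction with denominator `1`. -/
theorem restrictFunctor_map_projTildeMap (U : (Proj 𝒜).Opens) (φ : N →ₗ[A] N')
    (hφ : ∀ d, ∀ n ∈ 𝒩 d, φ n ∈ 𝒩' d) :
    (Scheme.Modules.restrictFunctor U.ι).map (projTildeMap 𝒜 φ hφ) =
      fracMap U 1 (NonvanishingOn.one U) 0 SetLike.GradedOne.one_mem φ hφ := by
  refine restrict_projTilde_hom_ext fun V t x => ?_
  have key : ∀ (x : ProjectiveSpectrum 𝒜) (hb : (1 : A) ∈ x.asHomogeneousIdeal.toIdeal.primeCompl)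
      (v : LocalizedAt 𝒜 N x), localizedMap 𝒜 x φ v = localizedDiv x φ 1 hb v := by
    intro x hb v
    induction v using LocalizedModule.induction_on with
    | h n c =>
      rw [localizedDiv_mk, localizedMap_mk]
      exact congrArg _ (one_mul c).symm
  exact key x.1 _ (t.1 x)

end FracMap

/-! ### Restriction to open sets and contractions of complexes -/

section Restr
open Limits
variable {X : Scheme.{u}} (U : X.Opens)

instance restrictFunctor_preservesColimits :
    PreservesColimits (Scheme.Modules.restrictFunctor U.ι) :=
  (Scheme.Modules.restrictAdjunction U.ι).leftAdjoint_preservesColimits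

/-- Limits of sheaves of modules are computed on sections, hence commute with restriction. -/
instance restrictFunctor_preservesLimits :
    PreservesLimits (Scheme.Modules.restrictFunctor U.ι) := by
  have : ReflectsLimits (Scheme.Modules.toPresheaf U.toScheme) :=
    reflectsLimits_of_reflectsIsomorphisms
  have : PreservesLimits ((Functor.whiskeringLeft _ _ Ab.{u}).obj U.ι.opensFunctor.op) :=
    inferInstance
  have : PreservesLimits (Scheme.Modules.toPresheaf X ⋙
      (Functor.whiskeringLeft _ _ Ab.{u}).obj U.ι.opensFunctor.op) := comp_preservesLimits _ _
  have : PreservesLimits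
      (Scheme.Modules.restrictFunctor U.ι ⋙ Scheme.Modules.toPresheaf U.toScheme) := this
  exact preservesLimits_of_reflects_of_preserves _ (Scheme.Modules.toPresheaf U.toScheme)

instance restrictFunctor_additive : (Scheme.Modules.restrictFunctor U.ι).Additive where
  map_add := rfl

end Restr

section Image
open Limits

/-- A functor which preserves epimorphisms and monomorphisms preserves images. -/
def mapImageIso {C D : Type*} [Category C] [Category D] [Abelian C] [Abelian D] (R : C ⥤ D)
    [R.PreservesMonomorphisms] [R.PreservesEpimorphisms] {X Y : C} (f : X ⟶ Y) {I : D}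
    (e : R.obj X ⟶ I) (m : I ⟶ R.obj Y) [Epi e] [Mono m] (h : e ≫ m = R.map f) :
    R.obj (image f) ≅ I :=
  have : StrongEpi (R.map (factorThruImage f)) := strongEpi_of_epi _
  have : StrongEpi e := strongEpi_of_epi _
  image.isoStrongEpiMono (R.map (factorThruImage f)) (R.map (image.ι f))
    (by rw [← R.map_comp, image.fac]) ≪≫ (image.isoStrongEpiMono e m h).symm

end Image

section Contraction
open Limits
variable {C : Type*} [Category C] [Preadditive C]

/-- A homotopy equivalence between a short complex `X₁ ⟶ X₂ ⟶ X₃` and an object `H` placed in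
the middle. -/
structure Contraction (S : ShortComplex C) (H : C) where
  /-- The inclusion of `H`. -/
  i : H ⟶ S.X₂
  /-- The projection to `H`. -/
  p : S.X₂ ⟶ H
  /-- The homotopy in degree two. -/
  s : S.X₂ ⟶ S.X₁
  /-- The homotopy in degree three. -/
  t : S.X₃ ⟶ S.X₂
  i_g : i ≫ S.g = 0
  f_p : S.f ≫ p = 0
  i_p : i ≫ p = 𝟙 H
  htpy : p ≫ i + s ≫ S.f + S.g ≫ t = 𝟙 S.X₂

namespace Contraction
variable {S : ShortComplex C} {H : C} (c : Contraction S H) (h : S.LeftHomologyData)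

theorem g_t_g : S.g ≫ c.t ≫ S.g = S.g := by
  have := congrArg (· ≫ S.g) c.htpy
  simpa [Preadditive.add_comp, c.i_g] using this

theorem f_s_f : S.f ≫ c.s ≫ S.f = S.f := by
  have := congrArg (S.f ≫ ·) c.htpy
  simpa [Preadditive.comp_add, c.f_p, reassoc_of% c.f_p] using this

/-- The retraction of `X₂` onto the cycles. -/
def toK : S.X₂ ⟶ h.K := h.liftK (𝟙 _ - S.g ≫ c.t) (by
  simp [Preadditive.sub_comp, c.g_t_g])

theorem toK_i : c.toK h ≫ h.i = 𝟙 _ - S.g ≫ c.t := h.liftK_i _ _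

theorem i_toK : h.i ≫ c.toK h = 𝟙 _ := by
  rw [← cancel_mono h.i, Category.assoc, toK_i, Preadditive.comp_sub, h.wi_assoc]
  simp

/-- The projection of the homology onto `H`. -/
def fromH : h.H ⟶ H := h.descH (h.i ≫ c.p) (by
  rw [h.f'_i_assoc, c.f_p])

theorem π_fromH : h.π ≫ c.fromH h = h.i ≫ c.p := h.π_descH _ _

/-- A section of the projection from the cycles to the homology. -/
def sect : h.H ⟶ h.K := c.fromH h ≫ c.i ≫ c.toK h

theorem cycles_decomp : h.π ≫ c.sect h + h.i ≫ c.s ≫ h.f' = 𝟙 _ := by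
  rw [← cancel_mono h.i, sect, ← Category.assoc h.π, π_fromH]
  simp only [Preadditive.add_comp, Category.assoc, toK_i, Preadditive.comp_sub, Category.comp_id,
    reassoc_of% c.i_g, zero_comp, sub_zero, h.f'_i, Category.id_comp]
  have := congrArg (h.i ≫ ·) c.htpy
  simpa [Preadditive.comp_add, h.wi_assoc] using this

theorem sect_π : c.sect h ≫ h.π = 𝟙 _ := by
  rw [← cancel_epi h.π, ← Category.assoc]
  have := congrArg (· ≫ h.π) (c.cycles_decomp h)
  simpa [Preadditive.add_comp] using this

/-- The homology of a complex contracted to `H` is `H`. -/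
def homologyIso : h.H ≅ H where
  hom := c.fromH h
  inv := c.i ≫ c.toK h ≫ h.π
  hom_inv_id := by simpa [sect] using c.sect_π h
  inv_hom_id := by
    rw [Category.assoc, Category.assoc, π_fromH, ← Category.assoc (c.toK h), toK_i]
    simp [Preadditive.sub_comp, Preadditive.comp_sub, c.i_p, reassoc_of% c.i_g]

end Contraction

end Contraction

/-! ### The sheaf of a free graded module of rank one -/

open Limits
section Unit

/-- The structure sheaf as a sheaf of modules. -/
def unitMod (X : Scheme.{u}) : X.Modules := SheafOfModules.unit X.ringCatSheaf

/-- The free sheaf of modules of rank `r`. -/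
def freeMod (X : Scheme.{u}) (r : ℕ) : X.Modules :=
  SheafOfModules.free (R := X.ringCatSheaf) (ULift.{u} (Fin r))

variable {k A N : Type u} [Field k] [CommRing A] [Algebra k A]
  {𝒜 : ℕ → Submodule k A} [GradedAlgebra 𝒜] [AddCommGroup N] [Module A N]
  {𝒩 : ℕ → AddSubgroup N}

theorem val_mk_smul (x : ProjectiveSpectrum 𝒜) (e : N) {d : ℕ} {a b : A} (ha : a ∈ 𝒜 d)
    (hb : b ∈ 𝒜 d) (hx : b ∈ x.asHomogeneousIdeal.toIdeal.primeCompl) :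
    HomogeneousLocalization.val (HomogeneousLocalization.mk ⟨d, ⟨a, ha⟩, ⟨b, hb⟩, hx⟩ :
      HomogeneousLocalization 𝒜 x.asHomogeneousIdeal.toIdeal.primeCompl) •
        (LocalizedModule.mk e 1 : LocalizedAt 𝒜 N x) = LocalizedModule.mk (a • e) ⟨b, hx⟩ := by
  rw [HomogeneousLocalization.val_mk]
  exact (LocalizedModule.mk_smul_mk ..).trans (by rw [mul_one])

theorem smul_mk_injective (x : ProjectiveSpectrum 𝒜) (e : N) (hinj : ∀ a : A, a • e = 0 → a = 0)
    (r r' : HomogeneousLocalization 𝒜 x.asHomogeneousIdeal.toIdeal.primeCompl)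
    (h : HomogeneousLocalization.val r • (LocalizedModule.mk e 1 : LocalizedAt 𝒜 N x) =
      HomogeneousLocalization.val r' • (LocalizedModule.mk e 1 : LocalizedAt 𝒜 N x)) :
    r = r' := by
  obtain ⟨⟨d, ⟨a, ha⟩, ⟨b, hb⟩, hx⟩, rfl⟩ := HomogeneousLocalization.mk_surjective r
  obtain ⟨⟨d', ⟨a', ha'⟩, ⟨b', hb'⟩, hx'⟩, rfl⟩ := HomogeneousLocalization.mk_surjective r'
  rw [val_mk_smul, val_mk_smul, LocalizedModule.mk_eq] at h
  obtain ⟨c, hc⟩ := h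
  apply HomogeneousLocalization.val_injective
  rw [HomogeneousLocalization.val_mk, HomogeneousLocalization.val_mk, Localization.mk_eq_mk_iff,
    Localization.r_iff_exists]
  refine ⟨c, ?_⟩
  simp only [Submonoid.smul_def, smul_smul] at hc
  have := hinj _ ((sub_smul _ _ e).trans (sub_eq_zero.mpr hc))
  simpa [mul_assoc] using sub_eq_zero.mp this

theorem exists_val_smul (x : ProjectiveSpectrum 𝒜) (e : N)
    (hsurj : ∀ d, ∀ n ∈ 𝒩 d, ∃ a ∈ 𝒜 d, n = a • e) (v : LocalizedAt 𝒜 N x)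
    (hv : ∃ (d : ℕ) (n : N) (b : A), n ∈ 𝒩 d ∧ b ∈ 𝒜 d ∧ IsFractionAt 𝒜 x n b v) :
    ∃ r : HomogeneousLocalization 𝒜 x.asHomogeneousIdeal.toIdeal.primeCompl,
      HomogeneousLocalization.val r • (LocalizedModule.mk e 1 : LocalizedAt 𝒜 N x) = v := by
  obtain ⟨d, n, b, hn, hb, hx, w⟩ := hv
  obtain ⟨a, ha, rfl⟩ := hsurj d n hn
  exact ⟨HomogeneousLocalization.mk ⟨d, ⟨a, ha⟩, ⟨b, hb⟩, hx⟩,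
    (val_mk_smul x e ha hb hx).trans w.symm⟩

variable [SetLike.GradedSMul 𝒜 𝒩]

variable (𝒩) in
/-- The constant section of `Ñ` over `V` given by an element of `N` of degree zero. -/
def constSection (e : N) (he : e ∈ 𝒩 0) (V : (Opens (ProjectiveSpectrum.top 𝒜))ᵒᵖ) :
    (projTildeInType 𝒜 𝒩).1.obj V :=
  ⟨fun _ => LocalizedModule.mk e 1, fun x => ⟨V.unop, x.2, 𝟙 _, 0, e, 1, he,
    SetLike.GradedOne.one_mem, fun _ => ⟨Submonoid.one_mem _, rfl⟩⟩⟩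

/-- The map of presheaves underlying `unitToTilde`. -/
def unitToTildeAb (e : N) (he : e ∈ 𝒩 0) :
    (unitMod (Proj 𝒜)).presheaf ⟶
      (projTilde 𝒜 𝒩).presheaf where
  app (V : (Opens (ProjectiveSpectrum.top 𝒜))ᵒᵖ) := AddCommGrpCat.ofHom
    { toFun := fun r : (ProjectiveSpectrum.Proj.structureSheaf 𝒜).1.obj V =>
        r • constSection 𝒩 e he V
      map_zero' := zero_smul ((ProjectiveSpectrum.Proj.structureSheaf 𝒜).1.obj V)
        (constSection 𝒩 e he V)
      map_add' := fun r r' : (ProjectiveSpectrum.Proj.structureSheaf 𝒜).1.obj V =>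
        add_smul r r' (constSection 𝒩 e he V) }
  naturality _ _ _ := rfl

variable (𝒩) in
/-- The morphism `𝒪 ⟶ Ñ` given by a global section `e` of degree zero. -/
def unitToTilde (e : N) (he : e ∈ 𝒩 0) :
    unitMod (Proj 𝒜) ⟶ projTilde 𝒜 𝒩 :=
  SheafOfModules.Hom.mk (PresheafOfModules.homMk
    (M₁ := PresheafOfModules.unit (Proj 𝒜).ringCatSheaf.obj)
    (M₂ := (projTilde 𝒜 𝒩).val) (unitToTildeAb e he)
    (fun (V : (Opens (ProjectiveSpectrum.top 𝒜))ᵒᵖ)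
        (r : (ProjectiveSpectrum.Proj.structureSheaf 𝒜).1.obj V)
        (r' : (ProjectiveSpectrum.Proj.structureSheaf 𝒜).1.obj V) =>
      mul_smul r r' (constSection 𝒩 e he V)))

/-- If `N` is free on one generator `e` of degree zero, then `Ñ` is the structure sheaf. -/
theorem isIso_unitToTilde (e : N) (he : e ∈ 𝒩 0) (hinj : ∀ a : A, a • e = 0 → a = 0)
    (hsurj : ∀ d, ∀ n ∈ 𝒩 d, ∃ a ∈ 𝒜 d, n = a • e) : IsIso (unitToTilde (𝒜 := 𝒜) 𝒩 e he) := by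
  rw [Scheme.Modules.Hom.isIso_iff_isIso_app]
  intro (V : Opens (ProjectiveSpectrum.top 𝒜))
  rw [ConcreteCategory.isIso_iff_bijective]
  refine ⟨fun r r' h => ?_, fun t => ?_⟩
  · refine Subtype.ext (funext fun x => smul_mk_injective x.1 e hinj _ _ ?_)
    exact congrFun (congrArg Subtype.val
      (show (_ : (projTildeInType 𝒜 𝒩).1.obj (op V)) = _ from h)) x
  · let t' : (projTildeInType 𝒜 𝒩).1.obj (op V) := t
    choose r hr using fun x : (V : Opens (ProjectiveSpectrum.top 𝒜)) =>
      exists_val_smul x.1 e hsurj (t'.1 x) (by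
        obtain ⟨W, mW, iW, d, n, b, hn, hb, w⟩ := t'.2 x
        exact ⟨d, n, b, hn, hb, w ⟨x.1, mW⟩⟩)
    refine ⟨(⟨r, fun x => ?_⟩ : (ProjectiveSpectrum.Proj.structureSheaf 𝒜).1.obj (op V)),
      Subtype.ext (funext fun x => hr x)⟩
    obtain ⟨W, mW, iW, d, n, b, hn, hb, w⟩ := t'.2 x
    obtain ⟨a, ha, rfl⟩ := hsurj d n hn
    refine ⟨W, mW, iW, d, ⟨a, ha⟩, ⟨b, hb⟩, fun y => (w y).choose, fun y => ?_⟩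
    refine smul_mk_injective y.1 e hinj _ _ ?_
    exact (hr (iW y)).trans ((w y).choose_spec.trans (val_mk_smul y.1 e ha hb _).symm)

end Unit

/-! ### The sheaves `W ⊗ 𝒪(j)` -/

open Limits
section Twist
variable {k : Type u} [Field k] {s : ℕ}
variable {W W' W'' : Type u} [AddCommGroup W] [Module k W] [AddCommGroup W'] [Module k W']
  [AddCommGroup W''] [Module k W'']

theorem twistMap_comp (g : W →ₗ[k] W') (g' : W' →ₗ[k] W'') (j : ℤ) :
    twistMap (s := s) g j ≫ twistMap g' j = twistMap (g' ∘ₗ g) j :=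
  (projTildeMap_comp ..).trans (projTildeMap_congr _ _ (LinearMap.baseChange_comp ..).symm _ _)

theorem twistMap_id (j : ℤ) : twistMap (s := s) (LinearMap.id : W →ₗ[k] W) j = 𝟙 _ := by
  refine projTildeMap_hom_ext _ _ fun U t x => ?_
  have key : ∀ (x : ProjectiveSpectrum (grading k s)) (v : LocalizedAt _ (S k s ⊗[k] W) x),
      localizedMap _ x ((LinearMap.id : W →ₗ[k] W).baseChange (S k s)) v = v := by
    intro x v
    induction v using LocalizedModule.induction_on with
    | h n c => rw [localizedMap_mk, LinearMap.baseChange_id, LinearMap.id_apply]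
  exact key x.1 (t.1 x)

theorem twistMap_add (g g' : W →ₗ[k] W') (j : ℤ) :
    twistMap (s := s) (g + g') j = twistMap g j + twistMap g' j := by
  refine projTildeMap_hom_ext _ _ fun U t x => ?_
  have key : ∀ (x : ProjectiveSpectrum (grading k s)) (v : LocalizedAt _ (S k s ⊗[k] W) x),
      localizedMap _ x ((g + g').baseChange (S k s)) v =
        localizedMap _ x (g.baseChange (S k s)) v + localizedMap _ x (g'.baseChange (S k s)) v := by
    intro x v
    induction v using LocalizedModule.induction_on with
    | h n c =>
      rw [localizedMap_mk, localizedMap_mk, localizedMap_mk, LocalizedModule.mk_add_mk,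
        ← smul_add, LinearMap.baseChange_add]
      exact (LocalizedModule.mk_cancel_common_left _ _ _).symm
  exact key x.1 (t.1 x)

variable (k s W W') in
/-- `g ↦ g ⊗ id` as a homomorphism of abelian groups. -/
def twistMapHom (j : ℤ) : (W →ₗ[k] W') →+ (twist k s W j ⟶ twist k s W' j) :=
  AddMonoidHom.mk' (fun g => twistMap g j) fun g g' => twistMap_add g g' j

/-- Elements of degree zero of `k[Y] ⊗ k` are those of `k[Y]`. -/
theorem twistDeg_self_eq (d : ℕ) (n : S k s ⊗[k] k) (hn : n ∈ twistDeg k s k 0 d) :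
    ∃ a ∈ grading k s d, n = a • ((1 : S k s) ⊗ₜ[k] (1 : k)) := by
  induction hn using Submodule.span_induction with
  | mem n hn =>
    obtain ⟨e, f, w, he, hf, rfl⟩ := hn
    obtain rfl : e = d := by omega
    refine ⟨w • f, Submodule.smul_mem _ _ hf, ?_⟩
    rw [smul_tmul', smul_eq_mul, mul_one, smul_tmul, smul_eq_mul, mul_one]
  | zero => exact ⟨0, zero_mem _, (zero_smul _ _).symm⟩
  | add n n' _ _ h h' =>
    obtain ⟨a, ha, rfl⟩ := h
    obtain ⟨a', ha', rfl⟩ := h'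
    exact ⟨a + a', add_mem ha ha', (add_smul _ _ _).symm⟩
  | smul c n _ h =>
    obtain ⟨a, ha, rfl⟩ := h
    exact ⟨c • a, Submodule.smul_mem _ _ ha, (smul_assoc _ _ _).symm⟩

variable (k s) in
/-- The sheaf `k ⊗ 𝒪` is the structure sheaf. -/
def unitIsoTwist : unitMod (ProjSpace k s) ≅ twist k s k 0 :=
  @asIso _ _ _ _ (unitToTilde (𝒜 := grading k s) (twistDeg k s k 0)
    ((1 : S k s) ⊗ₜ[k] (1 : k)) (one_tmul_mem _)) <|
  isIso_unitToTilde ((1 : S k s) ⊗ₜ[k] (1 : k)) (one_tmul_mem _)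
    (fun a ha => by
      rw [smul_tmul', smul_eq_mul, mul_one] at ha
      simpa using congrArg (TensorProduct.rid k (S k s)) ha)
    twistDeg_self_eq

/-- The structure sheaf of `U`, as the restriction of `k ⊗ 𝒪`. -/
def restrictTwistIsoUnit (U : (ProjSpace k s).Opens) :
    (twist k s k 0).restrict U.ι ≅
      unitMod U.toScheme :=
  (Scheme.Modules.restrictFunctor U.ι).mapIso (unitIsoTwist k s).symm ≪≫
    Scheme.Modules.restrictUnitIso U.ι

/-- The coordinates on `k^r`. -/
abbrev coordProj {r : ℕ} (a : ULift.{u} (Fin r)) : (ULift.{u} (Fin r) → k) →ₗ[k] k :=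
  LinearMap.proj a

/-- The inclusions of the coordinate axes of `k^r`. -/
abbrev coordIncl {r : ℕ} (a : ULift.{u} (Fin r)) : k →ₗ[k] (ULift.{u} (Fin r) → k) :=
  LinearMap.single k (fun _ => k) a

/-- `k^r ⊗ 𝒪` restricted to `U` is a biproduct of `r` copies of the structure sheaf. -/
def freeBicone (U : (ProjSpace k s).Opens) (r : ℕ) :
    Bicone (fun _ : ULift.{u} (Fin r) =>
      unitMod U.toScheme) where
  pt := (twist k s (ULift.{u} (Fin r) → k) 0).restrict U.ι
  π a := (Scheme.Modules.restrictFunctor U.ι).map (twistMap (coordProj a) 0) ≫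
    (restrictTwistIsoUnit U).hom
  ι a := (restrictTwistIsoUnit U).inv ≫
    (Scheme.Modules.restrictFunctor U.ι).map (twistMap (coordIncl a) 0)
  ι_π a b := by
    have h : (Scheme.Modules.restrictFunctor U.ι).map (twistMap (s := s) (coordIncl a) 0) ≫
        (Scheme.Modules.restrictFunctor U.ι).map (twistMap (coordProj b) 0) =
        (Scheme.Modules.restrictFunctor U.ι).map
          (twistMap (s := s) (coordProj (k := k) b ∘ₗ coordIncl a) 0) := by
      rw [← CategoryTheory.Functor.map_comp, twistMap_comp]
    rw [Category.assoc, reassoc_of% h]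
    split_ifs with h
    · subst h
      rw [LinearMap.proj_comp_single_same, twistMap_id, CategoryTheory.Functor.map_id]
      simp
    · rw [LinearMap.proj_comp_single_ne _ _ _ _ (Ne.symm h),
        show twistMap (s := s) (0 : k →ₗ[k] k) 0 = 0 from map_zero (twistMapHom k s k k 0),
        Functor.map_zero, zero_comp, comp_zero]

theorem freeBicone_total (U : (ProjSpace k s).Opens) (r : ℕ) :
    ∑ a, (freeBicone U r).π a ≫ (freeBicone U r).ι a = 𝟙 (freeBicone U r).pt := by
  have h : ∀ a, (freeBicone U r).π a ≫ (freeBicone U r).ι a =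
      (Scheme.Modules.restrictFunctor U.ι).map
        (twistMap (s := s) (coordIncl (k := k) a ∘ₗ coordProj a) 0) := by
    intro a
    simp only [freeBicone, Category.assoc, Iso.hom_inv_id_assoc, ← CategoryTheory.Functor.map_comp,
      twistMap_comp]
  have h' : ∑ a, coordIncl (k := k) (r := r) a ∘ₗ coordProj a = LinearMap.id :=
    LinearMap.ext fun v => by
      simp only [LinearMap.sum_apply, LinearMap.comp_apply, LinearMap.proj_apply]
      exact LinearMap.sum_single_apply (fun _ => k) v
  have h'' := ((Scheme.Modules.restrictFunctor U.ι).map_sum (fun a => twistMap (s := s)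
    (coordIncl (k := k) (r := r) a ∘ₗ coordProj a) 0) Finset.univ).symm
  refine (Finset.sum_congr rfl fun a _ => h a).trans (h''.trans ?_)
  refine (congrArg _ ((map_sum (twistMapHom k s (ULift.{u} (Fin r) → k)
    (ULift.{u} (Fin r) → k) 0) _ _).symm.trans ((congrArg _ h').trans (twistMap_id 0)))).trans ?_
  exact CategoryTheory.Functor.map_id _ _

/-- `k^r ⊗ 𝒪` restricted to `U` is free of rank `r`. -/
def restrictTwistIsoFree (U : (ProjSpace k s).Opens) (r : ℕ) :
    (twist k s (ULift.{u} (Fin r) → k) 0).restrict U.ι ≅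
      freeMod U.toScheme r :=
  (isBilimitOfTotal (freeBicone U r) (freeBicone_total U r)).isColimit.coconePointUniqueUpToIso
    (t := (show Cofan (fun _ : ULift.{u} (Fin r) =>
      unitMod U.toScheme) from
      SheafOfModules.freeCofan (ULift.{u} (Fin r))))
    (SheafOfModules.isColimitFreeCofan _)

/-- A direct sum of free sheaves is free. -/
def freeBiprodIso (X : Scheme.{u}) (r r' : ℕ) :
    (freeMod X r ⊞ freeMod X r') ≅ freeMod X (r + r') :=
  biprod.isoCoprod _ _ ≪≫ SheafOfModules.freeSumIso _ _ ≪≫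
    (SheafOfModules.freeFunctor (R := X.ringCatSheaf)).mapIso (Equiv.toIso
      ((Equiv.sumCongr Equiv.ulift Equiv.ulift).trans (finSumFinEquiv.trans Equiv.ulift.symm)))

end Twist

/-! ### Minors and rank -/

section Minors
open Matrix
variable {m n L : Type*} [Fintype n] [Field L]

theorem exists_linearIndependent_rows [Fintype m] (A : Matrix m n L) {r : ℕ} (hr : r ≤ A.rank) :
    ∃ I : Fin r → m, LinearIndependent L (A.submatrix I _root_.id).row := by
  obtain ⟨κ, a, ha, hsp, hli⟩ := exists_linearIndependent' L A.row
  have : Finite κ := Finite.of_injective a ha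
  have := Fintype.ofFinite κ
  have hc : Fintype.card κ = A.rank := by
    rw [rank_eq_finrank_span_row, ← hsp]
    exact linearIndependent_iff_card_eq_finrank_span.mp hli
  have e := Fintype.equivFin κ
  exact ⟨fun i => a (e.symm (Fin.castLE (hr.trans_eq hc.symm) i)),
    hli.comp _ (e.symm.injective.comp (Fin.castLE_injective _))⟩

/-- A matrix of rank at least `r` has a nonzero minor of size `r`. -/
theorem exists_minor_ne_zero [Fintype m] (A : Matrix m n L) {r : ℕ} (hr : r ≤ A.rank) :
    ∃ (I : Fin r → m) (J : Fin r → n), (A.submatrix I J).det ≠ 0 := by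
  obtain ⟨I, hI⟩ := exists_linearIndependent_rows A hr
  have h1 : (A.submatrix I _root_.id)ᵀ.rank = r := by
    rw [rank_transpose, hI.rank_matrix, Fintype.card_fin]
  obtain ⟨J, hJ⟩ := exists_linearIndependent_rows _ h1.ge
  refine ⟨I, J, ?_⟩
  have := (linearIndependent_rows_iff_isUnit.mp hJ)
  rw [isUnit_iff_isUnit_det, isUnit_iff_ne_zero] at this
  rw [← det_transpose]
  exact this

theorem le_rank_of_minor_ne_zero (A : Matrix m n L) {r : ℕ} (I : Fin r → m) (J : Fin r → n)
    (h : (A.submatrix I J).det ≠ 0) : r ≤ A.rank := by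
  refine le_trans ?_ (rank_submatrix_le A I J)
  rw [rank_of_det_ne_zero h, Fintype.card_fin]

/-- A matrix of rank `r` is recovered from the rows and columns of an invertible `r × r` minor. -/
theorem cur_decomposition_field [Fintype m] (A : Matrix m n L) {r : ℕ} (hr : A.rank ≤ r)
    (I : Fin r → m) (J : Fin r → n) (h : (A.submatrix I J).det ≠ 0) :
    A.submatrix _root_.id J * (A.submatrix I J).adjugate * A.submatrix I _root_.id =
      (A.submatrix I J).det • A := by
  classical
  have hsub : Submodule.span L (Set.range (A.submatrix _root_.id J).col) ≤
      Submodule.span L (Set.range A.col) :=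
    Submodule.span_mono (by rintro _ ⟨j, rfl⟩; exact ⟨J j, rfl⟩)
  have heq := Submodule.eq_of_le_of_finrank_le hsub (by
    rw [← rank_eq_finrank_span_cols, ← rank_eq_finrank_span_cols]
    refine hr.trans (le_rank_of_minor_ne_zero _ I _root_.id ?_)
    exact h)
  have hC : ∀ j, ∃ c : Fin r → L, (A.submatrix _root_.id J) *ᵥ c = A.col j := by
    intro j
    have : A.col j ∈ Submodule.span L (Set.range (A.submatrix _root_.id J).col) := by
      rw [heq]; exact Submodule.subset_span ⟨j, rfl⟩
    rw [← range_mulVecLin] at this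
    exact this
  -- the columns `J` span the column space, which gives a factorization `A = A[·, J] C`
  choose c hc using hC
  have hA : A = A.submatrix _root_.id J * (Matrix.of c)ᵀ := by
    ext i j
    exact (congrFun (hc j) i).symm
  have hI : A.submatrix I _root_.id = A.submatrix I J * (Matrix.of c)ᵀ := by
    ext i j
    exact (congrFun (hc j) (I i)).symm
  rw [hI, Matrix.mul_assoc, ← Matrix.mul_assoc (adjugate _), adjugate_mul, Matrix.smul_mul,
    Matrix.one_mul, Matrix.mul_smul, ← hA]

theorem cur_decomposition [Fintype m] {R : Type*} [CommRing R] [IsDomain R]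
    (A : Matrix m n R) {r : ℕ} (hr : (A.map (algebraMap R (FractionRing R))).rank ≤ r)
    (I : Fin r → m)
    (J : Fin r → n) (h : (A.submatrix I J).det ≠ 0) :
    A.submatrix _root_.id J * (A.submatrix I J).adjugate * A.submatrix I _root_.id =
      (A.submatrix I J).det • A := by
  have hinj := IsFractionRing.injective R (FractionRing R)
  have hdet : ((A.map (algebraMap R (FractionRing R))).submatrix I J).det =
      algebraMap R (FractionRing R) (A.submatrix I J).det := by
    rw [RingHom.map_det]; rfl
  have key := cur_decomposition_field _ hr I J (by
    rw [hdet]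
    exact fun h' => h (hinj (h'.trans (map_zero _).symm)))
  apply Matrix.map_injective hinj
  rw [hdet] at key
  have hadj : ((A.map (algebraMap R (FractionRing R))).submatrix I J).adjugate =
      ((A.submatrix I J).adjugate).map (algebraMap R (FractionRing R)) :=
    (RingHom.map_adjugate (algebraMap R (FractionRing R)) (A.submatrix I J)).symm
  beta_reduce
  rw [Matrix.map_mul, Matrix.map_mul, ← hadj]
  refine key.trans ?_
  ext i j
  simp

end Minors

/-! ### Homogeneous matrices -/

section Degrees
open Matrix
variable {k : Type u} [Field k] {s : ℕ} {l m n : Type*}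

/-- The polynomial `a` is homogeneous of the integral degree `e`: it vanishes, or `e` is a natural
number and `a` is homogeneous of degree `e`. Integral degrees allow for the degree `r - 1` of the
cofactors of an `r × r` matrix of linear forms, also for `r = 0`. -/
def HasDeg (e : ℤ) (a : S k s) : Prop := a = 0 ∨ ∃ d : ℕ, (d : ℤ) = e ∧ a ∈ grading k s d

/-- All entries of the matrix are homogeneous of degree `e`. -/
def MatDeg (e : ℤ) (A : Matrix m n (S k s)) : Prop := ∀ i j, HasDeg e (A i j)

theorem HasDeg.zero (e : ℤ) : HasDeg e (0 : S k s) := Or.inl rfl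

theorem HasDeg.of_mem {d : ℕ} {a : S k s} (h : a ∈ grading k s d) : HasDeg (d : ℤ) a :=
  Or.inr ⟨d, rfl, h⟩

theorem HasDeg.mem {d : ℕ} {a : S k s} (h : HasDeg (d : ℤ) a) : a ∈ grading k s d := by
  obtain rfl | ⟨e, he, h⟩ := h
  · exact zero_mem _
  · obtain rfl : e = d := by exact_mod_cast he
    exact h

theorem HasDeg.one : HasDeg 0 (1 : S k s) := Or.inr ⟨0, rfl, SetLike.GradedOne.one_mem⟩

theorem HasDeg.mul {e e' : ℤ} {a b : S k s} (ha : HasDeg e a) (hb : HasDeg e' b) :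
    HasDeg (e + e') (a * b) := by
  obtain rfl | ⟨d, rfl, ha⟩ := ha
  · rw [zero_mul]; exact .zero _
  obtain rfl | ⟨d', rfl, hb⟩ := hb
  · rw [mul_zero]; exact .zero _
  exact Or.inr ⟨d + d', by push_cast; rfl, SetLike.mul_mem_graded ha hb⟩

theorem HasDeg.add {e : ℤ} {a b : S k s} (ha : HasDeg e a) (hb : HasDeg e b) :
    HasDeg e (a + b) := by
  obtain rfl | ⟨d, rfl, ha⟩ := ha
  · rwa [zero_add]
  exact Or.inr ⟨d, rfl, add_mem ha hb.mem⟩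

theorem HasDeg.neg {e : ℤ} {a : S k s} (ha : HasDeg e a) : HasDeg e (-a) := by
  obtain rfl | ⟨d, rfl, ha⟩ := ha
  · rw [neg_zero]; exact .zero _
  exact Or.inr ⟨d, rfl, neg_mem ha⟩

theorem HasDeg.sum {ι : Type*} {t : Finset ι} {e : ℤ} {a : ι → S k s}
    (h : ∀ i ∈ t, HasDeg e (a i)) : HasDeg e (∑ i ∈ t, a i) :=
  Finset.sum_induction _ _ (fun _ _ => HasDeg.add) (.zero _) h

theorem HasDeg.prod {ι : Type*} {t : Finset ι} {e : ι → ℤ} {a : ι → S k s}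
    (h : ∀ i ∈ t, HasDeg (e i) (a i)) : HasDeg (∑ i ∈ t, e i) (∏ i ∈ t, a i) := by
  classical
  induction t using Finset.induction_on with
  | empty => exact .one
  | insert i t hi ih =>
    rw [Finset.sum_insert hi, Finset.prod_insert hi]
    exact (h i (Finset.mem_insert_self _ _)).mul
      (ih fun j hj => h j (Finset.mem_insert_of_mem hj))

theorem HasDeg.det {r : ℕ} {A : Matrix (Fin r) (Fin r) (S k s)} {d : Fin r → ℤ}
    (h : ∀ i j, HasDeg (d i) (A i j)) : HasDeg (∑ i, d i) A.det := by
  rw [det_apply]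
  refine HasDeg.sum fun σ _ => ?_
  have h1 : HasDeg (∑ i, d i) (∏ i, A (σ i) i) := by
    rw [← Equiv.sum_comp σ d]
    exact HasDeg.prod fun i _ => h _ _
  rcases Int.units_eq_one_or (Equiv.Perm.sign σ) with h2 | h2 <;> rw [h2]
  · rwa [one_smul]
  · rw [Units.neg_smul, one_smul]; exact h1.neg

theorem MatDeg.det {r : ℕ} {A : Matrix (Fin r) (Fin r) (S k s)} {e : ℤ} (h : MatDeg e A) :
    HasDeg (r * e) A.det := by
  have := HasDeg.det (d := fun _ => e) h
  simpa using this

theorem MatDeg.adjugate {r : ℕ} {A : Matrix (Fin r) (Fin r) (S k s)} {e : ℤ} (h : MatDeg e A) :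
    MatDeg ((r - 1) * e) A.adjugate := by
  intro i j
  rw [adjugate_apply]
  have := HasDeg.det (A := A.updateRow j (Pi.single i 1))
    (d := fun i' => e - (if i' = j then e else 0)) (fun i' j' => by
      by_cases hi : i' = j
      · subst hi
        rw [updateRow_self, if_pos rfl, sub_self]
        by_cases hj : j' = i
        · subst hj; rw [Pi.single_eq_same]; exact .one
        · rw [Pi.single_eq_of_ne hj]; exact .zero _
      · rw [updateRow_ne hi, if_neg hi, sub_zero]
        exact h _ _)
  convert this using 1
  simp [sub_mul]

theorem MatDeg.mul [Fintype m] {e e' : ℤ} {A : Matrix l m (S k s)} {B : Matrix m n (S k s)}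
    (hA : MatDeg e A) (hB : MatDeg e' B) : MatDeg (e + e') (A * B) :=
  fun i j => HasDeg.sum fun x _ => (hA i x).mul (hB x j)

theorem MatDeg.add {e : ℤ} {A B : Matrix m n (S k s)} (hA : MatDeg e A) (hB : MatDeg e B) :
    MatDeg e (A + B) := fun i j => (hA i j).add (hB i j)

theorem MatDeg.sub {e : ℤ} {A B : Matrix m n (S k s)} (hA : MatDeg e A) (hB : MatDeg e B) :
    MatDeg e (A - B) := fun i j => by
  rw [Matrix.sub_apply, sub_eq_add_neg]
  exact (hA i j).add (hB i j).neg

theorem MatDeg.smul {e e' : ℤ} {a : S k s} {A : Matrix m n (S k s)} (ha : HasDeg e a)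
    (hA : MatDeg e' A) : MatDeg (e + e') (a • A) := fun i j => ha.mul (hA i j)

theorem MatDeg.one [DecidableEq m] : MatDeg 0 (1 : Matrix m m (S k s)) := fun i j => by
  rw [Matrix.one_apply]
  split_ifs
  · exact .one
  · exact .zero _

theorem MatDeg.submatrix {m' n' : Type*} {e : ℤ} {A : Matrix m n (S k s)} (hA : MatDeg e A)
    (f : m' → m) (g : n' → n) : MatDeg e (A.submatrix f g) := fun _ _ => hA _ _

theorem MatDeg.congr {e e' : ℤ} {A : Matrix m n (S k s)} (hA : MatDeg e A) (h : e = e') :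
    MatDeg e' A := h ▸ hA

end Degrees

/-! ### Homogeneous splittings -/

section Splitting
open Matrix
variable {k : Type u} [Field k] {s : ℕ} {l m n : Type*} {L : Type*} [Field L]

/-- If the rank of `A` at the point given by `φ` is at least the generic rank, then some minor of
maximal size does not vanish there, and it is the denominator of a homogeneous generalized inverse
of `A`. -/
theorem exists_homogeneous_inverse [Fintype m] [Fintype n] {e : ℤ} (A : Matrix m n (S k s))
    (hA : MatDeg e A) {r : ℕ}
    (hr : (A.map (algebraMap (S k s) (FractionRing (S k s)))).rank ≤ r)
    (φ : S k s →+* L) (hφ : r ≤ (A.map φ).rank) :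
    ∃ (I : Fin r → m) (J : Fin r → n), φ (A.submatrix I J).det ≠ 0 ∧
      HasDeg (r * e) (A.submatrix I J).det ∧
      A.submatrix _root_.id J * (A.submatrix I J).adjugate * A.submatrix I _root_.id =
        (A.submatrix I J).det • A := by
  obtain ⟨I, J, h⟩ := exists_minor_ne_zero _ hφ
  have h' : φ (A.submatrix I J).det ≠ 0 := by
    rw [RingHom.map_det]; exact h
  exact ⟨I, J, h', (hA.submatrix I J).det,
    cur_decomposition A hr I J fun h0 => h' (by rw [h0, map_zero])⟩

theorem mul_one_submatrix [Fintype n] [DecidableEq n] {R : Type*} [CommRing R] {r : ℕ}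
    (A : Matrix m n R) (J : Fin r → n) :
    A * (1 : Matrix n n R).submatrix _root_.id J = A.submatrix _root_.id J := by
  ext i j
  simp [Matrix.mul_apply, Matrix.one_apply]

theorem one_submatrix_mul [Fintype m] [DecidableEq m] {R : Type*} [CommRing R] {r : ℕ}
    (A : Matrix m n R) (I : Fin r → m) :
    (1 : Matrix m m R).submatrix I _root_.id * A = A.submatrix I _root_.id := by
  ext i j
  simp [Matrix.mul_apply, Matrix.one_apply]

/-- A factorization of `h A` through a free module of rank `r`, with homogeneous matrices, whose
factors become split after inverting `h`. -/
structure ImageSplitting [Fintype m] [Fintype n] (A : Matrix m n (S k s)) (r : ℕ) where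
  /-- The denominator. -/
  h : S k s
  /-- The degree of the denominator. -/
  d : ℕ
  h_deg : h ∈ grading k s d
  /-- The projection to the image. -/
  pr : Matrix (Fin r) n (S k s)
  /-- The inclusion of the image. -/
  inc : Matrix m (Fin r) (S k s)
  /-- The section of the projection. -/
  prInv : Matrix n (Fin r) (S k s)
  /-- The retraction of the inclusion. -/
  incInv : Matrix (Fin r) m (S k s)
  pr_deg : MatDeg 1 pr
  inc_deg : MatDeg d inc
  prInv_deg : MatDeg (d - 1) prInv
  incInv_deg : MatDeg 0 incInv
  inc_pr : inc * pr = h • A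
  pr_prInv : pr * prInv = h • 1
  incInv_inc : incInv * inc = h • 1

/-- The factors are the rows and the columns of a maximal minor which does not vanish at `φ`. -/
theorem exists_imageSplitting [Fintype m] [Fintype n] [DecidableEq m] [DecidableEq n]
    (A : Matrix m n (S k s)) (hA : MatDeg 1 A) {r : ℕ}
    (hr : (A.map (algebraMap (S k s) (FractionRing (S k s)))).rank ≤ r)
    (φ : S k s →+* L) (hφ : r ≤ (A.map φ).rank) :
    ∃ D : ImageSplitting A r, φ D.h ≠ 0 := by
  obtain ⟨I, J, h0, hd, h⟩ := exists_homogeneous_inverse A hA hr φ hφ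
  refine ⟨⟨(A.submatrix I J).det, r, HasDeg.mem (by simpa using hd), A.submatrix I _root_.id,
    A.submatrix _root_.id J * (A.submatrix I J).adjugate,
    (1 : Matrix n n (S k s)).submatrix _root_.id J * (A.submatrix I J).adjugate,
    (1 : Matrix m m (S k s)).submatrix I _root_.id, hA.submatrix _ _,
    ((hA.submatrix _ _).mul (hA.submatrix I J).adjugate).congr (by ring),
    ((MatDeg.one.submatrix _ _).mul (hA.submatrix I J).adjugate).congr (by ring),
    MatDeg.one.submatrix _ _, h, ?_, ?_⟩, h0⟩
  · rw [← Matrix.mul_assoc, mul_one_submatrix]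
    exact mul_adjugate _
  · rw [← Matrix.mul_assoc, one_submatrix_mul]
    exact mul_adjugate _

/-- A homotopy equivalence between the complex given by the matrices `A` and `B` with `B A = 0` and
a free module of rank `r`, by homogeneous matrices and up to the denominator `h`. -/
structure ComplexSplitting [Fintype l] [Fintype m] [Fintype n] [DecidableEq m]
    (A : Matrix m n (S k s)) (B : Matrix l m (S k s)) (r : ℕ) where
  /-- The denominator. -/
  h : S k s
  /-- The degree of the denominator. -/
  d : ℕ
  h_deg : h ∈ grading k s d
  /-- The inclusion of the homology. -/
  inc : Matrix m (Fin r) (S k s)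
  /-- The projection to the homology. -/
  pr : Matrix (Fin r) m (S k s)
  /-- The homotopy, backwards along `A`. -/
  σ : Matrix n m (S k s)
  /-- The homotopy, backwards along `B`. -/
  τ : Matrix m l (S k s)
  /-- The degree of the inclusion. -/
  dinc : ℕ
  inc_deg : MatDeg dinc inc
  pr_deg : MatDeg (d - dinc) pr
  σ_deg : MatDeg (d - 1) σ
  τ_deg : MatDeg (d - 1) τ
  B_inc : B * inc = 0
  pr_A : pr * A = 0
  pr_inc : pr * inc = h • 1
  htpy : inc * pr + A * σ + τ * B = h • 1

theorem map_smul_ringHom {R R' : Type*} [CommRing R] [CommRing R'] (φ : R →+* R') (c : R)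
    (A : Matrix m n R) : (c • A).map φ = φ c • A.map φ := by
  ext i j
  simp

theorem matrix_rank_add_le [Finite m] [Fintype n] {R : Type*} [Field R] (A B : Matrix m n R) :
    (A + B).rank ≤ A.rank + B.rank := by
  refine le_trans (Submodule.finrank_mono (?_ : _ ≤ LinearMap.range A.mulVecLin ⊔
    LinearMap.range B.mulVecLin)) (Submodule.finrank_add_le_finrank_add_finrank _ _)
  rintro _ ⟨v, rfl⟩
  rw [mulVecLin_apply, add_mulVec]
  exact Submodule.add_mem_sup ⟨v, rfl⟩ ⟨v, rfl⟩

/-- Evaluating a homotopy `P ∼ h` at a point where `h ≠ 0` bounds the rank of `P` from below. -/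
theorem card_le_rank_of_htpy [Fintype l] [Fintype m] [Fintype n] [DecidableEq m] {R : Type*}
    [Field R] (A : Matrix m n R) (B : Matrix l m R) (P : Matrix m m R)
    (σ : Matrix n m R) (τ : Matrix m l R) {h : R} (hh : h ≠ 0)
    (htpy : P + A * σ + τ * B = h • 1) :
    Fintype.card m ≤ P.rank + A.rank + B.rank := by
  have h1 : (h • (1 : Matrix m m R)).rank = Fintype.card m := by
    rw [rank_smul_of_mem_nonZeroDivisors _ (mem_nonZeroDivisors_of_ne_zero hh), rank_one]
  rw [← h1, ← htpy]
  refine (matrix_rank_add_le _ _).trans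
    (add_le_add ((matrix_rank_add_le _ _).trans ?_) (rank_mul_le_right _ _))
  exact add_le_add le_rfl (rank_mul_le_left _ _)

/-- `Im P` and `Im A` are independent subspaces of `Ker B`. -/
theorem rank_le_card_of_htpy [Finite l] [Fintype m] [Fintype n] {R : Type*} [Field R]
    (A : Matrix m n R) (B : Matrix l m R)
    (P : Matrix m m R) {h : R} (hh : h ≠ 0) (hPP : P * P = h • P) (hPA : P * A = 0)
    (hBP : B * P = 0) (hBA : B * A = 0) : P.rank + A.rank + B.rank ≤ Fintype.card m := by
  have hdis : Disjoint (LinearMap.range P.mulVecLin) (LinearMap.range A.mulVecLin) := by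
    rw [Submodule.disjoint_def]
    rintro _ ⟨v, rfl⟩ ⟨w, hw⟩
    have h1 : P *ᵥ (P *ᵥ v) = h • (P *ᵥ v) := by rw [mulVec_mulVec, hPP, smul_mulVec]
    have h2 : A *ᵥ w = P *ᵥ v := hw
    rw [← h2, mulVec_mulVec, hPA, zero_mulVec] at h1
    exact h2.symm.trans ((smul_eq_zero.mp h1.symm).resolve_left hh)
  have hle : LinearMap.range P.mulVecLin ⊔ LinearMap.range A.mulVecLin ≤
      LinearMap.ker B.mulVecLin := by
    refine sup_le ?_ ?_ <;> rintro _ ⟨v, rfl⟩ <;>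
      simp only [LinearMap.mem_ker, mulVecLin_apply, mulVec_mulVec, hBP, hBA, zero_mulVec]
  have h1 := Submodule.finrank_sup_add_finrank_inf_eq (LinearMap.range P.mulVecLin)
    (LinearMap.range A.mulVecLin)
  rw [hdis.eq_bot, finrank_bot, add_zero] at h1
  have h2 := Submodule.finrank_mono hle
  have h3 := LinearMap.finrank_range_add_finrank_ker B.mulVecLin
  rw [Module.finrank_fintype_fun_eq_card] at h3
  unfold Matrix.rank
  omega

/-- A complex of matrices of linear forms splits near the points at which both matrices have their
generic rank. Given homogeneous generalized inverses `A'` and `B'` of `A` and `B` with the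
denominator `h`, the matrix `P = (h - A A') (h - B' B)` is `h²` times a projector onto a complement
of `Im A` in `Ker B`; as `P` also has its generic rank `r` at the given point, it factors through a
free module of rank `r` near this point. -/
theorem exists_complexSplitting [Fintype l] [Fintype m] [Fintype n] [DecidableEq l]
    [DecidableEq m] [DecidableEq n] (A : Matrix m n (S k s)) (B : Matrix l m (S k s))
    (hA : MatDeg 1 A) (hB : MatDeg 1 B) (hBA : B * A = 0) {rA rB r : ℕ}
    (hr : rA + rB + r = Fintype.card m)
    (hrA : (A.map (algebraMap (S k s) (FractionRing (S k s)))).rank = rA)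
    (hrB : (B.map (algebraMap (S k s) (FractionRing (S k s)))).rank = rB)
    (φ : S k s →+* L) (hφA : (A.map φ).rank = rA) (hφB : (B.map φ).rank = rB) :
    ∃ D : ComplexSplitting A B r, φ D.h ≠ 0 := by
  obtain ⟨IA, JA, hA0, hAd, hAA⟩ := exists_homogeneous_inverse A hA hrA.le φ hφA.ge
  obtain ⟨IB, JB, hB0, hBd, hBB⟩ := exists_homogeneous_inverse B hB hrB.le φ hφB.ge
  set a := (A.submatrix IA JA).det
  set b := (B.submatrix IB JB).det
  -- the two generalized inverses are given the common denominator `a b`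
  obtain ⟨A', hA', hA'd⟩ : ∃ A' : Matrix n m (S k s), A * A' * A = (a * b) • A ∧
      MatDeg (rA + rB - 1) A' := by
    refine ⟨b • ((1 : Matrix n n (S k s)).submatrix _root_.id JA * (A.submatrix IA JA).adjugate *
      (1 : Matrix m m (S k s)).submatrix IA _root_.id), ?_, ?_⟩
    · rw [Matrix.mul_smul, Matrix.smul_mul, mul_comm a, mul_smul, ← hAA, ← Matrix.mul_assoc,
        ← Matrix.mul_assoc, mul_one_submatrix, Matrix.mul_assoc _ _ A, one_submatrix_mul]
    · exact (MatDeg.smul hBd (((MatDeg.one.submatrix _ _).mul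
        (hA.submatrix IA JA).adjugate).mul (MatDeg.one.submatrix _ _))).congr (by ring)
  obtain ⟨B', hB', hB'd⟩ : ∃ B' : Matrix m l (S k s), B * B' * B = (a * b) • B ∧
      MatDeg (rA + rB - 1) B' := by
    refine ⟨a • ((1 : Matrix m m (S k s)).submatrix _root_.id JB * (B.submatrix IB JB).adjugate *
      (1 : Matrix l l (S k s)).submatrix IB _root_.id), ?_, ?_⟩
    · rw [Matrix.mul_smul, Matrix.smul_mul, mul_smul, ← hBB, ← Matrix.mul_assoc,
        ← Matrix.mul_assoc, mul_one_submatrix, Matrix.mul_assoc _ _ B, one_submatrix_mul]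
    · exact (MatDeg.smul hAd (((MatDeg.one.submatrix _ _).mul
        (hB.submatrix IB JB).adjugate).mul (MatDeg.one.submatrix _ _))).congr (by ring)
  have hh0 : φ (a * b) ≠ 0 := by rw [map_mul]; exact mul_ne_zero hA0 hB0
  have hhd : HasDeg (rA + rB) (a * b) := by simpa using hAd.mul hBd
  generalize a * b = h at hA' hB' hh0 hhd
  have hhM : MatDeg (m := m) (n := m) (rA + rB) (h • (1 : Matrix m m (S k s))) :=
    (MatDeg.smul hhd MatDeg.one).congr (by ring)
  set P : Matrix m m (S k s) := (h • 1 - A * A') * (h • 1 - B' * B) with hP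
  have hPd : MatDeg (2 * (rA + rB)) P :=
    ((hhM.sub ((hA.mul hA'd).congr (by ring))).mul
      (hhM.sub ((hB'd.mul hB).congr (by ring)))).congr (by ring)
  have hBP : B * P = 0 := by
    have h1 : B * (h • 1 - A * A') = h • B := by
      rw [Matrix.mul_sub, Matrix.mul_smul, Matrix.mul_one, ← Matrix.mul_assoc, hBA,
        Matrix.zero_mul, sub_zero]
    rw [hP, ← Matrix.mul_assoc, h1, Matrix.smul_mul, Matrix.mul_sub, ← Matrix.mul_assoc, hB',
      Matrix.mul_smul, Matrix.mul_one, sub_self, smul_zero]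
  have hPA : P * A = 0 := by
    rw [hP, Matrix.mul_assoc, Matrix.sub_mul _ _ A, Matrix.mul_assoc B', hBA, Matrix.mul_zero,
      sub_zero, Matrix.smul_mul, Matrix.one_mul, Matrix.mul_smul, Matrix.sub_mul, hA',
      Matrix.smul_mul, Matrix.one_mul, sub_self, smul_zero]
  have hPe : P + A * (h • A') + (h • B' - A * (A' * B')) * B = (h * h) • 1 := by
    rw [hP]
    simp only [Matrix.sub_mul, Matrix.mul_sub, Matrix.smul_mul, Matrix.mul_smul, Matrix.one_mul,
      Matrix.mul_one, Matrix.mul_assoc, mul_smul, smul_sub]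
    abel
  have hPB : P * (B' * B) = 0 := by
    rw [hP, Matrix.mul_assoc, Matrix.sub_mul _ _ (B' * B), Matrix.mul_assoc B',
      ← Matrix.mul_assoc B, hB']
    simp
  have hPP : P * P = (h * h) • P := by
    have h1 := congrArg (P * ·) hPe
    simp only [Matrix.mul_add, Matrix.sub_mul, Matrix.mul_sub, ← Matrix.mul_assoc] at h1
    simp only [hPA, Matrix.zero_mul, Matrix.mul_smul, Matrix.smul_mul, Matrix.mul_one] at h1
    rw [Matrix.mul_assoc P, hPB] at h1
    simpa using h1
  have hhh : φ (h * h) ≠ 0 := by rw [map_mul]; exact mul_ne_zero hh0 hh0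
  -- the rank of `P` at the generic point is at most `r`, and at the given point at least `r`
  have hrP : (P.map (algebraMap (S k s) (FractionRing (S k s)))).rank ≤ r := by
    have hinj := IsFractionRing.injective (S k s) (FractionRing (S k s))
    have h0 : algebraMap (S k s) (FractionRing (S k s)) (h * h) ≠ 0 := fun h1 =>
      hhh (by simpa using congrArg φ (hinj (h1.trans (map_zero _).symm)))
    have := rank_le_card_of_htpy (A.map (algebraMap (S k s) (FractionRing (S k s))))
      (B.map (algebraMap (S k s) (FractionRing (S k s))))
      (P.map (algebraMap (S k s) (FractionRing (S k s)))) h0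
      (by rw [← Matrix.map_mul, hPP, map_smul_ringHom])
      (by rw [← Matrix.map_mul, hPA, Matrix.map_zero _ (map_zero _)])
      (by rw [← Matrix.map_mul, hBP, Matrix.map_zero _ (map_zero _)])
      (by rw [← Matrix.map_mul, hBA, Matrix.map_zero _ (map_zero _)])
    omega
  have hφP : r ≤ (P.map φ).rank := by
    have := card_le_rank_of_htpy (A.map φ) (B.map φ) (P.map φ) ((h • A').map φ)
      ((h • B' - A * (A' * B')).map φ) hhh (by
        rw [← Matrix.map_mul, ← Matrix.map_mul, ← Matrix.map_add _ (map_add φ),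
          ← Matrix.map_add _ (map_add φ), hPe, map_smul_ringHom,
          Matrix.map_one _ (map_zero _) (map_one _)])
    omega
  obtain ⟨I, J, hP0, hδd, hPPP⟩ := exists_homogeneous_inverse P hPd hrP φ hφP
  set δ := (P.submatrix I J).det
  have hIJ : P.submatrix I _root_.id * P.submatrix _root_.id J = (h * h) • P.submatrix I J := by
    have := congrArg (fun M => M.submatrix I J) hPP
    exact this
  refine ⟨⟨δ * (h * h), 2 * (rA + rB) * (r + 1), HasDeg.mem ?_, P.submatrix _root_.id J,
    (P.submatrix I J).adjugate * P.submatrix I _root_.id, δ • (h • A'),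
    δ • (h • B' - A * (A' * B')), 2 * (rA + rB), hPd.submatrix _ _, ?_, ?_, ?_, ?_, ?_, ?_, ?_⟩, ?_⟩
  · have := hδd.mul (hhd.mul hhd)
    convert this using 1
    push_cast; ring
  · refine ((hPd.submatrix I J).adjugate.mul (hPd.submatrix _ _)).congr ?_
    push_cast; ring
  · refine (MatDeg.smul hδd (MatDeg.smul hhd hA'd)).congr ?_
    push_cast; ring
  · refine (MatDeg.smul hδd ((MatDeg.smul hhd hB'd).sub
      ((hA.mul (hA'd.mul hB'd)).congr ?_))).congr ?_
    · ring
    · push_cast; ring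
  · have := congrArg (fun M => M.submatrix _root_.id J) hBP
    exact this
  · rw [Matrix.mul_assoc]
    have : P.submatrix I _root_.id * A = 0 := congrArg (fun M => M.submatrix I _root_.id) hPA
    rw [this, Matrix.mul_zero]
  · rw [Matrix.mul_assoc, hIJ, Matrix.mul_smul, adjugate_mul, smul_smul, mul_comm]
  · rw [← Matrix.mul_assoc, hPPP, Matrix.mul_smul, Matrix.smul_mul, ← smul_add, ← smul_add, hPe,
      smul_smul]
  · rw [map_mul, map_mul]
    exact mul_ne_zero hP0 (mul_ne_zero hh0 hh0)

end Splitting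

/-! ### Ranks of specializations -/

section GenericRank
open Matrix
variable {k : Type u} [Field k] {s : ℕ} {l l' m n : Type*} {L : Type*} [Field L]

/-- The evaluation of polynomials at `α ∈ K^s`, as a ring homomorphism. -/
abbrev evalHom {K : Type u} [Field K] [Algebra k K] (α : Fin s → K) : S k s →+* K :=
  (MvPolynomial.aeval α : S k s →ₐ[k] K).toRingHom

/-- The rank of a matrix over a domain, i.e. over its field of fractions. -/
abbrev genericRank [Fintype n] (A : Matrix m n (S k s)) : ℕ :=
  (A.map (algebraMap (S k s) (FractionRing (S k s)))).rank

theorem det_submatrix_map {R R' : Type*} [CommRing R] [CommRing R'] (φ : R →+* R')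
    (A : Matrix m n R) {r : ℕ} (I : Fin r → m) (J : Fin r → n) :
    ((A.map φ).submatrix I J).det = φ (A.submatrix I J).det := by
  rw [RingHom.map_det]; rfl

theorem rank_map_le_genericRank [Fintype m] [Fintype n] (A : Matrix m n (S k s))
    (φ : S k s →+* L) : (A.map φ).rank ≤ genericRank A := by
  obtain ⟨I, J, h⟩ := exists_minor_ne_zero (A.map φ) le_rfl
  rw [det_submatrix_map] at h
  refine le_rank_of_minor_ne_zero _ I J ?_
  rw [det_submatrix_map]
  exact fun h0 => h (by
    rw [(IsFractionRing.injective (S k s) (FractionRing (S k s))) (h0.trans (map_zero _).symm),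
      map_zero])

theorem exists_minor_genericRank [Fintype m] [Fintype n] (A : Matrix m n (S k s)) :
    ∃ (I : Fin (genericRank A) → m) (J : Fin (genericRank A) → n), (A.submatrix I J).det ≠ 0 := by
  obtain ⟨I, J, h⟩ := exists_minor_ne_zero
    (A.map (algebraMap (S k s) (FractionRing (S k s)))) le_rfl
  rw [det_submatrix_map] at h
  exact ⟨I, J, fun h0 => h (by rw [h0, map_zero])⟩

/-- If the sum of the ranks of `A` and `B` is constant on `k^s ∖ {0}`, then so is each of the two
ranks, because both are lower semicontinuous; the constant values are the generic ones. -/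
theorem rank_eval_eq_genericRank [Infinite k] [Fintype m] [Fintype n] [Fintype l] [Fintype l']
    (A : Matrix m n (S k s)) (B : Matrix l l' (S k s)) {a : ℕ}
    (h : ∀ α : Fin s → k, α ≠ 0 → (A.map (evalHom α)).rank + (B.map (evalHom α)).rank = a)
    (α : Fin s → k) (hα : α ≠ 0) : (A.map (evalHom α)).rank = genericRank A := by
  obtain ⟨I, J, hA⟩ := exists_minor_genericRank A
  obtain ⟨I', J', hB⟩ := exists_minor_genericRank B
  obtain ⟨i, hi⟩ := Function.ne_iff.mp hα
  -- a point at which both ranks take their generic values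
  obtain ⟨β, hβ⟩ : ∃ β : Fin s → k, MvPolynomial.eval β ((A.submatrix I J).det *
      (B.submatrix I' J').det * MvPolynomial.X i) ≠ 0 := by
    by_contra! h0
    refine mul_ne_zero (mul_ne_zero hA hB) (MvPolynomial.X_ne_zero i) (MvPolynomial.funext ?_)
    simpa using h0
  rw [map_mul, map_mul, MvPolynomial.eval_X] at hβ
  have hβA : genericRank A ≤ (A.map (evalHom β)).rank :=
    le_rank_of_minor_ne_zero _ I J (by
      rw [det_submatrix_map]; exact left_ne_zero_of_mul (left_ne_zero_of_mul hβ))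
  have hβB : genericRank B ≤ (B.map (evalHom β)).rank :=
    le_rank_of_minor_ne_zero _ I' J' (by
      rw [det_submatrix_map]; exact right_ne_zero_of_mul (left_ne_zero_of_mul hβ))
  have h1 := h β fun h0 => right_ne_zero_of_mul hβ (by rw [h0]; rfl)
  have h2 := h α hα
  have := rank_map_le_genericRank A (evalHom α)
  have := rank_map_le_genericRank B (evalHom α)
  omega

/-- A matrix which has the generic rank at all points of `k^s ∖ {0}` has the generic rank
at every point of the affine space other than the origin: by the Nullstellensatz, the prime ideal
`Ker φ` is determined by the closed points at which it vanishes. -/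
theorem rank_map_eq_genericRank [IsAlgClosed k] [Fintype m] [Fintype n] (A : Matrix m n (S k s))
    (h : ∀ α : Fin s → k, α ≠ 0 → (A.map (evalHom α)).rank = genericRank A)
    (φ : S k s →+* L) (i : Fin s) (hi : φ (MvPolynomial.X i) ≠ 0) :
    (A.map φ).rank = genericRank A := by
  refine le_antisymm (rank_map_le_genericRank A φ) ?_
  by_contra hlt
  have hprime : (RingHom.ker φ).IsPrime := RingHom.ker_isPrime φ
  refine hi ?_
  rw [← RingHom.mem_ker, ← MvPolynomial.IsPrime.vanishingIdeal_zeroLocus (K := k) (RingHom.ker φ)]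
  intro α hα
  by_contra h0
  have hα0 : α ≠ 0 := fun h1 => h0 (by rw [h1, MvPolynomial.aeval_X]; rfl)
  obtain ⟨I, J, hIJ⟩ := exists_minor_ne_zero (A.map (evalHom α)) (h α hα0).ge
  rw [det_submatrix_map] at hIJ
  refine hIJ (hα _ ?_)
  by_contra h1
  exact hlt (le_rank_of_minor_ne_zero _ I J (by rw [det_submatrix_map]; exact h1))

end GenericRank

section KoszulMatrix
variable {k : Type u} [Field k] {s : ℕ} {W W' W'' : Type u} [AddCommGroup W] [Module k W]
  [AddCommGroup W'] [Module k W'] [AddCommGroup W''] [Module k W'']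
  {m n l : Type*} [Fintype n] [DecidableEq n] [Fintype m] [Fintype l]
  (b : Module.Basis n k W) (b' : Module.Basis m k W')

/-- The matrix of a linear map between free modules `S ⊗ W`. -/
def coordMatrix (g : S k s ⊗[k] W →ₗ[S k s] S k s ⊗[k] W') : Matrix m n (S k s) :=
  LinearMap.toMatrix (b.baseChange (S k s)) (b'.baseChange (S k s)) g

/-- The linear map between free modules `S ⊗ W` with the given matrix. -/
def ofMatrix (A : Matrix m n (S k s)) : S k s ⊗[k] W →ₗ[S k s] S k s ⊗[k] W' :=
  Matrix.toLin (b.baseChange (S k s)) (b'.baseChange (S k s)) A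

theorem ofMatrix_tmul (A : Matrix m n (S k s)) (f : S k s) (j : n) :
    ofMatrix b b' A (f ⊗ₜ[k] b j) = ∑ i, (A i j * f) ⊗ₜ[k] b' i := by
  have : f ⊗ₜ[k] b j = f • (b.baseChange (S k s)) j := by
    rw [Module.Basis.baseChange_apply, smul_tmul', smul_eq_mul, mul_one]
  rw [this, map_smul, ofMatrix, Matrix.toLin_self, Finset.smul_sum]
  refine Finset.sum_congr rfl fun i _ => ?_
  rw [Module.Basis.baseChange_apply, smul_tmul', smul_tmul', smul_eq_mul, smul_eq_mul, mul_one,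
    mul_comm]

theorem ofMatrix_coordMatrix (g : S k s ⊗[k] W →ₗ[S k s] S k s ⊗[k] W') :
    ofMatrix b b' (coordMatrix b b' g) = g := Matrix.toLin_toMatrix _ _ g

theorem ofMatrix_mul [DecidableEq m] (b'' : Module.Basis l k W'') (A : Matrix m n (S k s))
    (B : Matrix l m (S k s)) :
    ofMatrix b b'' (B * A) = ofMatrix b' b'' B ∘ₗ ofMatrix b b' A :=
  Matrix.toLin_mul _ _ _ B A

theorem ofMatrix_one : ofMatrix b b (1 : Matrix n n (S k s)) = LinearMap.id := Matrix.toLin_one _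

theorem coordMatrix_comp [DecidableEq m] (b'' : Module.Basis l k W'')
    (g : S k s ⊗[k] W →ₗ[S k s] S k s ⊗[k] W')
    (g' : S k s ⊗[k] W' →ₗ[S k s] S k s ⊗[k] W'') :
    coordMatrix b b'' (g' ∘ₗ g) = coordMatrix b' b'' g' * coordMatrix b b' g :=
  LinearMap.toMatrix_comp _ _ _ _ _

theorem toMatrix_basis_baseChange (K : Type u) [CommRing K] [Algebra k K] (x : W →ₗ[k] W') :
    LinearMap.toMatrix (b.baseChange K) (b'.baseChange K) (x.baseChange K) =
      (LinearMap.toMatrix b b' x).map (algebraMap k K) := by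
  ext i j
  rw [LinearMap.toMatrix_apply, Module.Basis.baseChange_apply, LinearMap.baseChange_tmul,
    Module.Basis.baseChange_repr_tmul, Matrix.map_apply, LinearMap.toMatrix_apply,
    Algebra.algebraMap_eq_smul_one]

theorem coordMatrix_koszulLin (x : Fin s → (W →ₗ[k] W')) :
    coordMatrix b b' (koszulLin x) = ∑ i, (MvPolynomial.X i : S k s) •
      (LinearMap.toMatrix b b' (x i)).map (algebraMap k (S k s)) := by
  unfold coordMatrix koszulLin
  rw [map_sum]
  refine Finset.sum_congr rfl fun i _ => ?_
  rw [map_smul, toMatrix_basis_baseChange]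

theorem coordMatrix_koszulLin_deg (x : Fin s → (W →ₗ[k] W')) :
    MatDeg 1 (coordMatrix b b' (koszulLin (k := k) (s := s) x)) := by
  intro i j
  rw [coordMatrix_koszulLin, Matrix.sum_apply]
  refine HasDeg.sum fun t _ => ?_
  have h := (HasDeg.of_mem (MvPolynomial.isHomogeneous_X k t)).mul
    (HasDeg.of_mem (MvPolynomial.isHomogeneous_C (Fin s) (LinearMap.toMatrix b b' (x t) i j)))
  simpa using h

end KoszulMatrix

/-! ### Jordan decompositions -/

section Jordan
variable {k : Type u} [Field k] {s : ℕ} {M : SuperMod k s} {α : Fin s → k} {a_ev a_od a₂ : ℕ}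

theorem zmod_two_cases (p : ZMod 2) : p = 0 ∨ p = 1 := by revert p; decide

theorem zmod_two_eq_add_one_iff (p q : ZMod 2) : p = q + 1 ↔ ¬ p = q := by revert p q; decide

theorem xElem_eq_sum (M : SuperMod k s) (α : Fin s → k) {p r : ZMod 2} (h : p + 1 = r) :
    M.xElem α h = ∑ i, α i • M.xPart i h := by
  refine LinearMap.ext fun m => Subtype.ext ?_
  have h1 : (xElt α : V k s) = ∑ i, α i • xElt (Pi.single i 1) := by
    conv_lhs => rw [pi_eq_sum_univ' α]
    unfold xElt
    rw [map_sum]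
    exact Finset.sum_congr rfl fun i _ => by rw [map_smul]
  rw [LinearMap.sum_apply, AddSubmonoidClass.coe_finsetSum]
  change xElt α • m.1 = ∑ i, α i • (xElt (Pi.single i 1) : V k s) • m.1
  rw [h1, Finset.sum_smul]
  exact Finset.sum_congr rfl fun i _ => smul_assoc _ _ _

theorem xEnd_xEnd (M : SuperMod k s) (α : Fin s → k) (m : M.carrier) :
    M.xEnd α (M.xEnd α m) = 0 := by
  change xElt α • xElt α • m = 0
  rw [smul_smul, xElt_mul_self, zero_smul]

namespace SuperMod.JordanDecomposition

variable (D : M.JordanDecomposition α a_ev a_od a₂)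

/-- The parity of the vectors of the homogeneous basis. -/
def deg : (Fin a_ev ⊕ Fin a_od) ⊕ (Fin a₂ ⊕ Fin a₂) → ZMod 2
  | .inl (.inl _) => 0
  | .inl (.inr _) => 1
  | .inr (.inl i) => D.parity i
  | .inr (.inr i) => D.parity i + 1

theorem xEnd_gen (i : Fin a₂) :
    M.xEnd α (D.basis (.inr (.inl i))) = D.basis (.inr (.inr i)) := D.gen_smul i

theorem xEnd_gen' (i : Fin a₂) : M.xEnd α (D.basis (.inr (.inr i))) = 0 := by
  rw [← D.xEnd_gen, xEnd_xEnd]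

theorem basis_mem : ∀ i, D.basis i ∈ M.part (D.deg i)
  | .inl (.inl i) => D.even_mem i
  | .inl (.inr i) => D.odd_mem i
  | .inr (.inl i) => D.gen_mem i
  | .inr (.inr i) => by
    rw [← D.gen_smul, deg, add_comm]
    exact M.smul_mem (xElt_mem α) (D.gen_mem i)

/-- The vectors of parity `q` of the homogeneous basis. -/
def partFamily (q : ZMod 2) (i : {i // D.deg i = q}) : M.part q :=
  ⟨D.basis i.1, by have := D.basis_mem i.1; rwa [i.2] at this⟩

theorem partFamily_linearIndependent (q : ZMod 2) : LinearIndependent k (D.partFamily q) :=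
  LinearIndependent.of_comp (M.part q).subtype
    (D.basis.linearIndependent.comp Subtype.val Subtype.val_injective)

theorem card_deg_zero : Fintype.card {i // D.deg i = 0} = a_ev + a₂ := by
  rw [Fintype.card_subtype, Finset.card_filter, Fintype.sum_sum_type, Fintype.sum_sum_type,
    Fintype.sum_sum_type]
  have h : ∀ p : ZMod 2, (if p = 0 then 1 else 0) + (if p + 1 = 0 then 1 else 0) = 1 := by decide
  change (∑ _ : Fin a_ev, if (0 : ZMod 2) = 0 then 1 else 0) +
    (∑ _ : Fin a_od, if (1 : ZMod 2) = 0 then 1 else 0) +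
    ((∑ i, if D.parity i = 0 then 1 else 0) + ∑ i, if D.parity i + 1 = 0 then 1 else 0) = _
  rw [← Finset.sum_add_distrib]
  simp only [h]
  simp

theorem card_deg_one : Fintype.card {i // D.deg i = 1} = a_od + a₂ := by
  rw [Fintype.card_subtype, Finset.card_filter, Fintype.sum_sum_type, Fintype.sum_sum_type,
    Fintype.sum_sum_type]
  have h : ∀ p : ZMod 2, (if p = 1 then 1 else 0) + (if p + 1 = 1 then 1 else 0) = 1 := by decide
  change (∑ _ : Fin a_ev, if (0 : ZMod 2) = 1 then 1 else 0) +
    (∑ _ : Fin a_od, if (1 : ZMod 2) = 1 then 1 else 0) +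
    ((∑ i, if D.parity i = 1 then 1 else 0) + ∑ i, if D.parity i + 1 = 1 then 1 else 0) = _
  rw [← Finset.sum_add_distrib]
  simp only [h]
  simp

theorem finrank_part_add (M : SuperMod k s) :
    Module.finrank k (M.part 0) + Module.finrank k (M.part 1) = Module.finrank k M.carrier := by
  have h := (LinearEquiv.ofBijective (DirectSum.coeLinearMap M.part) M.isInternal).finrank_eq
  rw [← h, Module.finrank_directSum]
  exact (Fin.sum_univ_two (fun q : Fin 2 => Module.finrank k (M.part q))).symm

theorem finrank_part (D : M.JordanDecomposition α a_ev a_od a₂) :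
    Module.finrank k (M.part 0) = a_ev + a₂ ∧ Module.finrank k (M.part 1) = a_od + a₂ := by
  have h0 := (D.partFamily_linearIndependent 0).fintype_card_le_finrank
  have h1 := (D.partFamily_linearIndependent 1).fintype_card_le_finrank
  have h2 := finrank_part_add M
  rw [card_deg_zero] at h0
  rw [card_deg_one] at h1
  rw [Module.finrank_eq_card_basis D.basis] at h2
  simp only [Fintype.card_sum, Fintype.card_fin] at h2
  omega

theorem card_deg (q : ZMod 2) : Fintype.card {i // D.deg i = q} = Module.finrank k (M.part q) := by
  obtain rfl | rfl := zmod_two_cases q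
  · rw [card_deg_zero, D.finrank_part.1]
  · rw [card_deg_one, D.finrank_part.2]

theorem span_partFamily (q : ZMod 2) : Submodule.span k (Set.range (D.partFamily q)) = ⊤ :=
  (D.partFamily_linearIndependent q).span_eq_top_of_card_eq_finrank' (D.card_deg q)

/-- The rank of `x_α` on the part of parity `q` is the number of generators of parity `q`. -/
theorem finrank_range_xElem (D : M.JordanDecomposition α a_ev a_od a₂) {q r : ZMod 2}
    (h : q + 1 = r) :
    Module.finrank k (LinearMap.range (M.xElem α h)) =
      Fintype.card {i // D.parity i = q} := by
  have hmem (i : {i // D.parity i = q}) : D.deg (.inr (.inr i.1)) = r := by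
    rw [deg, i.2, h]
  have hrange : LinearMap.range (M.xElem α h) = Submodule.span k (Set.range
      fun i : {i // D.parity i = q} => D.partFamily r ⟨.inr (.inr i.1), hmem i⟩) := by
    rw [LinearMap.range_eq_map, ← D.span_partFamily q, Submodule.map_span]
    refine le_antisymm (Submodule.span_le.mpr ?_) (Submodule.span_le.mpr ?_)
    · rintro _ ⟨_, ⟨⟨i, hi⟩, rfl⟩, rfl⟩
      obtain i | i | i := i
      · have h0 : M.xElem α h (D.partFamily q ⟨.inl i, hi⟩) = 0 := Subtype.ext (D.trivial_smul i)
        rw [h0]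
        exact zero_mem _
      · exact Submodule.subset_span ⟨⟨i, hi⟩, Subtype.ext (D.gen_smul i).symm⟩
      · have h0 : M.xElem α h (D.partFamily q ⟨.inr (.inr i), hi⟩) = 0 :=
          Subtype.ext (D.xEnd_gen' i)
        rw [h0]
        exact zero_mem _
    · rintro _ ⟨i, rfl⟩
      exact Submodule.subset_span ⟨_, ⟨⟨.inr (.inl i.1), i.2⟩, rfl⟩, Subtype.ext (D.gen_smul i.1)⟩
  rw [hrange]
  refine finrank_span_eq_card ((D.partFamily_linearIndependent r).comp _ fun i j hij => ?_)
  simpa [Subtype.ext_iff] using hij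

/-- The ranks of `x_α` on the two parts of `M` may depend on `α`, as far as the decomposition is
concerned, but their sum is `a₂`. -/
theorem finrank_range_xElem_add (D : M.JordanDecomposition α a_ev a_od a₂)
    {q r q' r' : ZMod 2} (h : q + 1 = r) (h' : q' + 1 = r') (hq : q + 1 = q') :
    Module.finrank k (LinearMap.range (M.xElem α h)) +
      Module.finrank k (LinearMap.range (M.xElem α h')) = a₂ := by
  rw [D.finrank_range_xElem, D.finrank_range_xElem, Fintype.card_subtype, Fintype.card_subtype,
    Finset.card_filter, Finset.card_filter, ← Finset.sum_add_distrib]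
  subst hq
  have h (p : ZMod 2) [Decidable (p = q)] [Decidable (p = q + 1)] :
      (if p = q then 1 else 0) + (if p = q + 1 then 1 else 0) = 1 := by
    simp only [zmod_two_eq_add_one_iff]
    split_ifs <;> rfl
  simp only [h]
  simp

/-- The socle of `P^{a₂}` consists of its vectors annihilated by `x_α`: it has the basis of
the `x_α p`. -/
theorem socle_eq : M.socle α D.projectivePart =
    Submodule.span k (Set.range fun i => D.basis (.inr (.inr i))) := by
  refine le_antisymm (sSup_le ?_) (Submodule.span_le.mpr ?_)
  · rintro W ⟨hWP, hW0, hWi, hWs⟩ w hw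
    -- a simple submodule is annihilated by `x_α`
    have hker : W ⊓ LinearMap.ker (M.xEnd α) = W := by
      refine (hWs _ (fun v hv => ?_) inf_le_left).resolve_left fun h => ?_
      · have h0 : M.xEnd α v = 0 := hv.2
        rw [Submodule.mem_comap, h0]
        exact zero_mem _
      · obtain ⟨v, hv, hv0⟩ := (Submodule.ne_bot_iff _).mp hW0
        have h1 : M.xEnd α v ∈ W ⊓ LinearMap.ker (M.xEnd α) := ⟨hWi hv, xEnd_xEnd M α v⟩
        rw [h, Submodule.mem_bot] at h1
        have h2 : v ∈ W ⊓ LinearMap.ker (M.xEnd α) := ⟨hv, h1⟩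
        rw [h, Submodule.mem_bot] at h2
        exact hv0 h2
    have hx : M.xEnd α w = 0 := (hker.ge hw).2
    obtain ⟨c, hc⟩ := (Submodule.mem_span_range_iff_exists_fun k).mp (hWP hw)
    rw [Fintype.sum_sum_type] at hc
    have hc0 : ∀ i, c (.inl i) = 0 := by
      rw [← hc, map_add, map_sum, map_sum] at hx
      simp only [map_smul, D.xEnd_gen, D.xEnd_gen', smul_zero, Finset.sum_const_zero,
        add_zero] at hx
      exact Fintype.linearIndependent_iff.mp (D.basis.linearIndependent.comp
        (fun i => .inr (.inr i)) (fun i j hij => by simpa using hij)) _ hx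
    rw [← hc]
    simp only [hc0, zero_smul, Finset.sum_const_zero, zero_add]
    exact sum_mem fun i _ => Submodule.smul_mem _ _ (Submodule.subset_span ⟨i, rfl⟩)
  · rintro _ ⟨i, rfl⟩
    refine (le_sSup (a := Submodule.span k {D.basis (.inr (.inr i))})
      ⟨?_, ?_, ?_, ?_⟩ : _ ≤ M.socle α D.projectivePart) (Submodule.mem_span_singleton_self _)
    · rw [Submodule.span_singleton_le_iff_mem]
      exact Submodule.subset_span ⟨.inr i, rfl⟩
    · rw [Ne, Submodule.span_singleton_eq_bot]
      exact D.basis.ne_zero _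
    · intro v hv
      obtain ⟨c, rfl⟩ := Submodule.mem_span_singleton.mp hv
      rw [Submodule.mem_comap, map_smul, D.xEnd_gen', smul_zero]
      exact zero_mem _
    · intro W' _ hW'
      exact (nonzero_span_atom _ (D.basis.ne_zero _)).le_iff.mp hW'

theorem finrank_socle : Module.finrank k (M.socle α D.projectivePart) = a₂ := by
  rw [D.socle_eq]
  exact (finrank_span_eq_card (D.basis.linearIndependent.comp
    (fun i => .inr (.inr i)) (fun i j hij => by simpa using hij))).trans (Fintype.card_fin _)

end SuperMod.JordanDecomposition
end Jordan

/-! ### The matrix of `θ_M` -/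

section ThetaMatrix
variable {k : Type u} [Field k] {s : ℕ} (M : SuperMod k s)

/-- A basis of the part of parity `q` of `M`. -/
abbrev partBasis (q : ZMod 2) : Module.Basis (Fin (Module.finrank k (M.part q))) k (M.part q) :=
  Module.finBasis k (M.part q)

/-- The map `θ_M` on graded modules, from the part of parity `p` to that of parity `r = p + 1`. -/
abbrev thetaLin {p r : ZMod 2} (h : p + 1 = r) :
    S k s ⊗[k] M.part p →ₗ[S k s] S k s ⊗[k] M.part r :=
  koszulLin fun i => M.xPart i h

/-- The matrix of `θ_M`, whose entries are linear forms. -/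
def thetaMatrix {p r : ZMod 2} (h : p + 1 = r) :
    Matrix (Fin (Module.finrank k (M.part r))) (Fin (Module.finrank k (M.part p))) (S k s) :=
  coordMatrix (partBasis M p) (partBasis M r) (thetaLin M h)

theorem thetaMatrix_deg {p r : ZMod 2} (h : p + 1 = r) : MatDeg 1 (thetaMatrix M h) :=
  coordMatrix_koszulLin_deg _ _ _

theorem thetaLin_comp {p q r : ZMod 2} (h : p + 1 = q) (h' : q + 1 = r) :
    thetaLin M h' ∘ₗ thetaLin M h = 0 := by
  refine koszulLin_ext fun f w => ?_
  simp only [LinearMap.coe_comp, Function.comp_apply, LinearMap.zero_apply, koszulLin_tmul,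
    map_sum]
  rw [← Finset.sum_product']
  refine Finset.sum_involution (fun a _ => a.swap) (fun a _ => ?_) (fun a _ h0 h1 => h0 ?_)
    (fun a _ => by simp) (fun a _ => by simp)
  · rw [mul_left_comm, Prod.fst_swap, Prod.snd_swap, ← tmul_add, M.xPart_add, tmul_zero]
  · have h2 : a.1 = a.2 := congrArg Prod.snd h1
    rw [h2, M.xPart_self, tmul_zero]

theorem thetaMatrix_mul {p q r : ZMod 2} (h : p + 1 = q) (h' : q + 1 = r) :
    thetaMatrix M h' * thetaMatrix M h = 0 := by
  rw [thetaMatrix, thetaMatrix, ← coordMatrix_comp, thetaLin_comp, coordMatrix, map_zero]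

theorem rank_thetaMatrix_eval_self (α : Fin s → k) {p r : ZMod 2} (h : p + 1 = r) :
    ((thetaMatrix M h).map (evalHom α)).rank =
      Module.finrank k (LinearMap.range (M.xElem α h)) := by
  have h1 : (thetaMatrix M h).map (evalHom α) =
      LinearMap.toMatrix (partBasis M p) (partBasis M r) (M.xElem α h) := by
    rw [thetaMatrix, coordMatrix_koszulLin, xElem_eq_sum, map_sum]
    ext i j
    simp [Matrix.sum_apply]
  rw [h1, Matrix.rank_eq_finrank_range_toLin _ (partBasis M r) (partBasis M p),
    Matrix.toLin_toMatrix]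

variable {M} {a_ev a_od a₂ : ℕ} (hM : M.HasConstantJordanType a_ev a_od a₂)
include hM

theorem SuperMod.HasConstantJordanType.rank_add {p r p' r' : ZMod 2} (h : p + 1 = r)
    (h' : p' + 1 = r') (hp : p + 1 = p') (α : Fin s → k) (hα : α ≠ 0) :
    ((thetaMatrix M h).map (evalHom α)).rank + ((thetaMatrix M h').map (evalHom α)).rank = a₂ := by
  obtain ⟨D⟩ := hM α hα
  rw [rank_thetaMatrix_eval_self, rank_thetaMatrix_eval_self]
  exact D.finrank_range_xElem_add h h' hp

variable [IsAlgClosed k] {L : Type*} [Field L] (φ : S k s →+* L) (i : Fin s)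
  (hi : φ (MvPolynomial.X i) ≠ 0)

/-- The even and the odd part of `θ_M` have generic ranks which sum to `a₂`. -/
theorem SuperMod.HasConstantJordanType.genericRank_add (i : Fin s) {p r p' r' : ZMod 2}
    (h : p + 1 = r) (h' : p' + 1 = r') (hp : p + 1 = p') :
    genericRank (thetaMatrix M h) + genericRank (thetaMatrix M h') = a₂ := by
  have hp' : p' + 1 = p := by rw [← hp, add_one_add_one]
  have hα : (Pi.single i 1 : Fin s → k) ≠ 0 := by simp
  rw [← rank_eval_eq_genericRank _ _ (hM.rank_add h h' hp) _ hα,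
    ← rank_eval_eq_genericRank _ _ (hM.rank_add h' h hp') _ hα]
  exact hM.rank_add h h' hp _ hα

include hi in
/-- The matrix of `θ_M` has its generic rank at all points of projective space. -/
theorem SuperMod.HasConstantJordanType.rank_map {p r : ZMod 2} (h : p + 1 = r) :
    ((thetaMatrix M h).map φ).rank = genericRank (thetaMatrix M h) :=
  rank_map_eq_genericRank _ (rank_eval_eq_genericRank _ _ (hM.rank_add h rfl rfl)) φ i hi

include hi in
theorem SuperMod.HasConstantJordanType.exists_imageSplitting {p r : ZMod 2} (h : p + 1 = r) :
    ∃ D : ImageSplitting (thetaMatrix M h) (genericRank (thetaMatrix M h)), φ D.h ≠ 0 :=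
  SuperBundle.exists_imageSplitting _ (thetaMatrix_deg M h) le_rfl φ (hM.rank_map φ i hi h).ge

include hi in
theorem SuperMod.HasConstantJordanType.exists_complexSplitting {p q r : ZMod 2} (h : p + 1 = q)
    (h' : q + 1 = r) {a : ℕ} (ha : Module.finrank k (M.part q) = a + a₂) :
    ∃ D : ComplexSplitting (thetaMatrix M h) (thetaMatrix M h') a, φ D.h ≠ 0 := by
  refine SuperBundle.exists_complexSplitting _ _ (thetaMatrix_deg M h) (thetaMatrix_deg M h')
    (thetaMatrix_mul M h h') ?_ rfl rfl φ (hM.rank_map φ i hi h) (hM.rank_map φ i hi h')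
  refine (congrArg (· + a) (hM.genericRank_add i h h' h)).trans ?_
  rw [Fintype.card_fin, ha, add_comm a]

omit [IsAlgClosed k] in
theorem SuperMod.HasConstantJordanType.finrank_part (i : Fin s) :
    Module.finrank k (M.part 0) = a_ev + a₂ ∧ Module.finrank k (M.part 1) = a_od + a₂ := by
  obtain ⟨D⟩ := hM (Pi.single i 1) (by simp)
  exact D.finrank_part

end ThetaMatrix

/-! ### Local structure of `ℱ₁` and `ℱ₂` -/

section CoordFrac
variable {k : Type u} [Field k] {s : ℕ} {W W' W'' : Type u} [AddCommGroup W] [Module k W]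
  [AddCommGroup W'] [Module k W'] [AddCommGroup W''] [Module k W'']
  {m n l : Type*} [Fintype n] [DecidableEq n] [Fintype m] [Fintype l]

theorem ofMatrix_mem {b : Module.Basis n k W} {b' : Module.Basis m k W'} {A : Matrix m n (S k s)}
    {e : ℤ} (hA : MatDeg e A) {j j' : ℤ} {d d' : ℕ} (hd : (d' : ℤ) + j' = d + j + e) :
    ∀ w ∈ twistDeg k s W j d, ofMatrix b b' A w ∈ twistDeg k s W' j' d' := by
  refine map_mem_twistDeg ((ofMatrix b b' A).restrictScalars k) fun e' f w he hf => ?_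
  rw [LinearMap.restrictScalars_apply, ← b.sum_repr w, tmul_sum, map_sum]
  refine sum_mem fun t _ => ?_
  rw [tmul_smul, smul_tmul', ofMatrix_tmul]
  refine sum_mem fun i _ => ?_
  obtain h | ⟨a, ha, hm⟩ := hA i t
  · rw [h, zero_mul, zero_tmul]; exact zero_mem _
  · exact tmul_mem_twistDeg (e := a + e') (by push_cast; omega)
      (SetLike.mul_mem_graded hm (Submodule.smul_mem _ _ hf)) _

theorem ofMatrix_smul (b : Module.Basis n k W) (b' : Module.Basis m k W') (c : S k s)
    (A : Matrix m n (S k s)) : ofMatrix b b' (c • A) = c • ofMatrix b b' A :=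
  map_smul (Matrix.toLin _ _) c A

theorem ofMatrix_add (b : Module.Basis n k W) (b' : Module.Basis m k W')
    (A A' : Matrix m n (S k s)) : ofMatrix b b' (A + A') = ofMatrix b b' A + ofMatrix b b' A' :=
  map_add (Matrix.toLin _ _) A A'

theorem ofMatrix_zero (b : Module.Basis n k W) (b' : Module.Basis m k W') :
    ofMatrix b b' (0 : Matrix m n (S k s)) = 0 := map_zero (Matrix.toLin _ _)

/-- The restriction of `W ⊗ 𝒪(j)` to an open subset. -/
abbrev twistOn (U : (ProjSpace k s).Opens) (W : Type u) [AddCommGroup W] [Module k W] (j : ℤ) :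
    U.toScheme.Modules := (Scheme.Modules.restrictFunctor U.ι).obj (twist k s W j)

variable (U : (ProjSpace k s).Opens)

/-- The morphism `A / h : W ⊗ 𝒪(j)|_U ⟶ W' ⊗ 𝒪(j')|_U` given by a matrix `A` of homogeneous
polynomials and a denominator `h` which does not vanish on `U`. -/
def coordFrac (b : Module.Basis n k W) (b' : Module.Basis m k W') {h : S k s} {d : ℕ}
    (hU : NonvanishingOn U h) (hd : h ∈ grading k s d) {A : Matrix m n (S k s)} {e : ℤ}
    (hA : MatDeg e A) {j j' : ℤ} (he : d + j' = j + e) : twistOn U W j ⟶ twistOn U W' j' :=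
  fracMap U h hU d hd (ofMatrix b b' A) fun _ => ofMatrix_mem hA (by push_cast; omega)

variable {U} {b : Module.Basis n k W} {b' : Module.Basis m k W'} {b'' : Module.Basis l k W''}
  {h h' : S k s} {d d' : ℕ}
  (hU : NonvanishingOn U h) (hd : h ∈ grading k s d) (hU' : NonvanishingOn U h')
  (hd' : h' ∈ grading k s d') {A A' : Matrix m n (S k s)} {B : Matrix l m (S k s)}
  {C : Matrix l n (S k s)} {e e' : ℤ}
  (hA : MatDeg e A) (hA' : MatDeg e A') (hB : MatDeg e' B) {j j' j'' : ℤ}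

theorem coordFrac_comp [DecidableEq m] (he : d + j' = j + e) (he' : d' + j'' = j' + e')
    {h'' : S k s} {d'' : ℕ} (hU'' : NonvanishingOn U h'') (hd'' : h'' ∈ grading k s d'')
    {e'' : ℤ} (hC : MatDeg e'' C) (he'' : d'' + j'' = j + e'')
    (hBA : h'' • (B * A) = (h' * h) • C) :
    coordFrac U b b' hU hd hA he ≫ coordFrac U b' b'' hU' hd' hB he' =
      coordFrac U b b'' hU'' hd'' hC he'' := by
  refine (fracMap_comp ..).trans (fracMap_congr ?_)
  rw [← ofMatrix_mul, ← ofMatrix_smul, hBA, ofMatrix_smul]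

theorem coordFrac_add (he : d + j' = j + e) :
    coordFrac U b b' hU hd hA he + coordFrac U b b' hU hd hA' he =
      coordFrac U b b' hU hd (hA.add hA') he := by
  refine (fracMap_add ..).trans (fracMap_congr ?_)
  rw [ofMatrix_add]

theorem coordFrac_eq_zero (he : d + j' = j + e) (h0 : A = 0) :
    coordFrac U b b' hU hd hA he = 0 :=
  fracMap_eq_zero _ _ _ _ _ (by rw [h0, ofMatrix_zero])

theorem coordFrac_smul_one {A : Matrix n n (S k s)} (hA : MatDeg e A) (he : d + j = j + e)
    (h1 : A = h • 1) : coordFrac U b b hU hd hA he = 𝟙 _ :=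
  fracMap_smul_id _ _ _ _ _ (by rw [h1, ofMatrix_smul, ofMatrix_one])

/-- Over `U`, the morphism `θ_M` is given by its matrix of linear forms, with denominator `1`. -/
theorem restrict_theta (M : SuperMod k s) {p r : ZMod 2} (hp : p + 1 = r) (hj : j + 1 = j') :
    (Scheme.Modules.restrictFunctor U.ι).map (theta M hp hj) =
      coordFrac U (partBasis M p) (partBasis M r) (NonvanishingOn.one U)
        (d := 0) SetLike.GradedOne.one_mem (thetaMatrix_deg M hp) (by push_cast; omega) := by
  refine (restrictFunctor_map_projTildeMap U _ _).trans (fracMap_congr ?_)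
  rw [thetaMatrix, ofMatrix_coordMatrix]

end CoordFrac

section LocalStructure
variable {k : Type u} [Field k] {s : ℕ} {M : SuperMod k s} {U : (ProjSpace k s).Opens}

/-- The standard basis of `k^r`. -/
abbrev stdBasis (k : Type u) [Field k] (r : ℕ) :
    Module.Basis (Fin r) k (ULift.{u} (Fin r) → k) :=
  (Pi.basisFun k (ULift.{u} (Fin r))).reindex Equiv.ulift

/-- The homotopy of a splitting, as an identity between morphisms of sheaves. The form `y` is
needed to make the inclusion and the projection of the homology of degree zero. -/
theorem ComplexSplitting.htpy_frac {q : ZMod 2} {a : ℕ}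
    (D : ComplexSplitting (thetaMatrix M (add_one_add_one q)) (thetaMatrix M (p := q) rfl) a)
    (hU : NonvanishingOn U D.h) {y : S k s} (hy : NonvanishingOn U y)
    (hyd : y ∈ grading k s D.dinc) (hprd : MatDeg (D.d : ℤ) (y • D.pr)) :
    coordFrac U (partBasis M q) (stdBasis k a) hU D.h_deg hprd (j := 0) (j' := 0) (by ring) ≫
      coordFrac U (stdBasis k a) (partBasis M q) hy hyd D.inc_deg (j' := 0) (by ring) +
    coordFrac U (partBasis M q) (partBasis M (q + 1)) hU D.h_deg D.σ_deg (j' := -1) (by ring) ≫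
      (Scheme.Modules.restrictFunctor U.ι).map
        (theta M (add_one_add_one q) (j := -1) (j' := 0) rfl) +
    (Scheme.Modules.restrictFunctor U.ι).map (theta M (p := q) rfl (j := 0) (j' := 1) rfl) ≫
      coordFrac U (partBasis M (q + 1)) (partBasis M q) hU D.h_deg D.τ_deg (j' := 0) (by ring) =
    𝟙 (twistOn U (M.part q) 0) := by
  have hid : MatDeg (D.d : ℤ) (D.inc * D.pr) := (D.inc_deg.mul D.pr_deg).congr (by ring)
  have hAσ : MatDeg (D.d : ℤ) (thetaMatrix M (add_one_add_one q) * D.σ) :=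
    ((thetaMatrix_deg M _).mul D.σ_deg).congr (by ring)
  have hτB : MatDeg (D.d : ℤ) (D.τ * thetaMatrix M (p := q) rfl) :=
    (D.τ_deg.mul (thetaMatrix_deg M _)).congr (by ring)
  rw [restrict_theta, restrict_theta,
    coordFrac_comp _ _ _ _ _ _ _ _ hU D.h_deg hid (by ring)
      (by rw [Matrix.mul_smul, smul_smul, mul_comm]),
    coordFrac_comp _ _ _ _ _ _ _ _ hU D.h_deg hAσ (by ring) (by rw [one_mul]),
    coordFrac_comp _ _ _ _ _ _ _ _ hU D.h_deg hτB (by ring) (by rw [mul_one]),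
    coordFrac_add, coordFrac_add]
  exact coordFrac_smul_one _ _ _ _ D.htpy

/-- Over an open set on which `h` has no zeros and on which some linear form `y` has
no zeros, a splitting of the matrices of `θ_M` with denominator `h` contracts the complex
of sheaves. -/
def ComplexSplitting.contraction {q : ZMod 2} {a : ℕ}
    (D : ComplexSplitting (thetaMatrix M (add_one_add_one q)) (thetaMatrix M (p := q) rfl) a)
    (hU : NonvanishingOn U D.h) {y : S k s} (hy : NonvanishingOn U y) (hy1 : y ∈ grading k s 1) :
    Contraction ((thetaComplex M q).map (Scheme.Modules.restrictFunctor U.ι))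
      (twistOn U (ULift.{u} (Fin a) → k) 0) :=
  have hyn : NonvanishingOn U (y ^ D.dinc) := fun x hx => Submonoid.pow_mem _ (hy x hx) _
  have hyd : y ^ D.dinc ∈ grading k s D.dinc := by
    simpa using SetLike.pow_mem_graded D.dinc hy1
  have hone : MatDeg (0 : ℤ) (1 : Matrix (Fin a) (Fin a) (S k s)) := MatDeg.one
  have hprd : MatDeg (D.d : ℤ) (y ^ D.dinc • D.pr) :=
    (MatDeg.smul (HasDeg.of_mem hyd) D.pr_deg).congr (by ring)
  { i := coordFrac U (stdBasis k a) (partBasis M q) hyn hyd D.inc_deg (by ring)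
    p := coordFrac U (partBasis M q) (stdBasis k a) hU D.h_deg hprd (by ring)
    s := coordFrac U (partBasis M q) (partBasis M (q + 1)) hU D.h_deg D.σ_deg (by ring)
    t := coordFrac U (partBasis M (q + 1)) (partBasis M q) hU D.h_deg D.τ_deg (by ring)
    i_g := by
      refine (congrArg (_ ≫ ·) (restrict_theta M rfl rfl)).trans ?_
      refine (coordFrac_comp _ _ _ _ _ _ _ _ hyn hyd (MatDeg.mul (thetaMatrix_deg M rfl)
        D.inc_deg) (by ring) (by rw [one_mul])).trans ?_
      exact coordFrac_eq_zero _ _ _ _ D.B_inc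
    f_p := by
      refine (congrArg (· ≫ _) (restrict_theta M (add_one_add_one q) rfl)).trans ?_
      refine (coordFrac_comp _ _ _ _ _ _ _ _ hU D.h_deg (hprd.mul (thetaMatrix_deg M _))
        (by ring) (by rw [mul_one])).trans ?_
      exact coordFrac_eq_zero _ _ _ _ (by rw [Matrix.smul_mul, D.pr_A, smul_zero])
    i_p := by
      refine (coordFrac_comp _ _ _ _ _ _ _ _ (NonvanishingOn.one U) (d'' := 0)
        SetLike.GradedOne.one_mem hone (by simp) ?_).trans
        (coordFrac_smul_one _ _ _ _ (one_smul _ _).symm)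
      rw [one_smul, Matrix.smul_mul, D.pr_inc, smul_smul, mul_comm]
    htpy := D.htpy_frac hU hyn hyd hprd }

/-- Over an open set on which the denominator has no zeros, the image of `θ_M` is free. -/
def ImageSplitting.imageIso {q : ZMod 2} {r : ℕ}
    (D : ImageSplitting (thetaMatrix M (add_one_add_one q)) r) (hU : NonvanishingOn U D.h) :
    (Scheme.Modules.restrictFunctor U.ι).obj (F₂ M q) ≅ twistOn U (ULift.{u} (Fin r) → k) 0 :=
  let R := Scheme.Modules.restrictFunctor U.ι
  let f := theta M (add_one_add_one q) (j := -1) (j' := 0) rfl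
  let pr := coordFrac U (partBasis M (q + 1)) (stdBasis k r) (NonvanishingOn.one U) (d := 0)
    SetLike.GradedOne.one_mem D.pr_deg (j := -1) (j' := 0) (by simp)
  let inc := coordFrac U (stdBasis k r) (partBasis M q) hU D.h_deg D.inc_deg (j := 0) (j' := 0)
    (by ring)
  have hone : MatDeg (0 : ℤ) (1 : Matrix (Fin r) (Fin r) (S k s)) := MatDeg.one
  have h1 : pr ≫ inc = R.map f := by
    refine (coordFrac_comp _ _ _ _ _ _ _ _ (NonvanishingOn.one U) (d'' := 0)
      SetLike.GradedOne.one_mem (thetaMatrix_deg M _) (by simp) ?_).trans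
        (restrict_theta M _ _).symm
    rw [one_smul, D.inc_pr, mul_one]
  have : IsSplitEpi pr := ⟨⟨⟨coordFrac U (stdBasis k r) (partBasis M (q + 1)) hU D.h_deg
    D.prInv_deg (by ring), by
      refine (coordFrac_comp _ _ _ _ _ _ _ _ (NonvanishingOn.one U) (d'' := 0)
        SetLike.GradedOne.one_mem hone (by simp) ?_).trans
        (coordFrac_smul_one _ _ _ _ (one_smul _ _).symm)
      rw [one_smul, D.pr_prInv, one_mul]⟩⟩⟩
  have : IsSplitMono inc := ⟨⟨⟨coordFrac U (partBasis M q) (stdBasis k r) (NonvanishingOn.one U)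
    (d := 0) SetLike.GradedOne.one_mem D.incInv_deg (by simp), by
      refine (coordFrac_comp _ _ _ _ _ _ _ _ (NonvanishingOn.one U) (d'' := 0)
        SetLike.GradedOne.one_mem hone (by simp) ?_).trans
        (coordFrac_smul_one _ _ _ _ (one_smul _ _).symm)
      rw [one_smul, D.incInv_inc, one_mul]⟩⟩⟩
  have hpr : Epi pr := inferInstance
  have hinc : Mono inc := inferInstance
  @mapImageIso _ _ _ _ _ _ R _ _ _ _ (thetaComplex M q).f _ pr inc hpr hinc h1

variable {a_ev a_od a₂ : ℕ}

/-- At each point of projective space some coordinate does not vanish. -/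
theorem exists_coord_mem_primeCompl (x : ProjectiveSpectrum (grading k s)) :
    ∃ i : Fin s, (MvPolynomial.X i : S k s) ∈ x.asHomogeneousIdeal.toIdeal.primeCompl := by
  by_contra! h
  refine x.not_irrelevant_le fun f hf => ?_
  have hf0 : GradedRing.proj (grading k s) 0 f = 0 := hf
  have hf1 : MvPolynomial.homogeneousComponent 0 f = 0 :=
    (MvPolynomial.decomposition.decompose'_apply f 0).symm.trans hf0
  have hle : Ideal.span (MvPolynomial.X '' (Set.univ : Set (Fin s))) ≤
      x.asHomogeneousIdeal.toIdeal := by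
    rw [Ideal.span_le]
    rintro _ ⟨i, -, rfl⟩
    exact not_not.mp (h i)
  refine hle (MvPolynomial.mem_ideal_span_X_image.mpr fun m hm => ?_)
  by_contra! hm0
  obtain rfl : m = 0 := Finsupp.ext fun i => hm0 i (Set.mem_univ i)
  rw [MvPolynomial.homogeneousComponent_zero, MvPolynomial.C_eq_zero] at hf1
  exact MvPolynomial.mem_support_iff.mp hm hf1

/-- The homomorphism to the fraction field of the homogeneous coordinate ring of the closure of
a point. -/
def toResidueField (x : ProjectiveSpectrum (grading k s)) :
    S k s →+* FractionRing (S k s ⧸ x.asHomogeneousIdeal.toIdeal) :=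
  (algebraMap _ _).comp (Ideal.Quotient.mk x.asHomogeneousIdeal.toIdeal)

theorem toResidueField_ne_zero_iff (x : ProjectiveSpectrum (grading k s)) (f : S k s) :
    toResidueField x f ≠ 0 ↔ f ∈ x.asHomogeneousIdeal.toIdeal.primeCompl := by
  rw [toResidueField, RingHom.comp_apply, Ne, FaithfulSMul.algebraMap_eq_zero_iff,
    Ideal.Quotient.eq_zero_iff_mem]
  rfl

theorem nonvanishingOn_basicOpen (f : S k s) :
    NonvanishingOn (Proj.basicOpen (grading k s) f) f := fun _ hx => hx

/-- Locally on projective space the complex of sheaves `M̃(-1) ⟶ M̃ ⟶ M̃(1)` is homotopy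
equivalent to a free module, and the image of `θ_M` is free. -/
theorem SuperMod.HasConstantJordanType.exists_contraction [IsAlgClosed k]
    (hM : M.HasConstantJordanType a_ev a_od a₂) (x : ProjectiveSpectrum (grading k s)) :
    ∃ U : (ProjSpace k s).Opens, (show ProjSpace k s from x) ∈ U ∧
      Nonempty (Contraction ((thetaComplex M 0).map (Scheme.Modules.restrictFunctor U.ι))
        (twistOn U (ULift.{u} (Fin a_ev) → k) 0)) ∧
      Nonempty (Contraction ((thetaComplex M 1).map (Scheme.Modules.restrictFunctor U.ι))
        (twistOn U (ULift.{u} (Fin a_od) → k) 0)) ∧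
      ∃ r₀ r₁ : ℕ, r₀ + r₁ = a₂ ∧
        Nonempty ((F₂ M 0).restrict U.ι ≅ twistOn U (ULift.{u} (Fin r₀) → k) 0) ∧
        Nonempty ((F₂ M 1).restrict U.ι ≅ twistOn U (ULift.{u} (Fin r₁) → k) 0) := by
  obtain ⟨i, hi⟩ := exists_coord_mem_primeCompl x
  have hi' := (toResidueField_ne_zero_iff x _).mpr hi
  have hdim := hM.finrank_part i
  obtain ⟨D, hD⟩ := hM.exists_complexSplitting _ i hi' (add_one_add_one 0) rfl hdim.1
  obtain ⟨D', hD'⟩ := hM.exists_complexSplitting _ i hi' (add_one_add_one 1) rfl hdim.2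
  obtain ⟨E, hE⟩ := hM.exists_imageSplitting _ i hi' (add_one_add_one 0)
  obtain ⟨E', hE'⟩ := hM.exists_imageSplitting _ i hi' (add_one_add_one 1)
  rw [toResidueField_ne_zero_iff] at hD hD' hE hE'
  have hU : NonvanishingOn (Proj.basicOpen (grading k s)
      (MvPolynomial.X i * D.h * D'.h * E.h * E'.h)) _ := nonvanishingOn_basicOpen _
  have hU' : ∀ f, f ∣ MvPolynomial.X i * D.h * D'.h * E.h * E'.h → NonvanishingOn
      (Proj.basicOpen (grading k s) (MvPolynomial.X i * D.h * D'.h * E.h * E'.h)) f :=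
    fun f hf x hx hfx => hU x hx (Ideal.mem_of_dvd _ hf hfx)
  refine ⟨_, mul_mem (mul_mem (mul_mem (mul_mem hi hD) hD') hE) hE',
    ⟨D.contraction (hU' _ ?_) (hU' (MvPolynomial.X i) ?_) (MvPolynomial.isHomogeneous_X k i)⟩,
    ⟨D'.contraction (hU' _ ?_) (hU' (MvPolynomial.X i) ?_) (MvPolynomial.isHomogeneous_X k i)⟩,
    _, _, hM.genericRank_add i (add_one_add_one 0) (add_one_add_one 1) rfl,
    ⟨E.imageIso (hU' _ ?_)⟩, ⟨E'.imageIso (hU' _ ?_)⟩⟩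
  · exact ⟨MvPolynomial.X i * D'.h * E.h * E'.h, by ring⟩
  · exact ⟨D.h * D'.h * E.h * E'.h, by ring⟩
  · exact ⟨MvPolynomial.X i * D.h * E.h * E'.h, by ring⟩
  · exact ⟨D.h * D'.h * E.h * E'.h, by ring⟩
  · exact ⟨MvPolynomial.X i * D.h * D'.h * E'.h, by ring⟩
  · exact ⟨MvPolynomial.X i * D.h * D'.h * E.h, by ring⟩

/-- A contraction of the restricted complex identifies `ℱ₁(M)` with a free sheaf. -/
def F₁IsoOfContraction {q : ZMod 2} {a : ℕ}
    (c : Contraction ((thetaComplex M q).map (Scheme.Modules.restrictFunctor U.ι))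
        (twistOn U (ULift.{u} (Fin a) → k) 0)) :
    (F₁ M q).restrict U.ι ≅ freeMod U.toScheme a :=
  c.homologyIso ((ShortComplex.LeftHomologyData.canonical (thetaComplex M q)).map
      (Scheme.Modules.restrictFunctor U.ι)) ≪≫ restrictTwistIsoFree U a

theorem SuperMod.HasConstantJordanType.isSuperVectorBundle_F₁ [IsAlgClosed k]
    (hM : M.HasConstantJordanType a_ev a_od a₂) : IsSuperVectorBundle (F₁ M) a_ev a_od := by
  intro x
  obtain ⟨U, hxU, ⟨c⟩, ⟨c'⟩, -⟩ := hM.exists_contraction x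
  exact ⟨U, hxU, ⟨F₁IsoOfContraction c⟩, ⟨F₁IsoOfContraction c'⟩⟩

theorem SuperMod.HasConstantJordanType.isVectorBundle_F₂ [IsAlgClosed k]
    (hM : M.HasConstantJordanType a_ev a_od a₂) : IsVectorBundle (F₂ M 0 ⊞ F₂ M 1) a₂ := by
  intro x
  obtain ⟨U, hxU, -, -, r₀, r₁, rfl, ⟨e₀⟩, ⟨e₁⟩⟩ := hM.exists_contraction x
  have := Limits.preservesBinaryBiproduct_of_preservesBinaryProduct
    (Scheme.Modules.restrictFunctor U.ι) (X := F₂ M 0) (Y := F₂ M 1)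
  exact ⟨U, hxU, ⟨(Scheme.Modules.restrictFunctor U.ι).mapBiprod _ _ ≪≫
    Limits.biprod.mapIso (e₀ ≪≫ restrictTwistIsoFree U r₀) (e₁ ≪≫ restrictTwistIsoFree U r₁) ≪≫
    freeBiprodIso _ r₀ r₁⟩⟩

end LocalStructure

/-! ### Stalks and fibres over an open subset -/

section StalkOn
variable {X : Scheme.{u}} {U : X.Opens} {F G H : X.Modules} {x : X}

/-- The restriction of sheaves of modules to an open subset. -/
abbrev restr (U : X.Opens) : X.Modules ⥤ U.toScheme.Modules := Scheme.Modules.restrictFunctor U.ι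

/-- The map on stalks underlying `stalkMapOn`. -/
def stalkMapOnAb (hx : x ∈ U) (ψ : (restr U).obj F ⟶ (restr U).obj G) :
    F.presheaf.stalk x ⟶ G.presheaf.stalk x :=
  (Scheme.Modules.restrictStalkNatIso U.ι ⟨x, hx⟩).inv.app F ≫
    (TopCat.Presheaf.stalkFunctor Ab.{u} (⟨x, hx⟩ : U.toScheme)).map
      ((Scheme.Modules.toPresheaf U.toScheme).map ψ) ≫
    (Scheme.Modules.restrictStalkNatIso U.ι ⟨x, hx⟩).hom.app G

theorem stalkMapOnAb_germ (hx : x ∈ U) (ψ : (restr U).obj F ⟶ (restr U).obj G)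
    (W : U.toScheme.Opens) (hW : (⟨x, hx⟩ : U.toScheme) ∈ W) (hxW : x ∈ U.ι ''ᵁ W)
    (m : F.presheaf.obj (op (U.ι ''ᵁ W))) :
    stalkMapOnAb hx ψ (F.presheaf.germ (U.ι ''ᵁ W) x hxW m) =
      G.presheaf.germ (U.ι ''ᵁ W) x hxW (ψ.app W m) := by
  have h1 := ConcreteCategory.congr_hom
    (Scheme.Modules.germ_restrictStalkNatIso_inv_app U.ι ⟨x, hx⟩ F hW) m
  have h2 := ConcreteCategory.congr_hom
    (Scheme.Modules.germ_restrictStalkNatIso_hom_app U.ι ⟨x, hx⟩ G hW) (ψ.app W m)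
  have h3 := TopCat.Presheaf.stalkFunctor_map_germ_apply (C := Ab) W (⟨x, hx⟩ : U.toScheme) hW
      ((Scheme.Modules.toPresheaf _).map ψ) m
  refine Eq.trans ?_ h2
  refine congrArg ((Scheme.Modules.restrictStalkNatIso U.ι ⟨x, hx⟩).hom.app G).hom ?_
  refine Eq.trans ?_ h3
  exact congrArg _ h1

theorem exists_germ_image (hx : x ∈ U) (v : stalkMod F x) : ∃ (W : U.toScheme.Opens)
    (_ : (⟨x, hx⟩ : U.toScheme) ∈ W) (hxW : x ∈ U.ι ''ᵁ W) (m : F.presheaf.obj (op (U.ι ''ᵁ W))),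
    F.presheaf.germ (U.ι ''ᵁ W) x hxW m = v := by
  obtain ⟨V, hV, m, rfl⟩ := F.presheaf.exists_germ_eq v
  have hle : U.ι ''ᵁ (U.ι ⁻¹ᵁ V) ≤ V := by
    rintro _ ⟨y, hy, rfl⟩
    exact hy
  have hxW : x ∈ U.ι ''ᵁ (U.ι ⁻¹ᵁ V) := ⟨⟨x, hx⟩, hV, rfl⟩
  exact ⟨U.ι ⁻¹ᵁ V, hV, hxW, F.presheaf.map (homOfLE hle).op m,
    F.presheaf.germ_res_apply (homOfLE hle) x hxW m⟩

theorem exists_germ_image_smul (hx : x ∈ U) (r : X.presheaf.stalk x) (v : stalkMod F x) :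
    ∃ (W : U.toScheme.Opens) (_ : (⟨x, hx⟩ : U.toScheme) ∈ W) (hxW : x ∈ U.ι ''ᵁ W)
      (a : X.presheaf.obj (op (U.ι ''ᵁ W))) (m : F.presheaf.obj (op (U.ι ''ᵁ W))),
      X.presheaf.germ (U.ι ''ᵁ W) x hxW a = r ∧ F.presheaf.germ (U.ι ''ᵁ W) x hxW m = v := by
  obtain ⟨V, hV, m, rfl⟩ := F.presheaf.exists_germ_eq v
  obtain ⟨V', hV', r, rfl⟩ := X.presheaf.exists_germ_eq r
  have hle : U.ι ''ᵁ (U.ι ⁻¹ᵁ (V ⊓ V')) ≤ V := by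
    rintro _ ⟨y, hy, rfl⟩
    exact hy.1
  have hle' : U.ι ''ᵁ (U.ι ⁻¹ᵁ (V ⊓ V')) ≤ V' := by
    rintro _ ⟨y, hy, rfl⟩
    exact hy.2
  have hxW : x ∈ U.ι ''ᵁ (U.ι ⁻¹ᵁ (V ⊓ V')) := ⟨⟨x, hx⟩, ⟨hV, hV'⟩, rfl⟩
  exact ⟨U.ι ⁻¹ᵁ (V ⊓ V'), ⟨hV, hV'⟩, hxW, X.presheaf.map (homOfLE hle').op r,
    F.presheaf.map (homOfLE hle).op m, X.presheaf.germ_res_apply (homOfLE hle') x hxW r,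
    F.presheaf.germ_res_apply (homOfLE hle) x hxW m⟩

/-- A morphism over an open subset is linear over the sections of the structure sheaf of the
ambient scheme. -/
theorem app_smul_image (ψ : (restr U).obj F ⟶ (restr U).obj G) (W : U.toScheme.Opens)
    (a : X.presheaf.obj (op (U.ι ''ᵁ W))) (m : F.presheaf.obj (op (U.ι ''ᵁ W))) :
    (show G.presheaf.obj (op (U.ι ''ᵁ W)) from ψ.app W (a • m)) =
      a • (show G.presheaf.obj (op (U.ι ''ᵁ W)) from ψ.app W m) := by
  have h : ∀ a', a' = (U.ι.appIso W).inv ((U.ι.appIso W).hom a) →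
      (show G.presheaf.obj (op (U.ι ''ᵁ W)) from ψ.app W (a' • m)) =
        a' • (show G.presheaf.obj (op (U.ι ''ᵁ W)) from ψ.app W m) := by
    rintro _ rfl
    exact ψ.app_smul (U := W) ((U.ι.appIso W).hom a) m
  exact h a (ConcreteCategory.congr_hom (U.ι.appIso W).hom_inv_id a).symm

/-- A morphism of sheaves of modules over an open subset induces a linear map on the stalks at
the points of this open subset. -/
def stalkMapOn (hx : x ∈ U) (ψ : (restr U).obj F ⟶ (restr U).obj G) :
    stalkMod F x →ₗ[X.presheaf.stalk x] stalkMod G x where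
  toFun := stalkMapOnAb hx ψ
  map_add' := map_add _
  map_smul' r v := by
    obtain ⟨W, hW, hxW, a, m, rfl, rfl⟩ := exists_germ_image_smul hx r v
    refine (congrArg _ (germ_smul F x (U.ι ''ᵁ W) hxW a m).symm).trans ?_
    refine (stalkMapOnAb_germ hx ψ W hW hxW _).trans ?_
    refine (congrArg _ (app_smul_image ψ W a m)).trans ?_
    refine (germ_smul G x (U.ι ''ᵁ W) hxW a _).trans (congrArg _ ?_)
    exact (stalkMapOnAb_germ hx ψ W hW hxW m).symm

theorem stalkMapOn_germ (hx : x ∈ U) (ψ : (restr U).obj F ⟶ (restr U).obj G)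
    (W : U.toScheme.Opens) (hW : (⟨x, hx⟩ : U.toScheme) ∈ W) (hxW : x ∈ U.ι ''ᵁ W)
    (m : F.presheaf.obj (op (U.ι ''ᵁ W))) :
    stalkMapOn hx ψ (F.presheaf.germ (U.ι ''ᵁ W) x hxW m) =
      G.presheaf.germ (U.ι ''ᵁ W) x hxW (ψ.app W m) := stalkMapOnAb_germ hx ψ W hW hxW m

theorem stalkMapOn_map (hx : x ∈ U) (φ : F ⟶ G) :
    stalkMapOn hx ((restr U).map φ) = stalkModMap φ x := by
  refine LinearMap.ext fun v => ?_
  obtain ⟨W, hW, hxW, m, rfl⟩ := exists_germ_image hx v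
  refine (stalkMapOn_germ hx _ W hW hxW m).trans ?_
  exact (TopCat.Presheaf.stalkFunctor_map_germ_apply (C := Ab) (U.ι ''ᵁ W) x hxW
      ((Scheme.Modules.toPresheaf X).map φ) _).symm

theorem stalkMapOn_id (hx : x ∈ U) : stalkMapOn hx (𝟙 ((restr U).obj F)) = LinearMap.id := by
  refine LinearMap.ext fun v => ?_
  obtain ⟨W, hW, hxW, m, rfl⟩ := exists_germ_image hx v
  exact stalkMapOn_germ hx _ W hW hxW m

theorem stalkMapOn_comp (hx : x ∈ U) (ψ : (restr U).obj F ⟶ (restr U).obj G)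
    (ψ' : (restr U).obj G ⟶ (restr U).obj H) :
    stalkMapOn hx (ψ ≫ ψ') = stalkMapOn hx ψ' ∘ₗ stalkMapOn hx ψ := by
  refine LinearMap.ext fun v => ?_
  obtain ⟨W, hW, hxW, m, rfl⟩ := exists_germ_image hx v
  refine (stalkMapOn_germ hx _ W hW hxW m).trans ?_
  refine Eq.trans ?_ (congrArg (stalkMapOn hx ψ') (stalkMapOn_germ hx ψ W hW hxW m)).symm
  exact (stalkMapOn_germ hx ψ' W hW hxW _).symm

theorem stalkMapOn_add (hx : x ∈ U) (ψ ψ' : (restr U).obj F ⟶ (restr U).obj G) :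
    stalkMapOn hx (ψ + ψ') = stalkMapOn hx ψ + stalkMapOn hx ψ' := by
  refine LinearMap.ext fun v => ?_
  obtain ⟨W, hW, hxW, m, rfl⟩ := exists_germ_image hx v
  refine (stalkMapOn_germ hx _ W hW hxW m).trans ?_
  refine Eq.trans ?_ (congrArg₂ (· + ·) (stalkMapOn_germ hx ψ W hW hxW m)
    (stalkMapOn_germ hx ψ' W hW hxW m)).symm
  exact map_add (G.presheaf.germ (U.ι ''ᵁ W) x hxW).hom _ _

variable {K : Type u} [Field K] (ev : X.presheaf.stalk x →+* K)

/-- The map on fibres induced by a morphism of sheaves of modules over an open subset. -/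
def fibreMapOn (hx : x ∈ U) (ψ : (restr U).obj F ⟶ (restr U).obj G) :
    Fibre ev F →ₗ[K] Fibre ev G :=
  letI := ev.toAlgebra
  (stalkMapOn hx ψ).baseChange K

theorem fibreMapOn_map (hx : x ∈ U) (φ : F ⟶ G) :
    fibreMapOn ev hx ((restr U).map φ) = fibreMap ev φ := by
  unfold fibreMapOn fibreMap
  rw [stalkMapOn_map]

theorem fibreMapOn_id (hx : x ∈ U) : fibreMapOn ev hx (𝟙 ((restr U).obj F)) = LinearMap.id := by
  let := ev.toAlgebra
  unfold fibreMapOn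
  rw [stalkMapOn_id]
  exact LinearMap.baseChange_id

theorem fibreMapOn_comp (hx : x ∈ U) (ψ : (restr U).obj F ⟶ (restr U).obj G)
    (ψ' : (restr U).obj G ⟶ (restr U).obj H) :
    fibreMapOn ev hx (ψ ≫ ψ') = fibreMapOn ev hx ψ' ∘ₗ fibreMapOn ev hx ψ := by
  let := ev.toAlgebra
  unfold fibreMapOn
  rw [stalkMapOn_comp]
  exact LinearMap.baseChange_comp ..

theorem fibreMapOn_add (hx : x ∈ U) (ψ ψ' : (restr U).obj F ⟶ (restr U).obj G) :
    fibreMapOn ev hx (ψ + ψ') = fibreMapOn ev hx ψ + fibreMapOn ev hx ψ' := by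
  let := ev.toAlgebra
  unfold fibreMapOn
  rw [stalkMapOn_add]
  exact LinearMap.baseChange_add ..

theorem fibreMap_comp (φ : F ⟶ G) (φ' : G ⟶ H) (z : Fibre ev F) :
    fibreMap ev (φ ≫ φ') z = fibreMap ev φ' (fibreMap ev φ z) := by
  have hx : x ∈ (⊤ : X.Opens) := trivial
  rw [← fibreMapOn_map ev hx, ← fibreMapOn_map ev hx, ← fibreMapOn_map ev hx, Functor.map_comp,
    fibreMapOn_comp]
  rfl

end StalkOn

/-! ### Stalks of `Ñ` as modules of fractions -/

section StalkValue

variable {k A N : Type u} [Field k] [CommRing A] [Algebra k A]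
  {𝒜 : ℕ → Submodule k A} [GradedAlgebra 𝒜] [AddCommGroup N] [Module A N]
  {𝒩 : ℕ → AddSubgroup N} [SetLike.GradedSMul 𝒜 𝒩]
  {N' : Type u} [AddCommGroup N'] [Module A N'] {𝒩' : ℕ → AddSubgroup N'}
  [SetLike.GradedSMul 𝒜 𝒩']

variable (𝒩) in
/-- The evaluation at `x` of the sections of `Ñ` over a neighbourhood of `x`. -/
def sectionValue (x : ProjectiveSpectrum 𝒜) (U : Opens (ProjectiveSpectrum.top 𝒜)) (hx : x ∈ U) :
    (projTildeAb 𝒜 𝒩).obj (op U) ⟶ AddCommGrpCat.of (LocalizedAt 𝒜 N x) :=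
  AddCommGrpCat.ofHom
    { toFun := fun t : (projTildeInType 𝒜 𝒩).1.obj (op U) => t.1 ⟨x, hx⟩
      map_zero' := rfl
      map_add' := fun _ _ => rfl }

variable (𝒩) in
/-- The evaluations at `x` over all neighbourhoods of `x`. -/
def valueCocone (x : ProjectiveSpectrum.top 𝒜) :
    Limits.Cocone ((OpenNhds.inclusion x).op ⋙ projTildeAb 𝒜 𝒩) where
  pt := AddCommGrpCat.of (LocalizedAt 𝒜 N x)
  ι := { app := fun U => sectionValue 𝒩 x U.unop.1 U.unop.2
         naturality := fun _ _ _ => rfl }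

variable (𝒩) in
/-- The morphism underlying `stalkValue`. -/
def stalkValueAb (x : ProjectiveSpectrum.top 𝒜) :
    TopCat.Presheaf.stalk (projTildeAb 𝒜 𝒩) x ⟶ AddCommGrpCat.of (LocalizedAt 𝒜 N x) :=
  Limits.colimit.desc _ (valueCocone 𝒩 x)

theorem germ_stalkValueAb (x : ProjectiveSpectrum.top 𝒜) (U : Opens (ProjectiveSpectrum.top 𝒜))
    (hx : x ∈ U) : TopCat.Presheaf.germ (projTildeAb 𝒜 𝒩) U x hx ≫ stalkValueAb 𝒩 x =
      sectionValue 𝒩 x U hx :=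
  Limits.colimit.ι_desc (valueCocone 𝒩 x) (op ⟨U, hx⟩)

variable (𝒩) in
/-- The map from the stalk of `Ñ` at `x` to the localization `N_x`. -/
def stalkValue (x : ProjectiveSpectrum 𝒜) :
    stalkMod (projTilde 𝒜 𝒩) (show Proj 𝒜 from x) →+ LocalizedAt 𝒜 N x :=
  (stalkValueAb 𝒩 x).hom

theorem stalkValue_germ (x : ProjectiveSpectrum 𝒜) (U : (Proj 𝒜).Opens)
    (hx : (show Proj 𝒜 from x) ∈ U) (t : (projTilde 𝒜 𝒩).presheaf.obj (op U)) :
    stalkValue 𝒩 x ((projTilde 𝒜 𝒩).presheaf.germ U x hx t) =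
      (show (projTildeInType 𝒜 𝒩).1.obj (op U) from t).1 ⟨x, hx⟩ :=
  ConcreteCategory.congr_hom (germ_stalkValueAb x U hx) t

theorem stalkValue_smul (x : ProjectiveSpectrum 𝒜)
    (r : (Proj 𝒜).presheaf.stalk (show Proj 𝒜 from x))
    (v : stalkMod (projTilde 𝒜 𝒩) (show Proj 𝒜 from x)) :
    stalkValue 𝒩 x (r • v) = HomogeneousLocalization.val ((Proj.stalkIso 𝒜 x).hom r) •
      stalkValue 𝒩 x v := by
  obtain ⟨U, hU, r, rfl⟩ := (Proj 𝒜).presheaf.exists_germ_eq r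
  obtain ⟨V, hV, m, rfl⟩ := (projTilde 𝒜 𝒩).presheaf.exists_germ_eq v
  have hUV : (show Proj 𝒜 from x) ∈ U ⊓ V := ⟨hU, hV⟩
  have hr := (Proj 𝒜).presheaf.germ_res_apply (homOfLE inf_le_left : U ⊓ V ⟶ U) x hUV r
  have hm := (projTilde 𝒜 𝒩).presheaf.germ_res_apply (homOfLE inf_le_right : U ⊓ V ⟶ V) x hUV m
  rw [← hr, ← hm]
  generalize (Proj 𝒜).presheaf.map (homOfLE inf_le_left : U ⊓ V ⟶ U).op r = r'
  generalize (projTilde 𝒜 𝒩).presheaf.map (homOfLE inf_le_right : U ⊓ V ⟶ V).op m = m'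
  refine (congrArg (stalkValue 𝒩 x) (germ_smul _ _ (U ⊓ V) hUV r' m').symm).trans ?_
  refine (stalkValue_germ x (U ⊓ V) hUV _).trans ?_
  refine Eq.trans ?_ (congrArg₂ (fun (a : HomogeneousLocalization.AtPrime 𝒜
    x.asHomogeneousIdeal.toIdeal) (b : LocalizedAt 𝒜 N x) => HomogeneousLocalization.val a • b)
    (Proj.stalkIso'_germ 𝒜 (U ⊓ V) x hUV r') (stalkValue_germ x (U ⊓ V) hUV m')).symm
  rfl

theorem stalkValue_map (x : ProjectiveSpectrum 𝒜) (φ : N →ₗ[A] N')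
    (hφ : ∀ d, ∀ n ∈ 𝒩 d, φ n ∈ 𝒩' d) (v : stalkMod (projTilde 𝒜 𝒩) (show Proj 𝒜 from x)) :
    stalkValue 𝒩' x (stalkModMap (projTildeMap 𝒜 φ hφ) (show Proj 𝒜 from x) v) =
      localizedMap 𝒜 x φ (stalkValue 𝒩 x v) := by
  obtain ⟨U, hU, t, rfl⟩ := (projTilde 𝒜 𝒩).presheaf.exists_germ_eq v
  refine (congrArg (stalkValue 𝒩' x) (TopCat.Presheaf.stalkFunctor_map_germ_apply (C := Ab) U
    (show Proj 𝒜 from x) hU ((Scheme.Modules.toPresheaf _).map (projTildeMap 𝒜 φ hφ)) t)).trans ?_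
  refine (stalkValue_germ x U hU _).trans ?_
  exact congrArg (localizedMap 𝒜 x φ) (stalkValue_germ x U hU t).symm

/-- Every element of the stalk is a homogeneous fraction of degree zero. -/
theorem exists_stalkValue_eq (x : ProjectiveSpectrum 𝒜)
    (v : stalkMod (projTilde 𝒜 𝒩) (show Proj 𝒜 from x)) :
    ∃ (d : ℕ) (n : N) (b : A), n ∈ 𝒩 d ∧ b ∈ 𝒜 d ∧ IsFractionAt 𝒜 x n b (stalkValue 𝒩 x v) := by
  obtain ⟨U, hU, t, rfl⟩ := (projTilde 𝒜 𝒩).presheaf.exists_germ_eq v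
  obtain ⟨W, mW, iW, d, n, b, hn, hb, w⟩ :=
    (show (projTildeInType 𝒜 𝒩).1.obj (op U) from t).2 ⟨x, hU⟩
  refine ⟨d, n, b, hn, hb, ?_⟩
  rw [stalkValue_germ]
  exact w ⟨x, mW⟩

variable (𝒩) in
/-- The section `n / b` of `Ñ` over the open set where `b` does not vanish. -/
def fracSection {d : ℕ} {n : N} {b : A} (hn : n ∈ 𝒩 d) (hb : b ∈ 𝒜 d) :
    (projTilde 𝒜 𝒩).presheaf.obj (op (Proj.basicOpen 𝒜 b)) :=
  (⟨fun x => LocalizedModule.mk n ⟨b, x.2⟩, fun x => ⟨_, x.2, 𝟙 _, d, n, b, hn, hb,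
    fun y => ⟨y.2, rfl⟩⟩⟩ : (projTildeInType 𝒜 𝒩).1.obj (op (Proj.basicOpen 𝒜 b)))

variable (𝒩) in
/-- The germ at `x` of the section `n / b`. -/
def fracGerm (x : ProjectiveSpectrum 𝒜) {d : ℕ} {n : N} {b : A} (hn : n ∈ 𝒩 d) (hb : b ∈ 𝒜 d)
    (hx : b ∈ x.asHomogeneousIdeal.toIdeal.primeCompl) :
    stalkMod (projTilde 𝒜 𝒩) (show Proj 𝒜 from x) :=
  (projTilde 𝒜 𝒩).presheaf.germ (Proj.basicOpen 𝒜 b) x hx (fracSection 𝒩 hn hb)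

theorem stalkValue_fracGerm (x : ProjectiveSpectrum 𝒜) {d : ℕ} {n : N} {b : A} (hn : n ∈ 𝒩 d)
    (hb : b ∈ 𝒜 d) (hx : b ∈ x.asHomogeneousIdeal.toIdeal.primeCompl) :
    stalkValue 𝒩 x (fracGerm 𝒩 x hn hb hx) = LocalizedModule.mk n ⟨b, hx⟩ :=
  stalkValue_germ x (Proj.basicOpen 𝒜 b) hx _

/-- For a torsion-free graded module, the stalks are contained in the localizations. -/
theorem stalkValue_injective [IsDomain A] [Module.IsTorsionFree A N] (x : ProjectiveSpectrum 𝒜) :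
    Function.Injective (stalkValue 𝒩 x) := by
  refine (injective_iff_map_eq_zero _).mpr fun v hv => ?_
  obtain ⟨U, hU, t, rfl⟩ := (projTilde 𝒜 𝒩).presheaf.exists_germ_eq v
  rw [stalkValue_germ] at hv
  obtain ⟨W, mW, iW, d, n, b, hn, hb, w⟩ :=
    (show (projTildeInType 𝒜 𝒩).1.obj (op U) from t).2 ⟨x, hU⟩
  obtain ⟨hbx, h⟩ := w ⟨x, mW⟩
  have h0 : (LocalizedModule.mk n ⟨b, hbx⟩ : LocalizedAt 𝒜 N x) = LocalizedModule.mk 0 1 :=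
    (h.symm.trans hv).trans (LocalizedModule.zero_mk _).symm
  rw [LocalizedModule.mk_eq] at h0
  obtain ⟨c, hc⟩ := h0
  have hn0 : n = 0 := by
    simp only [one_smul, smul_zero, Submonoid.smul_def] at hc
    refine (smul_eq_zero.mp hc).resolve_left fun h1 => c.2 ?_
    rw [h1]
    exact zero_mem _
  subst hn0
  have ht : (projTilde 𝒜 𝒩).presheaf.map iW.op t = 0 := by
    refine Subtype.ext (funext fun y => ?_)
    obtain ⟨hy, e⟩ := w y
    exact e.trans (LocalizedModule.zero_mk _)
  have h2 := (projTilde 𝒜 𝒩).presheaf.germ_res_apply iW x mW t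
  refine h2.symm.trans ((congrArg ((projTilde 𝒜 𝒩).presheaf.germ W x mW).hom ht).trans ?_)
  exact map_zero ((projTilde 𝒜 𝒩).presheaf.germ W x mW).hom

end StalkValue

/-! ### Evaluation on fibres -/

/-- The `K`-linear map on a base change along `ev : R → K` extending an `ev`-semilinear map. -/
def liftFibre {R K F E : Type u} [CommRing R] [Field K] (ev : R →+* K) [AddCommGroup F] [Module R F]
    [AddCommGroup E] [Module K E] (g : F →+ E) (hg : ∀ r v, g (r • v) = ev r • g v) :
    letI := ev.toAlgebra
    K ⊗[R] F →ₗ[K] E :=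
  letI := ev.toAlgebra
  letI : Module R E := Module.compHom _ ev
  haveI : IsScalarTower R K E := ⟨fun a b c => by rw [Algebra.smul_def, mul_smul]; rfl⟩
  LinearMap.liftBaseChange K { g with map_smul' := hg }

section Evaluation

variable {k : Type u} [Field k] {s : ℕ} {K : Type u} [Field K] [Algebra k K]
  {W W' : Type u} [AddCommGroup W] [Module k W] [AddCommGroup W'] [Module k W']

/-- The evaluation at `α` of the elements of `S ⊗ W`. -/
def evalTensor (α : Fin s → K) : S k s ⊗[k] W →ₗ[k] K ⊗[k] W :=
  LinearMap.rTensor W (MvPolynomial.aeval α : S k s →ₐ[k] K).toLinearMap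

theorem evalTensor_tmul (α : Fin s → K) (f : S k s) (w : W) :
    evalTensor α (f ⊗ₜ[k] w) = MvPolynomial.aeval α f ⊗ₜ[k] w := rfl

theorem evalTensor_smul (α : Fin s → K) (a : S k s) (n : S k s ⊗[k] W) :
    evalTensor α (a • n) = MvPolynomial.aeval α a • evalTensor α n := by
  induction n using TensorProduct.induction_on with
  | zero => simp
  | tmul f w =>
    rw [smul_tmul', smul_eq_mul, evalTensor_tmul, evalTensor_tmul, map_mul, smul_tmul', smul_eq_mul]
  | add n n' h h' => rw [smul_add, map_add, map_add, smul_add, h, h']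

variable {α : Fin s → K} {hα : α ≠ 0}

theorem aeval_ne_zero_of_mem {d : ℕ} {b : S k s} (hb : b ∈ grading k s d)
    (hx : b ∈ (pointPrime k α hα).asHomogeneousIdeal.toIdeal.primeCompl) :
    MvPolynomial.aeval α b ≠ 0 := fun h => hx ((mem_point_iff α hα hb).mpr h)

/-- The element `w` is the value at `α` of the homogeneous fraction `l = n / b`: the denominators
are cleared, `b(α) w = n(α)`. -/
def IsValue (j : ℤ) (l : LocalizedAt (grading k s) (S k s ⊗[k] W) (pointPrime k α hα))
    (w : K ⊗[k] W) : Prop :=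
  ∃ (d : ℕ) (n : S k s ⊗[k] W) (b : S k s), n ∈ twistDeg k s W j d ∧ b ∈ grading k s d ∧
    IsFractionAt (grading k s) (pointPrime k α hα) n b l ∧
      MvPolynomial.aeval α b • w = evalTensor α n

variable {j j' : ℤ} {l l' : LocalizedAt (grading k s) (S k s ⊗[k] W) (pointPrime k α hα)}
  {w w' : K ⊗[k] W}

theorem IsValue.unique (h : IsValue j l w) (h' : IsValue j l w') : w = w' := by
  obtain ⟨d, n, b, hn, hb, ⟨hx, rfl⟩, e⟩ := h
  obtain ⟨d', n', b', hn', hb', ⟨hx', h⟩, e'⟩ := h'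
  rw [LocalizedModule.mk_eq] at h
  obtain ⟨c, hc⟩ := h
  have hc0 : (c : S k s) ≠ 0 := fun h => c.2 (by rw [h]; exact zero_mem _)
  have h1 : b' • n = b • n' := smul_right_injective _ hc0 hc
  have h2 := congrArg (evalTensor α) h1
  rw [evalTensor_smul, evalTensor_smul, ← e, ← e', smul_smul, smul_smul, mul_comm] at h2
  exact smul_right_injective _
    (mul_ne_zero (aeval_ne_zero_of_mem hb hx) (aeval_ne_zero_of_mem hb' hx')) h2

theorem IsValue.add (h : IsValue j l w) (h' : IsValue j l' w') :
    IsValue j (l + l') (w + w') := by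
  obtain ⟨d, n, b, hn, hb, ⟨hx, rfl⟩, e⟩ := h
  obtain ⟨d', n', b', hn', hb', ⟨hx', rfl⟩, e'⟩ := h'
  refine ⟨d + d', b' • n + b • n', b * b', add_mem ?_ ?_, SetLike.mul_mem_graded hb hb',
    ⟨Submonoid.mul_mem _ hx hx', LocalizedModule.mk_add_mk ..⟩, ?_⟩
  · rw [add_comm]; exact SetLike.GradedSMul.smul_mem hb' hn
  · exact SetLike.GradedSMul.smul_mem hb hn'
  · rw [map_add, evalTensor_smul, evalTensor_smul, ← e, ← e', map_mul, smul_add, smul_smul,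
      smul_smul, mul_comm]

theorem IsValue.smul (h : IsValue j l w) (r : HomogeneousLocalization.AtPrime (grading k s)
    (pointPrime k α hα).asHomogeneousIdeal.toIdeal) :
    IsValue j (HomogeneousLocalization.val r • l) (evalAt α hα r • w) := by
  obtain ⟨d, n, b, hn, hb, ⟨hx, rfl⟩, e⟩ := h
  obtain ⟨c, rfl⟩ := HomogeneousLocalization.mk_surjective r
  refine ⟨c.deg + d, (c.num : S k s) • n, (c.den : S k s) * b,
    SetLike.GradedSMul.smul_mem c.num.2 hn, SetLike.mul_mem_graded c.den.2 hb,
    ⟨Submonoid.mul_mem _ c.den_mem hx, ?_⟩, ?_⟩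
  · rw [HomogeneousLocalization.val_mk]
    exact LocalizedModule.mk_smul_mk ..
  · have h : evalAt α hα (HomogeneousLocalization.mk c) =
      MvPolynomial.aeval α (c.num : S k s) / MvPolynomial.aeval α (c.den : S k s) := rfl
    rw [h, evalTensor_smul, ← e, map_mul, smul_smul, smul_smul, mul_right_comm,
      mul_div_cancel₀ _ (aeval_den_ne_zero α hα c)]

theorem IsValue.map (h : IsValue j l w) (φ : S k s ⊗[k] W →ₗ[S k s] S k s ⊗[k] W')
    (hφ : ∀ d, ∀ n ∈ twistDeg k s W j d, φ n ∈ twistDeg k s W' j' d)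
    (φα : K ⊗[k] W →ₗ[K] K ⊗[k] W') (hα' : ∀ n, evalTensor α (φ n) = φα (evalTensor α n)) :
    IsValue j' (localizedMap (grading k s) (pointPrime k α hα) φ l) (φα w) := by
  obtain ⟨d, n, b, hn, hb, ⟨hx, rfl⟩, e⟩ := h
  exact ⟨d, φ n, b, hφ d n hn, hb, ⟨hx, localizedMap_mk ..⟩, by rw [hα', ← e, map_smul]⟩

theorem exists_isValue (v : stalkMod (twist k s W j) (point k α hα)) :
    ∃ w : K ⊗[k] W, IsValue j (stalkValue (twistDeg k s W j) (pointPrime k α hα) v) w := by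
  obtain ⟨d, n, b, hn, hb, hx, e⟩ := exists_stalkValue_eq (𝒩 := twistDeg k s W j)
    (pointPrime k α hα) v
  refine ⟨(MvPolynomial.aeval α b)⁻¹ • evalTensor α n, d, n, b, hn, hb, ⟨hx, e⟩, ?_⟩
  rw [smul_smul, mul_inv_cancel₀ (aeval_ne_zero_of_mem hb hx), one_smul]

/-- The value at `α` of a germ at `ᾱ` of a section of `W ⊗ 𝒪(j)`. -/
def germEval (v : stalkMod (twist k s W j) (point k α hα)) : K ⊗[k] W := (exists_isValue v).choose

theorem germEval_spec (v : stalkMod (twist k s W j) (point k α hα)) :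
    IsValue j (stalkValue (twistDeg k s W j) (pointPrime k α hα) v) (germEval v) :=
  (exists_isValue v).choose_spec

theorem germEval_smul (r : (ProjSpace k s).presheaf.stalk (point k α hα))
    (v : stalkMod (twist k s W j) (point k α hα)) :
    germEval (r • v) = evalStalk k α hα r • germEval v := by
  refine (germEval_spec _).unique ?_
  have h := stalkValue_smul (𝒩 := twistDeg k s W j) (pointPrime k α hα) r v
  rw [show stalkValue (twistDeg k s W j) (pointPrime k α hα) (r • v) = _ from h]
  exact (germEval_spec v).smul _

theorem germEval_add (v v' : stalkMod (twist k s W j) (point k α hα)) :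
    germEval (v + v') = germEval v + germEval v' := by
  refine (germEval_spec _).unique ?_
  have h := (stalkValue (twistDeg k s W j) (pointPrime k α hα)).map_add v v'
  rw [show stalkValue (twistDeg k s W j) (pointPrime k α hα) (v + v') = _ from h]
  exact (germEval_spec v).add (germEval_spec v')

variable (k W j hα) in
/-- Evaluation at `α`, from the fibre of `W ⊗ 𝒪(j)` at `ᾱ` to `K ⊗ W`. -/
def fibreEval : Fibre (evalStalk k α hα) (twist k s W j) →ₗ[K] K ⊗[k] W :=
  liftFibre (evalStalk k α hα) (AddMonoidHom.mk' germEval germEval_add) germEval_smul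

/-- The element `1 ⊗ v` of the fibre given by a germ `v`. -/
def fibreOfGerm {X : Scheme.{u}} {x : X} (ev : X.presheaf.stalk x →+* K) {F : X.Modules}
    (v : stalkMod F x) : Fibre ev F :=
  letI := ev.toAlgebra
  (1 : K) ⊗ₜ[X.presheaf.stalk x] v

theorem fibreOfGerm_smul {X : Scheme.{u}} {x : X} (ev : X.presheaf.stalk x →+* K) {F : X.Modules}
    (r : X.presheaf.stalk x) (v : stalkMod F x) :
    fibreOfGerm ev (r • v) = ev r • fibreOfGerm ev v := by
  let := ev.toAlgebra
  refine (TensorProduct.tmul_smul _ _ _).trans ((TensorProduct.smul_tmul' _ _ _).trans ?_)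
  refine Eq.trans ?_ (TensorProduct.smul_tmul' _ _ _).symm
  rw [smul_eq_mul, Algebra.smul_def]
  rfl

theorem fibreOfGerm_add {X : Scheme.{u}} {x : X} (ev : X.presheaf.stalk x →+* K) {F : X.Modules}
    (v v' : stalkMod F x) :
    fibreOfGerm ev (v + v') = fibreOfGerm ev v + fibreOfGerm ev v' := by
  let := ev.toAlgebra
  exact TensorProduct.tmul_add ..

theorem Fibre.induction {X : Scheme.{u}} {x : X} {ev : X.presheaf.stalk x →+* K} {F : X.Modules}
    {P : Fibre ev F → Prop} (smul : ∀ (c : K) v, P (c • fibreOfGerm ev v))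
    (add : ∀ z z', P z → P z' → P (z + z')) (z : Fibre ev F) : P z := by
  let := ev.toAlgebra
  refine TensorProduct.induction_on (motive := P) z ?_ (fun c v => ?_) add
  · have := smul 0 0
    rwa [zero_smul] at this
  · have := smul c v
    rwa [show c • fibreOfGerm ev v = c ⊗ₜ[X.presheaf.stalk x] v from
      (TensorProduct.smul_tmul' _ _ _).trans (by rw [smul_eq_mul, mul_one])] at this

theorem fibreEval_fibreOfGerm (v : stalkMod (twist k s W j) (point k α hα)) :
    fibreEval k W hα j (fibreOfGerm (evalStalk k α hα) v) = germEval v := one_smul K _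

theorem fibreMap_fibreOfGerm {X : Scheme.{u}} {x : X} (ev : X.presheaf.stalk x →+* K)
    {F G : X.Modules} (φ : F ⟶ G) (v : stalkMod F x) :
    fibreMap ev φ (fibreOfGerm ev v) = fibreOfGerm ev (stalkModMap φ x v) := rfl

/-- Evaluation at `α` is compatible with a morphism `Φ` of sheaves given by a map `φ` of graded
modules whose value at `α` is the map `φα`. -/
theorem fibreEval_fibreMap (φ : S k s ⊗[k] W →ₗ[S k s] S k s ⊗[k] W')
    (hφ : ∀ d, ∀ n ∈ twistDeg k s W j d, φ n ∈ twistDeg k s W' j' d)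
    (φα : K ⊗[k] W →ₗ[K] K ⊗[k] W') (hα' : ∀ n, evalTensor α (φ n) = φα (evalTensor α n))
    {Φ : twist k s W j ⟶ twist k s W' j'} (hΦ : Φ = projTildeMap (grading k s) φ hφ)
    (z : Fibre (evalStalk k α hα) (twist k s W j)) :
    fibreEval k W' hα j' (fibreMap (evalStalk k α hα) Φ z) = φα (fibreEval k W hα j z) := by
  induction z using Fibre.induction with
  | add z z' h h' => rw [map_add, map_add, map_add, map_add, h, h']
  | smul c v =>
    rw [map_smul, map_smul, map_smul, map_smul, fibreMap_fibreOfGerm, fibreEval_fibreOfGerm,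
      fibreEval_fibreOfGerm]
    congr 1
    refine (germEval_spec _).unique ?_
    have h := stalkValue_map (𝒩 := twistDeg k s W j) (𝒩' := twistDeg k s W' j')
      (pointPrime k α hα) φ hφ v
    subst hΦ
    exact h ▸ (germEval_spec v).map φ hφ φα hα'

theorem fibreEval_constMap (v : K ⊗[k] W) : fibreEval k W hα 0 (constMap k W α hα v) = v := by
  induction v using TensorProduct.induction_on with
  | zero => rw [map_zero, map_zero]
  | add v v' h h' => rw [map_add, map_add, h, h']
  | tmul c w =>
    rw [constMap_tmul, map_smul]
    have h : fibreEval k W hα 0 (constValue α hα w) = (1 : K) ⊗ₜ[k] w := by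
      refine (fibreEval_fibreOfGerm _).trans ((germEval_spec _).unique ?_)
      refine ⟨0, (1 : S k s) ⊗ₜ[k] w, 1, one_tmul_mem w, SetLike.GradedOne.one_mem,
        ⟨Submonoid.one_mem _,
          stalkValue_germ (𝒩 := twistDeg k s W 0) (pointPrime k α hα) ⊤ trivial _⟩, ?_⟩
      rw [evalTensor_tmul, map_one, one_smul]
    rw [h, smul_tmul', smul_eq_mul, mul_one]

end Evaluation

/-! ### Evaluation is bijective -/

section EvaluationBijective

variable {k : Type u} [Field k] {s : ℕ} {K : Type u} [Field K] [Algebra k K]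
  {W W' : Type u} [AddCommGroup W] [Module k W] [AddCommGroup W'] [Module k W']
  {α : Fin s → K} {hα : α ≠ 0} {j : ℤ}

instance : Module.IsTorsionFree (S k s) (S k s ⊗[k] W) :=
  haveI : Module.Free (S k s) (S k s ⊗[k] W) := inferInstance
  inferInstance

theorem localizedModule_mk_add {A N : Type*} [CommRing A] [AddCommGroup N] [Module A N]
    {T : Submonoid A} (n n' : N) (b : T) :
    LocalizedModule.mk (n + n') b = LocalizedModule.mk n b + LocalizedModule.mk n' b := by
  rw [LocalizedModule.mk_add_mk, ← smul_add, LocalizedModule.mk_cancel_common_left]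

theorem stalkValue_twist_injective :
    Function.Injective (stalkValue (twistDeg k s W j) (pointPrime k α hα)) :=
  stalkValue_injective _

theorem germEval_fracGerm {d : ℕ} {n : S k s ⊗[k] W} {b : S k s} (hn : n ∈ twistDeg k s W j d)
    (hb : b ∈ grading k s d)
    (hx : b ∈ (pointPrime k α hα).asHomogeneousIdeal.toIdeal.primeCompl) :
    germEval (j := j) (fracGerm (twistDeg k s W j) (pointPrime k α hα) hn hb hx) =
      (MvPolynomial.aeval α b)⁻¹ • evalTensor α n := by
  refine (germEval_spec _).unique ⟨d, n, b, hn, hb, ⟨hx, stalkValue_fracGerm _ hn hb hx⟩, ?_⟩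
  rw [smul_smul, mul_inv_cancel₀ (aeval_ne_zero_of_mem hb hx), one_smul]

/-- If the germs `g w` depend on `w ∈ W` linearly over `k` and generate the stalk, and if the value
of `g w` at `α` is a nonzero multiple of `w`, then evaluation at `α` is bijective. -/
theorem fibreEval_bijective_of_germ (g : W → stalkMod (twist k s W j) (point k α hα))
    (hadd : ∀ w w', g (w + w') = g w + g w')
    (hsmul : ∀ (c : k) w, fibreOfGerm (evalStalk k α hα) (g (c • w)) =
      algebraMap k K c • fibreOfGerm (evalStalk k α hα) (g w))
    (hgen : ∀ v, v ∈ Submodule.span ((ProjSpace k s).presheaf.stalk (point k α hα)) (Set.range g))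
    {c : K} (hc : c ≠ 0) (hval : ∀ w, germEval (g w) = c • (1 : K) ⊗ₜ[k] w) :
    Function.Bijective (fibreEval k W hα j) := by
  let γ : K ⊗[k] W →ₗ[K] Fibre (evalStalk k α hα) (twist k s W j) :=
    letI : Module k (Fibre (evalStalk k α hα) (twist k s W j)) :=
      Module.compHom _ (algebraMap k K)
    haveI : IsScalarTower k K (Fibre (evalStalk k α hα) (twist k s W j)) :=
      ⟨fun a b c => by rw [Algebra.smul_def, mul_smul]; rfl⟩
    LinearMap.liftBaseChange K
      { toFun := fun w => fibreOfGerm (evalStalk k α hα) (g w)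
        map_add' := fun w w' => by rw [hadd, fibreOfGerm_add]
        map_smul' := hsmul }
  have hγ : ∀ c w, γ (c ⊗ₜ w) = c • fibreOfGerm (evalStalk k α hα) (g w) := fun _ _ => rfl
  have h1 : ∀ t, fibreEval k W hα j (γ t) = c • t := fun t => by
    induction t using TensorProduct.induction_on with
    | zero => simp
    | add t t' h h' => rw [map_add, map_add, h, h', smul_add]
    | tmul a w =>
      rw [hγ, map_smul, fibreEval_fibreOfGerm, hval, smul_comm, smul_tmul', smul_eq_mul, mul_one]
  have h2 : Function.Surjective γ := fun z => by
    induction z using Fibre.induction with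
    | add z z' h h' =>
      obtain ⟨t, rfl⟩ := h
      obtain ⟨t', rfl⟩ := h'
      exact ⟨t + t', map_add ..⟩
    | smul a v =>
      have : ∀ v : stalkMod (twist k s W j) (point k α hα),
          fibreOfGerm (evalStalk k α hα) v ∈ LinearMap.range γ := fun v => by
        induction hgen v using Submodule.span_induction with
        | mem v hv =>
          obtain ⟨w, rfl⟩ := hv
          exact ⟨1 ⊗ₜ w, by rw [hγ, one_smul]⟩
        | zero =>
          have := fibreOfGerm_smul (evalStalk k α hα) 0
            (0 : stalkMod (twist k s W j) (point k α hα))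
          rw [zero_smul, map_zero, zero_smul] at this
          rw [this]
          exact zero_mem _
        | add v v' _ _ h h' => rw [fibreOfGerm_add]; exact add_mem h h'
        | smul r v _ h => rw [fibreOfGerm_smul]; exact Submodule.smul_mem _ _ h
      exact (LinearMap.range γ).smul_mem a (this v)
  constructor
  · refine (injective_iff_map_eq_zero _).mpr fun z hz => ?_
    obtain ⟨t, rfl⟩ := h2 z
    rw [h1, smul_eq_zero] at hz
    rw [hz.resolve_left hc, map_zero]
  · intro t
    exact ⟨γ (c⁻¹ • t), by rw [h1, smul_smul, mul_inv_cancel₀ hc, one_smul]⟩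

theorem twistDeg_induction {d : ℕ} {P : S k s ⊗[k] W → Prop}
    (hadd : ∀ n ∈ twistDeg k s W j d, ∀ n' ∈ twistDeg k s W j d, P n → P n' → P (n + n'))
    (htmul : ∀ (e : ℕ) (f : S k s) (w : W), (e : ℤ) = d + j → f ∈ grading k s e → P (f ⊗ₜ[k] w))
    (hzero : P 0) : ∀ n ∈ twistDeg k s W j d, P n := by
  intro n hn
  have h : ∀ c : k, P (c • n) := by
    change n ∈ Submodule.span k _ at hn
    induction hn using Submodule.span_induction with
    | mem n hn =>
      obtain ⟨e, f, w, he, hf, rfl⟩ := hn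
      intro c
      rw [smul_tmul']
      exact htmul e _ w he (Submodule.smul_mem _ c hf)
    | zero => intro c; rwa [smul_zero]
    | add n n' hn hn' h h' =>
      intro c
      rw [smul_add]
      exact hadd _ (Submodule.smul_mem _ c hn) _ (Submodule.smul_mem _ c hn') (h c) (h' c)
    | smul a n _ h => intro c; rw [smul_smul]; exact h _
  simpa using h 1

theorem exists_degrees (j : ℤ) : ∃ d e : ℕ, (e : ℤ) = d + j :=
  ⟨(-j).toNat, j.toNat, by omega⟩

variable (k W hα j) in
/-- If the coordinate `Y_i` does not vanish at `ᾱ`, then the germs of the sections `Y_i^j w`, where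
`w ∈ W`, generate the stalk of `W ⊗ 𝒪(j)`. For negative `j`, the section `Y_i^j` is written as a
fraction `Y_i^e / Y_i^d` with `j = e - d`. -/
theorem fibreEval_bijective : Function.Bijective (fibreEval k W hα j) := by
  obtain ⟨i, hi⟩ := Function.ne_iff.mp hα
  change α i ≠ 0 at hi
  obtain ⟨d, e, hde⟩ := exists_degrees j
  have hX : (MvPolynomial.X i : S k s) ∈ grading k s 1 := MvPolynomial.isHomogeneous_X k i
  have hpow : ∀ n, (MvPolynomial.X i : S k s) ^ n ∈ grading k s n := fun n => by
    simpa using SetLike.pow_mem_graded n hX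
  have hx : ∀ n, (MvPolynomial.X i : S k s) ^ n ∈
      (pointPrime k α hα).asHomogeneousIdeal.toIdeal.primeCompl := fun n h => by
    have := (mem_point_iff α hα (hpow n)).mp h
    rw [map_pow, MvPolynomial.aeval_X] at this
    exact hi (eq_zero_of_pow_eq_zero this)
  let g : W → stalkMod (twist k s W j) (point k α hα) := fun w =>
    fracGerm (twistDeg k s W j) (pointPrime k α hα) (tmul_mem_twistDeg hde (hpow e) w) (hpow d)
      (hx d)
  have hg : ∀ w, stalkValue (twistDeg k s W j) (pointPrime k α hα) (g w) =
    LocalizedModule.mk (((MvPolynomial.X i : S k s) ^ e) ⊗ₜ[k] w) ⟨_, hx d⟩ := fun w =>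
      stalkValue_fracGerm _ _ _ _
  have hadd : ∀ w w', g (w + w') = g w + g w' := fun w w' => by
    refine stalkValue_twist_injective ?_
    have h := (stalkValue (twistDeg k s W j) (pointPrime k α hα)).map_add (g w) (g w')
    refine Eq.trans ?_ h.symm
    rw [hg, hg, hg, tmul_add]
    exact localizedModule_mk_add ..
  -- a fraction `(f ⊗ w) / b` is the multiple `(f Y_i^d) / (b Y_i^e)` of `g w`
  have hfrac : ∀ (d' e' : ℕ) (f b : S k s) (w : W), (e' : ℤ) = d' + j → f ∈ grading k s e' →
      ∀ (hb : b ∈ grading k s d')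
        (hbx : b ∈ (pointPrime k α hα).asHomogeneousIdeal.toIdeal.primeCompl)
      (v : stalkMod (twist k s W j) (point k α hα)),
      stalkValue (twistDeg k s W j) (pointPrime k α hα) v =
        LocalizedModule.mk (f ⊗ₜ[k] w) ⟨b, hbx⟩ →
      ∃ r : (ProjSpace k s).presheaf.stalk (point k α hα), v = r • g w ∧
        evalStalk k α hα r = MvPolynomial.aeval α (f * MvPolynomial.X i ^ d) /
          MvPolynomial.aeval α (b * MvPolynomial.X i ^ e) := by
    intro d' e' f b w he' hf hb hbx v hv
    have hdeg : e' + d = d' + e := by omega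
    let c : HomogeneousLocalization.NumDenSameDeg (grading k s)
        (pointPrime k α hα).asHomogeneousIdeal.toIdeal.primeCompl :=
      ⟨d' + e, ⟨f * MvPolynomial.X i ^ d, hdeg ▸ SetLike.mul_mem_graded hf (hpow d)⟩,
        ⟨b * MvPolynomial.X i ^ e, SetLike.mul_mem_graded hb (hpow e)⟩,
        Submonoid.mul_mem _ hbx (hx e)⟩
    have hc := ConcreteCategory.congr_hom
      (Proj.stalkIso (grading k s) (point k α hα)).inv_hom_id (HomogeneousLocalization.mk c)
    refine ⟨(Proj.stalkIso (grading k s) (point k α hα)).inv (HomogeneousLocalization.mk c), ?_, ?_⟩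
    · refine stalkValue_twist_injective ?_
      have h := stalkValue_smul (𝒩 := twistDeg k s W j) (pointPrime k α hα)
        ((Proj.stalkIso (grading k s) (point k α hα)).inv (HomogeneousLocalization.mk c)) (g w)
      refine Eq.trans ?_ h.symm
      refine Eq.trans ?_ (congrArg₂ (fun (a : HomogeneousLocalization.AtPrime (grading k s)
        (pointPrime k α hα).asHomogeneousIdeal.toIdeal) (b : LocalizedAt (grading k s)
          (S k s ⊗[k] W) (pointPrime k α hα)) => HomogeneousLocalization.val a • b) hc.symm (hg w).symm)
      rw [hv]
      change _ = HomogeneousLocalization.val (HomogeneousLocalization.mk c) • _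
      rw [HomogeneousLocalization.val_mk]
      refine Eq.trans ?_ (LocalizedModule.mk_smul_mk ..).symm
      rw [LocalizedModule.mk_eq]
      refine ⟨1, ?_⟩
      simp only [one_smul, Submonoid.smul_def, smul_tmul', smul_eq_mul, c, Submonoid.coe_mul]
      congr 1
      ring
    · exact congrArg (evalAt α hα) hc
  refine fibreEval_bijective_of_germ g hadd (fun c w => ?_) (fun v => ?_)
    (c := α i ^ e / α i ^ d) (div_ne_zero (pow_ne_zero _ hi) (pow_ne_zero _ hi)) (fun w => ?_)
  · obtain ⟨r, h, hr⟩ := hfrac d e (MvPolynomial.C c * MvPolynomial.X i ^ e) (MvPolynomial.X i ^ d) w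
      hde (by simpa using SetLike.mul_mem_graded (MvPolynomial.isHomogeneous_C _ c) (hpow e))
      (hpow d) (hx d) (g (c • w)) (by
        rw [hg, tmul_smul, smul_tmul', MvPolynomial.smul_eq_C_mul])
    rw [h, fibreOfGerm_smul, hr]
    congr 1
    simp only [map_mul, map_pow, MvPolynomial.aeval_X, MvPolynomial.aeval_C]
    field_simp
  · obtain ⟨d', n, b, hn, hb, hbx, hv⟩ := exists_stalkValue_eq (𝒩 := twistDeg k s W j)
      (pointPrime k α hα) v
    have key : ∀ n ∈ twistDeg k s W j d', ∀ v : stalkMod (twist k s W j) (point k α hα),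
        stalkValue (twistDeg k s W j) (pointPrime k α hα) v = LocalizedModule.mk n ⟨b, hbx⟩ →
        v ∈ Submodule.span ((ProjSpace k s).presheaf.stalk (point k α hα)) (Set.range g) := by
      refine twistDeg_induction (P := fun n => ∀ v : stalkMod (twist k s W j) (point k α hα),
        stalkValue (twistDeg k s W j) (pointPrime k α hα) v = LocalizedModule.mk n ⟨b, hbx⟩ →
        v ∈ Submodule.span ((ProjSpace k s).presheaf.stalk (point k α hα)) (Set.range g))
        (fun n hn n' hn' h h' v hv => ?_) (fun e' f w he' hf v hv => ?_) ?_
      · have hadd' := (stalkValue (twistDeg k s W j) (pointPrime k α hα)).map_add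
          (fracGerm (twistDeg k s W j) (pointPrime k α hα) hn hb hbx)
          (fracGerm (twistDeg k s W j) (pointPrime k α hα) hn' hb hbx)
        rw [stalkValue_fracGerm, stalkValue_fracGerm, ← localizedModule_mk_add, ← hv] at hadd'
        rw [← stalkValue_twist_injective hadd']
        exact add_mem (h _ (stalkValue_fracGerm ..)) (h' _ (stalkValue_fracGerm ..))
      · obtain ⟨r, rfl, -⟩ := hfrac d' e' f b w he' hf hb hbx v hv
        exact Submodule.smul_mem _ _ (Submodule.subset_span ⟨w, rfl⟩)
      · intro v hv
        rw [LocalizedModule.zero_mk] at hv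
        rw [stalkValue_twist_injective (hv.trans (stalkValue _ _).map_zero.symm)]
        exact zero_mem _
    exact key n hn v hv
  · refine (germEval_fracGerm _ _ _).trans ?_
    rw [evalTensor_tmul, map_pow, map_pow, MvPolynomial.aeval_X, smul_tmul', smul_tmul', smul_eq_mul,
      smul_eq_mul]
    congr 1
    field_simp

end EvaluationBijective

/-! ### Fibres of a contractible complex -/

section FibresOfContraction
open Limits

variable {X : Scheme.{u}} {U : X.Opens} {x : X} {K : Type u} [Field K]
  {S : ShortComplex X.Modules} {H : U.toScheme.Modules}

/-- A contraction of the restriction of a complex to an open set splits the restrictions of the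
inclusion of the cycles and of the projection onto the homology. -/
theorem Contraction.exists_splitting (c : Contraction (S.map (restr U)) H) :
    ∃ (s : (restr U).obj S.X₂ ⟶ (restr U).obj S.X₁) (t : (restr U).obj S.X₃ ⟶ (restr U).obj S.X₂)
      (r : (restr U).obj S.X₂ ⟶ (restr U).obj S.cycles)
      (σ : (restr U).obj S.homology ⟶ (restr U).obj S.cycles),
      (restr U).map S.iCycles ≫ r = 𝟙 _ ∧ σ ≫ (restr U).map S.homologyπ = 𝟙 _ ∧
      r ≫ (restr U).map S.iCycles + (restr U).map S.g ≫ t = 𝟙 _ ∧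
      (restr U).map S.homologyπ ≫ σ + (restr U).map S.iCycles ≫ s ≫ (restr U).map S.toCycles =
        𝟙 _ ∧
      (restr U).map S.f ≫ s ≫ (restr U).map S.f = (restr U).map S.f := by
  let h := (ShortComplex.LeftHomologyData.canonical S).map (restr U)
  have hf : (ShortComplex.LeftHomologyData.canonical S).f' = S.toCycles :=
    (cancel_mono S.iCycles).mp
      ((ShortComplex.LeftHomologyData.canonical S).f'_i.trans S.toCycles_i.symm)
  have hf' : h.f' = (restr U).map S.toCycles :=
    (ShortComplex.LeftHomologyData.map_f' _ _).trans (congrArg (restr U).map hf)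
  refine ⟨c.s, c.t, c.toK h, c.sect h, c.i_toK h, c.sect_π h, ?_, ?_, c.f_s_f⟩
  · exact (congrArg (· + (S.map (restr U)).g ≫ c.t) (c.toK_i h)).trans (sub_add_cancel _ _)
  · have := c.cycles_decomp h
    rw [hf'] at this
    exact this

variable (ev : X.presheaf.stalk x →+* K)

theorem fibreMapOn_comp_apply {F G L : X.Modules} (hx : x ∈ U)
    (ψ : (restr U).obj F ⟶ (restr U).obj G) (ψ' : (restr U).obj G ⟶ (restr U).obj L)
    (z : Fibre ev F) :
    fibreMapOn ev hx (ψ ≫ ψ') z = fibreMapOn ev hx ψ' (fibreMapOn ev hx ψ z) := by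
  rw [fibreMapOn_comp, LinearMap.comp_apply]

theorem fibreMapOn_id_apply {F : X.Modules} (hx : x ∈ U) (z : Fibre ev F) :
    fibreMapOn ev hx (𝟙 ((restr U).obj F)) z = z := by
  rw [fibreMapOn_id, LinearMap.id_apply]

theorem fibreMap_zero {F G : X.Modules} (z : Fibre ev F) : fibreMap ev (0 : F ⟶ G) z = 0 := by
  have hx : x ∈ (⊤ : X.Opens) := trivial
  have h := fibreMapOn_add ev hx (0 : (restr ⊤).obj F ⟶ (restr ⊤).obj G) 0
  rw [add_zero, left_eq_add] at h
  rw [← fibreMapOn_map ev hx, Functor.map_zero, h, LinearMap.zero_apply]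

theorem fibreMap_iCycles_injective (c : Contraction (S.map (restr U)) H) (hx : x ∈ U) :
    Function.Injective (fibreMap ev S.iCycles) := by
  obtain ⟨s, t, r, σ, h, -⟩ := c.exists_splitting
  refine Function.LeftInverse.injective (g := fibreMapOn ev hx r) fun z => ?_
  rw [← fibreMapOn_map ev hx, ← fibreMapOn_comp_apply, h, fibreMapOn_id_apply]

theorem fibreMap_homologyπ_surjective (c : Contraction (S.map (restr U)) H) (hx : x ∈ U) :
    Function.Surjective (fibreMap ev S.homologyπ) := by
  obtain ⟨s, t, r, σ, -, h, -⟩ := c.exists_splitting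
  refine Function.RightInverse.surjective (g := fibreMapOn ev hx σ) fun z => ?_
  rw [← fibreMapOn_map ev hx, ← fibreMapOn_comp_apply, h, fibreMapOn_id_apply]

theorem range_fibreMap_iCycles (c : Contraction (S.map (restr U)) H) (hx : x ∈ U) :
    LinearMap.range (fibreMap ev S.iCycles) = LinearMap.ker (fibreMap ev S.g) := by
  obtain ⟨s, t, r, σ, -, -, h, -⟩ := c.exists_splitting
  refine le_antisymm ?_ fun v hv => ⟨fibreMapOn ev hx r v, ?_⟩
  · rintro _ ⟨z, rfl⟩
    rw [LinearMap.mem_ker, ← fibreMap_comp, S.iCycles_g, fibreMap_zero]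
  · have h' := fibreMapOn_id_apply ev hx v
    rwa [← h, fibreMapOn_add, LinearMap.add_apply, fibreMapOn_comp_apply, fibreMapOn_comp_apply,
      fibreMapOn_map, fibreMapOn_map, LinearMap.mem_ker.mp hv, map_zero, add_zero] at h'

theorem fibreMap_homologyπ_eq_zero_iff (c : Contraction (S.map (restr U)) H) (hx : x ∈ U)
    (z : Fibre ev S.cycles) : fibreMap ev S.homologyπ z = 0 ↔
      fibreMap ev S.iCycles z ∈ LinearMap.range (fibreMap ev S.f) := by
  obtain ⟨s, t, r, σ, -, -, -, h, -⟩ := c.exists_splitting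
  constructor
  · intro hz
    have h' := fibreMapOn_id_apply ev hx z
    rw [← h, fibreMapOn_add, LinearMap.add_apply, fibreMapOn_comp_apply, fibreMapOn_map, hz,
      map_zero, zero_add, fibreMapOn_comp_apply, fibreMapOn_comp_apply, fibreMapOn_map,
      fibreMapOn_map] at h'
    refine ⟨fibreMapOn ev hx s (fibreMap ev S.iCycles z), ?_⟩
    conv_rhs => rw [← h']
    rw [← fibreMap_comp, S.toCycles_i]
  · rintro ⟨a, ha⟩
    have h : z = fibreMap ev S.toCycles a := by
      refine fibreMap_iCycles_injective ev c hx ?_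
      rw [← fibreMap_comp, S.toCycles_i, ha]
    rw [h, ← fibreMap_comp, S.toCycles_comp_homologyπ, fibreMap_zero]

/-- The restriction of the image of `S.f` is a direct summand of the restriction of `S.X₂`. -/
theorem Contraction.exists_imageι_retraction (c : Contraction (S.map (restr U)) H) :
    ∃ s : (restr U).obj S.X₂ ⟶ (restr U).obj S.X₁,
      (restr U).map (image.ι S.f) ≫ s ≫ (restr U).map (factorThruImage S.f) = 𝟙 _ := by
  obtain ⟨s, t, r, σ, -, -, -, -, h⟩ := c.exists_splitting
  refine ⟨s, ?_⟩
  have hfac : (restr U).map (factorThruImage S.f) ≫ (restr U).map (image.ι S.f) =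
      (restr U).map S.f := by rw [← Functor.map_comp, image.fac]
  rw [← cancel_mono ((restr U).map (image.ι S.f)),
    ← cancel_epi ((restr U).map (factorThruImage S.f))]
  simp only [Category.assoc, Category.id_comp, hfac]
  rw [reassoc_of% hfac, h]

theorem fibreMap_imageι_injective (c : Contraction (S.map (restr U)) H) (hx : x ∈ U) :
    Function.Injective (fibreMap ev (image.ι S.f)) := by
  obtain ⟨s, h⟩ := c.exists_imageι_retraction
  refine Function.LeftInverse.injective
    (g := fibreMapOn ev hx (s ≫ (restr U).map (factorThruImage S.f))) fun z => ?_
  rw [← fibreMapOn_map ev hx, ← fibreMapOn_comp_apply, h, fibreMapOn_id_apply]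

theorem range_fibreMap_imageι (c : Contraction (S.map (restr U)) H) (hx : x ∈ U) :
    LinearMap.range (fibreMap ev (image.ι S.f)) = LinearMap.range (fibreMap ev S.f) := by
  obtain ⟨s, h⟩ := c.exists_imageι_retraction
  have hsurj : Function.Surjective (fibreMap ev (factorThruImage S.f)) :=
    Function.RightInverse.surjective
      (g := fibreMapOn ev hx ((restr U).map (image.ι S.f) ≫ s)) fun z => by
        rw [← fibreMapOn_map ev hx, ← fibreMapOn_comp_apply, Category.assoc, h,
          fibreMapOn_id_apply]
  have h : fibreMap ev S.f =
      fibreMap ev (image.ι S.f) ∘ₗ fibreMap ev (factorThruImage S.f) := by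
    refine LinearMap.ext fun z => ?_
    rw [LinearMap.comp_apply, ← fibreMap_comp, image.fac]
  rw [h, LinearMap.range_comp, LinearMap.range_eq_top.mpr hsurj, Submodule.map_top]

end FibresOfContraction

section Subquotients

variable {K L Q E : Type u} [Field K] [AddCommGroup L] [Module K L] [AddCommGroup Q] [Module K Q]
  [AddCommGroup E] [Module K E]

/-- A linear map onto `A`, followed by the projection to a subquotient of `A`, factors through
every quotient with the same kernel. -/
theorem exists_subquotient_equiv {A B : Submodule K E} {i : L →ₗ[K] E} {π : L →ₗ[K] Q}
    (hπ : Function.Surjective π) (hA : LinearMap.range i = A) (hB : ∀ z, π z = 0 ↔ i z ∈ B) :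
    ∃ φ : Q ≃ₗ[K] Subquotient A B, ∀ z, ∃ hv : i z ∈ A,
      φ (π z) = Subquotient.mk A B ⟨i z, hv⟩ := by
  have hi : ∀ z, i z ∈ A := fun z => hA ▸ LinearMap.mem_range_self i z
  let ψ : L →ₗ[K] Subquotient A B := Subquotient.mk A B ∘ₗ i.codRestrict A hi
  have hψ : Function.Surjective ψ := fun y => by
    obtain ⟨⟨v, hv⟩, rfl⟩ := Submodule.mkQ_surjective (B.submoduleOf A) y
    obtain ⟨z, rfl⟩ : v ∈ LinearMap.range i := hA.symm ▸ hv
    exact ⟨z, rfl⟩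
  have hker : LinearMap.ker π = LinearMap.ker ψ := by
    refine Submodule.ext fun z => ?_
    rw [LinearMap.mem_ker, LinearMap.mem_ker, hB]
    exact (Submodule.Quotient.mk_eq_zero (B.submoduleOf A) (x := ⟨i z, hi z⟩)).symm
  refine ⟨(π.quotKerEquivOfSurjective hπ).symm ≪≫ₗ Submodule.quotEquivOfEq _ _ hker ≪≫ₗ
    ψ.quotKerEquivOfSurjective hψ, fun z => ⟨hi z, ?_⟩⟩
  have h : (π.quotKerEquivOfSurjective hπ).symm (π z) = Submodule.Quotient.mk z :=
    (LinearEquiv.symm_apply_eq _).mpr rfl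
  rw [LinearEquiv.trans_apply, LinearEquiv.trans_apply, h]
  rfl

end Subquotients

/-! ### Fibres of `ℱ₁` and `ℱ₂` -/

section Specialization

variable {k : Type u} [Field k] {s : ℕ} {K : Type u} [Field K] [Algebra k K]
  {α : Fin s → K} {hα : α ≠ 0} {M N : SuperMod k s}

theorem fibreEval_theta {p r : ZMod 2} (h : p + 1 = r) {j j' : ℤ} (hj : j + 1 = j')
    (z : Fibre (evalStalk k α hα) (twist k s (M.part p) j)) :
    fibreEval k (M.part r) hα j' (fibreMap (evalStalk k α hα) (theta M h hj) z) =
      M.xAt α h (fibreEval k (M.part p) hα j z) := by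
  refine fibreEval_fibreMap (koszulLin fun i => M.xPart i h) (koszulLin_mem _ hj) _ (fun n => ?_)
    rfl z
  induction n using TensorProduct.induction_on with
  | zero => simp only [map_zero]
  | add n n' h h' => simp only [map_add, h, h']
  | tmul f m =>
    rw [koszulLin_tmul, map_sum, evalTensor_tmul, SuperMod.xAt, LinearMap.sum_apply]
    refine Finset.sum_congr rfl fun i _ => ?_
    rw [evalTensor_tmul, map_mul, MvPolynomial.aeval_X, LinearMap.smul_apply,
      LinearMap.baseChange_tmul, smul_tmul', smul_eq_mul]

theorem fibreEval_twistMap {W W' : Type u} [AddCommGroup W] [Module k W] [AddCommGroup W']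
    [Module k W'] (g : W →ₗ[k] W') (j : ℤ) (z : Fibre (evalStalk k α hα) (twist k s W j)) :
    fibreEval k W' hα j (fibreMap (evalStalk k α hα) (twistMap g j) z) =
      g.baseChange K (fibreEval k W hα j z) := by
  refine fibreEval_fibreMap (g.baseChange (S k s)) _ _ (fun n => ?_) rfl z
  induction n using TensorProduct.induction_on with
  | zero => simp only [map_zero]
  | add n n' h h' => simp only [map_add, h, h']
  | tmul f m => rfl

/-- Evaluation at `α` on the fibre at `ᾱ` of the kernel of `θ_M`. -/
def kerThetaEval (M : SuperMod k s) (hα : α ≠ 0) (q : ZMod 2) :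
    Fibre (evalStalk k α hα) (kerTheta M q) →ₗ[K] K ⊗[k] M.part q :=
  fibreEval k (M.part q) hα 0 ∘ₗ fibreMap (evalStalk k α hα) (kerThetaι M q)

/-- Evaluation at `α` on the fibre at `ᾱ` of `ℱ₂(M)`. -/
def F₂Eval (M : SuperMod k s) (hα : α ≠ 0) (q : ZMod 2) :
    Fibre (evalStalk k α hα) (F₂ M q) →ₗ[K] K ⊗[k] M.part q :=
  fibreEval k (M.part q) hα 0 ∘ₗ fibreMap (evalStalk k α hα) (F₂ι M q)

theorem fibreEval_mem_imAt_iff {q : ZMod 2}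
    (z : Fibre (evalStalk k α hα) (twist k s (M.part q) 0)) :
    fibreEval k (M.part q) hα 0 z ∈ M.imAt α q ↔
      z ∈ LinearMap.range (fibreMap (evalStalk k α hα) (thetaComplex M q).f) := by
  constructor
  · rintro ⟨w, hw⟩
    obtain ⟨y, rfl⟩ := (fibreEval_bijective k (M.part (q + 1)) hα (-1)).2 w
    refine ⟨y, (fibreEval_bijective k (M.part q) hα 0).1 ?_⟩
    exact (fibreEval_theta (M := M) (add_one_add_one q) rfl y).trans hw
  · rintro ⟨y, rfl⟩
    exact ⟨_, (fibreEval_theta (M := M) (add_one_add_one q) rfl y).symm⟩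

theorem fibreEval_mem_kerAt_iff {q : ZMod 2}
    (z : Fibre (evalStalk k α hα) (twist k s (M.part q) 0)) :
    fibreEval k (M.part q) hα 0 z ∈ M.kerAt α q ↔
      z ∈ LinearMap.ker (fibreMap (evalStalk k α hα) (thetaComplex M q).g) := by
  have h := fibreEval_theta (M := M) (p := q) (r := q + 1) rfl (j := 0) (j' := 1) rfl z
  refine (Iff.of_eq (congrArg (· = 0) h)).symm.trans ?_
  exact map_eq_zero_iff _ (fibreEval_bijective k (M.part (q + 1)) hα 1).1

variable {U : (ProjSpace k s).Opens} {q : ZMod 2} {H : U.toScheme.Modules}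

/-- Near `ᾱ` the kernel of `θ_M` is a direct summand of `M̃`, hence evaluation at `α` maps its
fibre isomorphically onto `Ker x_α`; an element of this fibre is zero in the fibre of `ℱ₁(M)` if and
only if it comes from the fibre of `M̃(-1)`, that is, if its value lies in `Im x_α`. -/
theorem exists_isSpecialization₁ (c : Contraction ((thetaComplex M q).map (restr U)) H)
    (hU : point k α hα ∈ U) :
    ∃ φ : Fibre (evalStalk k α hα) (F₁ M q) ≃ₗ[K] M.F₁At α q,
      ∀ z, ∃ hv : kerThetaEval M hα q z ∈ M.kerAt α q,
        φ (fibreMap (evalStalk k α hα) (F₁π M q) z) =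
          Subquotient.mk (M.kerAt α q) (M.imAt α q) ⟨kerThetaEval M hα q z, hv⟩ := by
  refine exists_subquotient_equiv (fibreMap_homologyπ_surjective _ c hU) ?_ fun z => ?_
  · have h := range_fibreMap_iCycles (evalStalk k α hα) c hU
    refine Submodule.ext fun v => ?_
    obtain ⟨y, rfl⟩ := (fibreEval_bijective k (M.part q) hα 0).2 v
    rw [fibreEval_mem_kerAt_iff, ← h]
    constructor
    · rintro ⟨z, hz⟩
      exact ⟨z, (fibreEval_bijective k (M.part q) hα 0).1 hz⟩
    · rintro ⟨z, rfl⟩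
      exact ⟨z, rfl⟩
  · exact (fibreMap_homologyπ_eq_zero_iff _ c hU z).trans (fibreEval_mem_imAt_iff _).symm

/-- Near `ᾱ` the image of `θ_M` is a direct summand of `M̃`, hence its fibre is contained in that
of `M̃`, and evaluation at `α` maps it onto `Im x_α`. -/
theorem exists_isSpecialization₂ (c : Contraction ((thetaComplex M q).map (restr U)) H)
    (hU : point k α hα ∈ U) :
    ∃ φ : Fibre (evalStalk k α hα) (F₂ M q) ≃ₗ[K] M.imAt α q, ∀ z, (φ z).1 = F₂Eval M hα q z := by
  have hinj : Function.Injective (F₂Eval M hα q) :=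
    (fibreEval_bijective k (M.part q) hα 0).1.comp (fibreMap_imageι_injective _ c hU)
  have hr : LinearMap.range (F₂Eval M hα q) = M.imAt α q := by
    have h := range_fibreMap_imageι (evalStalk k α hα) c hU
    refine Submodule.ext fun v => ?_
    obtain ⟨y, rfl⟩ := (fibreEval_bijective k (M.part q) hα 0).2 v
    rw [fibreEval_mem_imAt_iff, ← h]
    constructor
    · rintro ⟨z, hz⟩
      exact ⟨z, (fibreEval_bijective k (M.part q) hα 0).1 hz⟩
    · rintro ⟨z, rfl⟩
      exact ⟨z, rfl⟩
  exact ⟨LinearEquiv.ofInjective _ hinj ≪≫ₗ LinearEquiv.ofEq _ _ hr, fun z => rfl⟩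

theorem kerThetaEval_eq (z : Fibre (evalStalk k α hα) (kerTheta M q)) (v : K ⊗[k] M.part q)
    (h : fibreMap (evalStalk k α hα) (kerThetaι M q) z = constMap k (M.part q) α hα v) :
    kerThetaEval M hα q z = v := by
  rw [kerThetaEval, LinearMap.comp_apply, h, fibreEval_constMap]

theorem F₂Eval_eq (z : Fibre (evalStalk k α hα) (F₂ M q)) (v : K ⊗[k] M.part q)
    (h : fibreMap (evalStalk k α hα) (F₂ι M q) z = constMap k (M.part q) α hα v) :
    F₂Eval M hα q z = v := by
  rw [F₂Eval, LinearMap.comp_apply, h, fibreEval_constMap]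

variable {a_ev a_od a₂ b_ev b_od b₂ : ℕ}

/-- Near each point, the complex of sheaves given by `θ_M` is contractible onto its homology. -/
theorem SuperMod.HasConstantJordanType.exists_contraction_part [IsAlgClosed k]
    (hM : M.HasConstantJordanType a_ev a_od a₂) (x : ProjSpace k s) (q : ZMod 2) :
    ∃ (U : (ProjSpace k s).Opens) (_ : x ∈ U) (H : U.toScheme.Modules),
      Nonempty (Contraction ((thetaComplex M q).map (restr U)) H) := by
  obtain ⟨U, hU, h0, h1, -⟩ := hM.exists_contraction x
  obtain rfl | rfl := zmod_two_cases q
  · exact ⟨U, hU, _, h0⟩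
  · exact ⟨U, hU, _, h1⟩

theorem exists_F₁_square [IsAlgClosed k] (hM : M.HasConstantJordanType a_ev a_od a₂)
    (hN : N.HasConstantJordanType b_ev b_od b₂) {p : ZMod 2} (f : HomogMap p M N) (hα : α ≠ 0)
    {q r : ZMod 2} (h : q + p = r) :
    ∃ (φ : Fibre (evalStalk k α hα) (F₁ M q) ≃ₗ[K] M.F₁At α q)
      (ψ : Fibre (evalStalk k α hα) (F₁ N r) ≃ₗ[K] N.F₁At α r),
      IsSpecialization₁ M α hα q φ ∧ IsSpecialization₁ N α hα r ψ ∧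
        ∀ z, ψ (fibreMap (evalStalk k α hα) (F₁map f h) z) = f.F₁At α h (φ z) := by
  obtain ⟨U, hU, _, ⟨c⟩⟩ := hM.exists_contraction_part (point k α hα) q
  obtain ⟨U', hU', _, ⟨c'⟩⟩ := hN.exists_contraction_part (point k α hα) r
  obtain ⟨φ, hφ⟩ := exists_isSpecialization₁ c hU
  obtain ⟨ψ, hψ⟩ := exists_isSpecialization₁ c' hU'
  refine ⟨φ, ψ, fun z v hz => ?_, fun z v hz => ?_, fun z => ?_⟩
  · obtain rfl := kerThetaEval_eq z v hz
    exact hφ z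
  · obtain rfl := kerThetaEval_eq z v hz
    exact hψ z
  · obtain ⟨y, rfl⟩ := fibreMap_homologyπ_surjective (evalStalk k α hα) c hU z
    obtain ⟨hv, hy⟩ := hφ y
    let y' : Fibre (evalStalk k α hα) (kerTheta N r) :=
      fibreMap (evalStalk k α hα) (ShortComplex.cyclesMap (thetaComplexMap f h)) y
    obtain ⟨hv', hy'⟩ := hψ y'
    have e1 : fibreMap (evalStalk k α hα) (F₁map f h)
        (fibreMap (evalStalk k α hα) (thetaComplex M q).homologyπ y) =
        fibreMap (evalStalk k α hα) (F₁π N r) y' := by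
      refine (fibreMap_comp _ _ _ y).symm.trans ?_
      refine Eq.trans ?_ (fibreMap_comp _ _ _ y)
      exact congrArg (fun χ => fibreMap (evalStalk k α hα) χ y)
        (ShortComplex.homologyπ_naturality (thetaComplexMap f h))
    have e2 : kerThetaEval N hα r y' =
        (f.part h).baseChange K (kerThetaEval M hα q y) := by
      refine Eq.trans ?_ (fibreEval_twistMap (f.part h) 0 _)
      refine congrArg (fibreEval k (N.part r) hα 0) ?_
      refine (fibreMap_comp _ _ _ y).symm.trans ?_
      refine Eq.trans ?_ (fibreMap_comp _ _ _ y)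
      exact congrArg (fun χ => fibreMap (evalStalk k α hα) χ y)
        (ShortComplex.cyclesMap_i (thetaComplexMap f h))
    rw [e1, hy']
    refine Eq.trans ?_ (congrArg (f.F₁At α h) hy).symm
    exact congrArg (Subquotient.mk (N.kerAt α r) (N.imAt α r)) (Subtype.ext e2)

theorem exists_F₂_square [IsAlgClosed k] (hM : M.HasConstantJordanType a_ev a_od a₂)
    (hN : N.HasConstantJordanType b_ev b_od b₂) {p : ZMod 2} (f : HomogMap p M N) (hα : α ≠ 0)
    {q r : ZMod 2} (h : q + p = r) :
    ∃ (φ : Fibre (evalStalk k α hα) (F₂ M q) ≃ₗ[K] M.imAt α q)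
      (ψ : Fibre (evalStalk k α hα) (F₂ N r) ≃ₗ[K] N.imAt α r),
      IsSpecialization₂ M α hα q φ ∧ IsSpecialization₂ N α hα r ψ ∧
        ∀ z, ψ (fibreMap (evalStalk k α hα) (F₂map f h) z) = f.imAt α h (φ z) := by
  obtain ⟨U, hU, _, ⟨c⟩⟩ := hM.exists_contraction_part (point k α hα) q
  obtain ⟨U', hU', _, ⟨c'⟩⟩ := hN.exists_contraction_part (point k α hα) r
  obtain ⟨φ, hφ⟩ := exists_isSpecialization₂ c hU
  obtain ⟨ψ, hψ⟩ := exists_isSpecialization₂ c' hU'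
  refine ⟨φ, ψ, fun z v hz => ?_, fun z v hz => ?_, fun z => ?_⟩
  · rw [hφ, F₂Eval_eq z v hz]
  · rw [hψ, F₂Eval_eq z v hz]
  · refine Subtype.ext ((hψ _).trans ?_)
    refine Eq.trans ?_ (congrArg ((f.part h).baseChange K) (hφ z)).symm
    refine Eq.trans ?_ (fibreEval_twistMap (f.part h) 0 _)
    refine congrArg (fibreEval k (N.part r) hα 0) ?_
    refine (fibreMap_comp _ _ _ z).symm.trans ?_
    refine Eq.trans ?_ (fibreMap_comp _ _ _ z)
    exact congrArg (fun χ => fibreMap (evalStalk k α hα) χ z) (Limits.image.map_ι _)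

end Specialization

/-! ### Closed points -/

section SubquotientEquiv

variable {K V₁ V₂ V₃ W₁ W₂ W₃ : Type u} [Field K] [AddCommGroup V₁] [Module K V₁]
  [AddCommGroup V₂] [Module K V₂] [AddCommGroup V₃] [Module K V₃] [AddCommGroup W₁] [Module K W₁]
  [AddCommGroup W₂] [Module K W₂] [AddCommGroup W₃] [Module K W₃]

theorem nonempty_subquotient_equiv {f : V₁ →ₗ[K] V₂} {g : V₂ →ₗ[K] V₃} {f' : W₁ →ₗ[K] W₂}
    {g' : W₂ →ₗ[K] W₃} (e₁ : V₁ ≃ₗ[K] W₁) (e₂ : V₂ ≃ₗ[K] W₂) (e₃ : V₃ ≃ₗ[K] W₃)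
    (hf : ∀ v, e₂ (f v) = f' (e₁ v)) (hg : ∀ v, e₃ (g v) = g' (e₂ v)) :
    Nonempty (Subquotient (LinearMap.ker g) (LinearMap.range f) ≃ₗ[K]
      Subquotient (LinearMap.ker g') (LinearMap.range f')) := by
  have hsurj : Function.Surjective (Subquotient.mk (LinearMap.ker g) (LinearMap.range f)) :=
    Submodule.mkQ_surjective ((LinearMap.range f).submoduleOf (LinearMap.ker g))
  have hA : LinearMap.range (e₂.toLinearMap ∘ₗ (LinearMap.ker g).subtype) = LinearMap.ker g' := by
    refine Submodule.ext fun v => ⟨?_, fun hv => ?_⟩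
    · rintro ⟨⟨z, hz⟩, rfl⟩
      change g' (e₂ z) = 0
      rw [← hg, LinearMap.mem_ker.mp hz, map_zero]
    · refine ⟨⟨e₂.symm v, e₃.injective ?_⟩, e₂.apply_symm_apply v⟩
      rw [hg, e₂.apply_symm_apply, map_zero, LinearMap.mem_ker.mp hv]
  have hB (z : LinearMap.ker g) : Subquotient.mk (LinearMap.ker g) (LinearMap.range f) z = 0 ↔
      (e₂.toLinearMap ∘ₗ (LinearMap.ker g).subtype) z ∈ LinearMap.range f' := by
    refine (Submodule.Quotient.mk_eq_zero ((LinearMap.range f).submoduleOf (LinearMap.ker g))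
      (x := z)).trans ⟨?_, ?_⟩
    · rintro ⟨w, hw⟩
      exact ⟨e₁ w, (hf w).symm.trans (congrArg e₂ hw)⟩
    · rintro ⟨w, hw⟩
      refine ⟨e₁.symm w, e₂.injective ?_⟩
      rw [hf, e₁.apply_symm_apply]
      exact hw
  obtain ⟨φ, -⟩ := exists_subquotient_equiv hsurj hA hB
  exact ⟨φ⟩

theorem nonempty_range_equiv {f : V₁ →ₗ[K] V₂} {f' : W₁ →ₗ[K] W₂} (e₁ : V₁ ≃ₗ[K] W₁)
    (e₂ : V₂ ≃ₗ[K] W₂) (hf : ∀ v, e₂ (f v) = f' (e₁ v)) :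
    Nonempty (LinearMap.range f ≃ₗ[K] LinearMap.range f') := by
  refine ⟨e₂.submoduleMap (LinearMap.range f) ≪≫ₗ LinearEquiv.ofEq _ _ ?_⟩
  refine Submodule.ext fun v => ⟨?_, ?_⟩
  · rintro ⟨_, ⟨w, rfl⟩, rfl⟩
    exact ⟨e₁ w, (hf w).symm⟩
  · rintro ⟨w, rfl⟩
    exact ⟨_, ⟨e₁.symm w, rfl⟩, (hf _).trans (by rw [e₁.apply_symm_apply])⟩

end SubquotientEquiv

section ClosedPoints

variable {k : Type u} [Field k] {s : ℕ} {M : SuperMod k s} {α : Fin s → k}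
  {a_ev a_od a₂ : ℕ}

theorem lid_xAt {p r : ZMod 2} (h : p + 1 = r) (v : k ⊗[k] M.part p) :
    TensorProduct.lid k (M.part r) (M.xAt α h v) =
      M.xElem α h (TensorProduct.lid k (M.part p) v) := by
  induction v using TensorProduct.induction_on with
  | zero => simp only [map_zero]
  | add v v' h h' => simp only [map_add, h, h']
  | tmul c m =>
    rw [xElem_eq_sum, SuperMod.xAt, LinearMap.sum_apply, LinearMap.sum_apply, map_sum]
    refine Finset.sum_congr rfl fun i _ => ?_
    rw [LinearMap.smul_apply, LinearMap.baseChange_tmul, map_smul, TensorProduct.lid_tmul,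
      TensorProduct.lid_tmul, LinearMap.smul_apply, map_smul]

/-- For `α ∈ k^s`, the space `ℱ_{1,α}(M)` is `M_{x_α}`. -/
theorem nonempty_F₁At_equiv (M : SuperMod k s) (α : Fin s → k) (q : ZMod 2) :
    Nonempty (M.F₁At α q ≃ₗ[k] M.MxPart α q) :=
  nonempty_subquotient_equiv (TensorProduct.lid k (M.part (q + 1))) (TensorProduct.lid k (M.part q))
    (TensorProduct.lid k (M.part (q + 1))) (lid_xAt (add_one_add_one q)) (lid_xAt rfl)

theorem nonempty_fibre_F₁_equiv [IsAlgClosed k] (hM : M.HasConstantJordanType a_ev a_od a₂)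
    (hα : α ≠ 0) (q : ZMod 2) :
    Nonempty (Fibre (evalStalk k α hα) (F₁ M q) ≃ₗ[k] M.MxPart α q) := by
  obtain ⟨U, hU, _, ⟨c⟩⟩ := hM.exists_contraction_part (point k α hα) q
  obtain ⟨φ, -⟩ := exists_isSpecialization₁ c hU
  obtain ⟨e⟩ := nonempty_F₁At_equiv M α q
  exact ⟨φ ≪≫ₗ e⟩

theorem nonempty_fibre_F₂_equiv_socle [IsAlgClosed k] (hM : M.HasConstantJordanType a_ev a_od a₂)
    (hα : α ≠ 0) (D : M.JordanDecomposition α a_ev a_od a₂) :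
    Nonempty ((Fibre (evalStalk k α hα) (F₂ M 0) × Fibre (evalStalk k α hα) (F₂ M 1)) ≃ₗ[k]
      M.socle α D.projectivePart) := by
  have hF (q : ZMod 2) : Nonempty (Fibre (evalStalk k α hα) (F₂ M q) ≃ₗ[k]
      LinearMap.range (M.xElem α (add_one_add_one q))) := by
    obtain ⟨U, hU, _, ⟨c⟩⟩ := hM.exists_contraction_part (point k α hα) q
    obtain ⟨φ, -⟩ := exists_isSpecialization₂ c hU
    obtain ⟨e⟩ := nonempty_range_equiv (TensorProduct.lid k (M.part (q + 1)))
      (TensorProduct.lid k (M.part q)) (lid_xAt (α := α) (add_one_add_one q))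
    exact ⟨φ ≪≫ₗ e⟩
  obtain ⟨φ₀⟩ := hF 0
  obtain ⟨φ₁⟩ := hF 1
  have : FiniteDimensional k M.carrier := M.finiteDimensional
  refine ⟨(φ₀.prodCongr φ₁) ≪≫ₗ LinearEquiv.ofFinrankEq _ _ ?_⟩
  rw [Module.finrank_prod, D.finrank_socle]
  exact D.finrank_range_xElem_add _ _ rfl

end ClosedPoints

/-! ### Functoriality -/

section Functoriality
open Limits

variable {k : Type u} [Field k] {s : ℕ} {M N L : SuperMod k s}

theorem part_id {q : ZMod 2} (h : q + 0 = q) : (HomogMap.id M).part h = LinearMap.id := rfl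

theorem part_comp {p p' : ZMod 2} (f : HomogMap p M N) (g : HomogMap p' N L) {q r t : ZMod 2}
    (h : q + p = r) (h' : r + p' = t) (h'' : q + (p + p') = t) :
    (g.comp f).part h'' = g.part h' ∘ₗ f.part h := rfl

theorem neg_one_pow_val_add (p p' : ZMod 2) :
    (-1 : k) ^ (p + p').val = (-1) ^ p'.val * (-1) ^ p.val := by
  have key : ∀ p p' : ZMod 2, (p + p').val % 2 = (p'.val + p.val) % 2 := by decide
  rw [← pow_add, neg_one_pow_eq_pow_mod_two, key, ← neg_one_pow_eq_pow_mod_two]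

theorem twistMap_smul_part_comp {p p' : ZMod 2} (f : HomogMap p M N) (g : HomogMap p' N L)
    {q r t : ZMod 2} (h : q + p = r) (h' : r + p' = t) (h'' : q + (p + p') = t) (j : ℤ) :
    twistMap (s := s) ((-1 : k) ^ (p + p').val • (g.comp f).part h'') j =
      twistMap (s := s) ((-1 : k) ^ p.val • f.part h) j ≫
        twistMap (s := s) ((-1 : k) ^ p'.val • g.part h') j := by
  rw [twistMap_comp, LinearMap.smul_comp, LinearMap.comp_smul, smul_smul, neg_one_pow_val_add,
    part_comp]

theorem thetaComplexMap_id (M : SuperMod k s) {q : ZMod 2} (h : q + 0 = q) :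
    thetaComplexMap (HomogMap.id M) h = 𝟙 (thetaComplex M q) := by
  have h1 (q : ZMod 2) (h : q + 0 = q) (j : ℤ) :
      twistMap (s := s) ((-1 : k) ^ (0 : ZMod 2).val • (HomogMap.id M).part h) j = 𝟙 _ := by
    rw [ZMod.val_zero, pow_zero, one_smul, part_id, twistMap_id]
  exact ShortComplex.hom_ext _ _ (h1 _ _ _) (twistMap_id 0) (h1 _ _ _)

theorem thetaComplexMap_comp {p p' : ZMod 2} (f : HomogMap p M N) (g : HomogMap p' N L)
    {q r t : ZMod 2} (h : q + p = r) (h' : r + p' = t) (h'' : q + (p + p') = t) :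
    thetaComplexMap (g.comp f) h'' = thetaComplexMap f h ≫ thetaComplexMap g h' :=
  ShortComplex.hom_ext _ _ (twistMap_smul_part_comp f g _ _ _ _)
    (twistMap_comp (f.part h) (g.part h') 0).symm (twistMap_smul_part_comp f g _ _ _ _)

theorem F₁map_id (M : SuperMod k s) {q : ZMod 2} (h : q + 0 = q) :
    F₁map (HomogMap.id M) h = 𝟙 (F₁ M q) := by
  rw [F₁map, thetaComplexMap_id]
  exact ShortComplex.homologyMap_id (thetaComplex M q)

theorem F₁map_comp {p p' : ZMod 2} (f : HomogMap p M N) (g : HomogMap p' N L)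
    {q r t : ZMod 2} (h : q + p = r) (h' : r + p' = t) (h'' : q + (p + p') = t) :
    F₁map (g.comp f) h'' = F₁map f h ≫ F₁map g h' := by
  rw [F₁map, thetaComplexMap_comp f g h h' h'']
  exact ShortComplex.homologyMap_comp (thetaComplexMap f h) (thetaComplexMap g h')

/-- `F₂map` is the restriction of `f ⊗ id` to images; the lemmas `F₂map_id` and `F₂map_comp` follow
because `F₂ι` is a monomorphism. -/
theorem F₂map_ι {p : ZMod 2} (f : HomogMap p M N) {q r : ZMod 2} (h : q + p = r) :
    F₂map f h ≫ F₂ι N r = F₂ι M q ≫ twistMap (f.part h) 0 :=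
  image.map_ι _

instance (M : SuperMod k s) (q : ZMod 2) : Mono (F₂ι M q) :=
  inferInstanceAs (Mono (image.ι (thetaComplex M q).f))

theorem F₂map_id (M : SuperMod k s) {q : ZMod 2} (h : q + 0 = q) :
    F₂map (HomogMap.id M) h = 𝟙 (F₂ M q) := by
  rw [← cancel_mono (F₂ι M q), F₂map_ι, part_id, twistMap_id, Category.comp_id, Category.id_comp]

theorem F₂map_comp {p p' : ZMod 2} (f : HomogMap p M N) (g : HomogMap p' N L)
    {q r t : ZMod 2} (h : q + p = r) (h' : r + p' = t) (h'' : q + (p + p') = t) :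
    F₂map (g.comp f) h'' = F₂map f h ≫ F₂map g h' := by
  rw [← cancel_mono (F₂ι L t), Category.assoc, F₂map_ι, F₂map_ι, ← Category.assoc, F₂map_ι,
    Category.assoc, twistMap_comp, part_comp f g h h' h'']

end Functoriality

end SuperBundle

end

theorem mainTheorem3 {k : Type u} [Field k] [IsAlgClosed k] [CharZero k] (s : ℕ) :
    -- the bundles and their fibres at the closed points
    (∀ (M : SuperMod k s) (a_ev a_od a₂ : ℕ), M.HasConstantJordanType a_ev a_od a₂ →
      (IsSuperVectorBundle (F₁ M) a_ev a_od ∧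
        ∀ (α : Fin s → k) (hα : α ≠ 0) (q : ZMod 2),
          Nonempty (Fibre (evalStalk k α hα) (F₁ M q) ≃ₗ[k] M.MxPart α q)) ∧
      (IsVectorBundle (F₂ M 0 ⊞ F₂ M 1) a₂ ∧
        ∀ (α : Fin s → k) (hα : α ≠ 0) (D : M.JordanDecomposition α a_ev a_od a₂),
          Nonempty ((Fibre (evalStalk k α hα) (F₂ M 0) × Fibre (evalStalk k α hα) (F₂ M 1)) ≃ₗ[k]
            M.socle α D.projectivePart))) ∧
    -- functoriality
    ((∀ (M : SuperMod k s) (q : ZMod 2) (h : q + 0 = q),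
        F₁map (HomogMap.id M) h = 𝟙 (F₁ M q) ∧ F₂map (HomogMap.id M) h = 𝟙 (F₂ M q)) ∧
      (∀ (M N L : SuperMod k s) (p p' : ZMod 2) (f : HomogMap p M N) (g : HomogMap p' N L)
        (q r t : ZMod 2) (h : q + p = r) (h' : r + p' = t) (h'' : q + (p + p') = t),
        F₁map (g.comp f) h'' = F₁map f h ≫ F₁map g h' ∧
          F₂map (g.comp f) h'' = F₂map f h ≫ F₂map g h')) ∧
    -- compatibility with the specialization to the fibres
    (∀ (M N : SuperMod k s) (a_ev a_od a₂ b_ev b_od b₂ : ℕ),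
      M.HasConstantJordanType a_ev a_od a₂ → N.HasConstantJordanType b_ev b_od b₂ →
      ∀ (p : ZMod 2) (f : HomogMap p M N) (K : Type u) [Field K] [Algebra k K] (α : Fin s → K)
        (hα : α ≠ 0) (q r : ZMod 2) (h : q + p = r),
        (∃ (φ : Fibre (evalStalk k α hα) (F₁ M q) ≃ₗ[K] M.F₁At α q)
          (ψ : Fibre (evalStalk k α hα) (F₁ N r) ≃ₗ[K] N.F₁At α r),
          IsSpecialization₁ M α hα q φ ∧ IsSpecialization₁ N α hα r ψ ∧
            ∀ z, ψ (fibreMap (evalStalk k α hα) (F₁map f h) z) = f.F₁At α h (φ z)) ∧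
        (∃ (φ : Fibre (evalStalk k α hα) (F₂ M q) ≃ₗ[K] M.imAt α q)
          (ψ : Fibre (evalStalk k α hα) (F₂ N r) ≃ₗ[K] N.imAt α r),
          IsSpecialization₂ M α hα q φ ∧ IsSpecialization₂ N α hα r ψ ∧
            ∀ z, ψ (fibreMap (evalStalk k α hα) (F₂map f h) z) = f.imAt α h (φ z))) :=
  ⟨fun M _ _ _ hM =>
    ⟨⟨hM.isSuperVectorBundle_F₁, fun _ hα q => nonempty_fibre_F₁_equiv hM hα q⟩,
      hM.isVectorBundle_F₂, fun _ hα D => nonempty_fibre_F₂_equiv_socle hM hα D⟩,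
    ⟨fun M _ h => ⟨F₁map_id M h, F₂map_id M h⟩,
      fun _ _ _ _ _ f g _ _ _ h h' h'' => ⟨F₁map_comp f g h h' h'', F₂map_comp f g h h' h''⟩⟩,
    fun _ _ _ _ _ _ _ _ hM hN _ f _ _ _ _ hα _ _ h =>
      ⟨exists_F₁_square hM hN f hα h, exists_F₂_square hM hN f hα h⟩⟩
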